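/- **Setting.** Let $R$ be a commutative $\mathbf{C}$-algebra that is formally smooth and essentially of finite type over $\mathbf{C}$ (for instance the coordinate ring of a smooth affine variety), $S=\operatorname{Spec}R$, and let $D_R\subseteq\operatorname{End}_{\mathbf C}(R)$ be the subring generated by $R$ and $\operatorname{Der}_{\mathbf C}(R)$. For $j=1,\dots,r$ let $f_j=\sum_{i=1}^{\delta_j}\lambda_{j,i}x^{d_{j,i}}\in R[x_1,\dots,x_N]$ with $\lambda_{j,i}\in R$, $d_{j,i}\in\mathbf N^N$. Put $B=R[x_1,\dots,x_N]/(f_1,\dots,f_r)$ and $Y=\operatorname{Spec}B$. **The ideals.** Let $\{\mu_{j,i}\}$ be indeterminates, $\mathbf C[\mu]$ the polynomial ring in them, $D_{\mathbf C[\mu]}$ the ring of differential operators in the $\partial/\partial\mu_{j,i}$ with polynomial coefficients, and $e_1,\dots,e_r$ the unit vectors of $\mathbf Z^r$. Let $E$ be the group of all integer vectors $b=(b_{j,i})$ with $\sum_{j,i} b_{j,i}(d_{j,i},e_j)=0$, and set $$\Box_b=\prod_{b_{j,i}>0}\Big(\frac{\partial}{\partial\mu_{j,i}}\Big)^{b_{j,i}}-\prod_{b_{j,i}<0}\Big(\frac{\partial}{\partial\mu_{j,i}}\Big)^{-b_{j,i}}\quad(b\in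 E),$$ $$Z_k=\sum_{j,i}d_{j,i}(k)\,\mu_{j,i}\frac{\partial}{\partial\mu_{j,i}}\ (1\le k\le N),\qquad Z_{N+k}=\sum_{i}\mu_{k,i}\frac{\partial}{\partial\mu_{k,i}}\ (1\le k\le r).$$ For $u\in\mathbf N^N$, $v\in\mathbf N^r$ let $I(u,v)\subseteq D_{\mathbf C[\mu]}$ be the left ideal generated by all $\Box_b$ ($b\in E$), all $Z_k+u_k+1$ ($1\le k\le N$) and all $Z_{N+k}+v_k+1$ ($1\le k\le r$). View $R$ as a $\mathbf C[\mu]$-algebra by $\mu_{j,i}\mapsto\lambda_{j,i}$. The $R$-module $(D_{\mathbf C[\mu]})^*=R\otimes_{\mathbf C[\mu]}D_{\mathbf C[\mu]}$ is a $D_R$-module, where $\partial\in\operatorname{Der}_{\mathbf C}(R)$ acts by $$\partial(e\otimes m)=\partial(e)\otimes m+\sum_{j,i}e\,\partial(\lambda_{j,i})\otimes\frac{\partial}{\partial\mu_{j,i}}m .$$ Let $I_R(u,v)$ be the left ideal of all $L\in D_R$ such that $L\cdot(1\otimes1)$ lies in the image of $R\otimes_{\mathbf C[\mu]}I(u,v)$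 in $(D_{\mathbf C[\mu]})^*$. **Statement.** Suppose that $f_1,\dots,f_r$ define a smooth complete intersection $Y\subseteq\mathbf A^N_R$, i.e. $Y$ is smooth over $S$ of relative dimension $N-r$ at each of its points. Let $u\in\mathbf N^N$. Then: 1. There is a unique form $\omega_u\in\Omega^{N-r}_{B/R}$ such that for every subset $\sigma=\{i_1<\dots<i_r\}\subseteq\{1,\dots,N\}$, with $J_\sigma=\det[\partial f_j/\partial x_{i_k}]_{j,k}$, its restriction to the open subset of $Y$ where $J_\sigma$ is invertible is $$\frac{(\operatorname{sgn}\sigma)\,x^u}{J_\sigma}\,dx_1\wedge\cdots\wedge\widehat{dx_{i_1}}\wedge\cdots\wedge\widehat{dx_{i_r}}\wedge\cdots\wedge dx_N,$$ where $\operatorname{sgn}\sigma=\pm1$ is chosen so that $(\operatorname{sgn}\sigma)\,dx_1\wedge\cdots\widehat{dx_{i_1}}\cdots\widehat{dx_{i_r}}\cdots\wedge dx_N\wedge dx_{i_1}\wedge\cdots\wedge dx_{i_r}=dx_1\wedge\cdots\wedge dx_N$. The form $\omega_u$ is closed. 2. Let $D_R$ act on the relative algebraic de Rham cohomology $H^{N-r}_{DR}(Y/S)$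 through the Gauss–Manin connection (a derivation $\partial$ of $R$ acts by $[\omega]\mapsto[\mathcal L_\theta\omega]$, for any derivation $\theta$ of $B$ that lifts $\partial$). Then $L\,[\omega_u]=0$ in $H^{N-r}_{DR}(Y/S)$ for every $L\in I_R(u,0)$. -/

import Mathlib

open scoped TensorProduct

noncomputable section

namespace RelDeRham

section DiffOps

/-- The ring `D_R` of `K`-linear differential operators: the subring of `End_K R` generated by the
multiplications by elements of `R` and the `K`-linear derivations of `R`. -/
def diffOps (K R : Type*) [CommRing K] [CommRing R] [Algebra K R] :
    Subalgebra K (Module.End K R) :=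
  Algebra.adjoin K (Set.range (Algebra.lmul K R) ∪
    Set.range fun τ : Derivation K R R => (τ : R →ₗ[K] R))

/-- Multiplication by `r` as a differential operator. -/
def mulOp (K : Type*) {R : Type*} [CommRing K] [CommRing R] [Algebra K R] (r : R) :
    diffOps K R := ⟨Algebra.lmul K R r, Algebra.subset_adjoin (Or.inl ⟨r, rfl⟩)⟩

/-- A derivation as a differential operator. -/
def derOp {K R : Type*} [CommRing K] [CommRing R] [Algebra K R]
    (τ : Derivation K R R) : diffOps K R := ⟨τ, Algebra.subset_adjoin (Or.inr ⟨τ, rfl⟩)⟩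

/-- A flat (integrable) connection over `K` on the `R`-module `M`. -/
structure FlatConnection (K R M : Type*) [CommRing K] [CommRing R] [Algebra K R] [AddCommGroup M]
    [Module R M] where
  nabla : Derivation K R R → M →+ M
  nabla_add : ∀ τ τ' m, nabla (τ + τ') m = nabla τ m + nabla τ' m
  nabla_smul : ∀ (r : R) τ m, nabla (r • τ) m = r • nabla τ m
  leibniz : ∀ τ (r : R) m, nabla τ (r • m) = r • nabla τ m + τ r • m
  flat : ∀ τ τ' m, nabla ⁅τ, τ'⁆ m = nabla τ (nabla τ' m) - nabla τ' (nabla τ m)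

section DualBasis

variable {K R : Type*} [CommRing K] [CommRing R] [Algebra K R]

lemma exists_dualBasis [Module.Projective R Ω[R⁄K]] [Module.Finite R Ω[R⁄K]] :
    ∃ (n : ℕ) (f : Fin n → R) (ξ : Fin n → Derivation K R R),
      ∀ τ : Derivation K R R, τ = ∑ i, τ (f i) • ξ i := by
  have hfg : (Submodule.span R (Set.range (KaehlerDifferential.D K R))).FG := by
    rw [KaehlerDifferential.span_range_derivation]; exact Module.Finite.fg_top
  obtain ⟨t, ht, hspan⟩ := (Submodule.fg_span_iff_fg_span_finset_subset _).mp hfg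
  choose g hg using fun x : t => ht x.2
  let e := t.equivFin
  let f : Fin t.card → R := fun i => g (e.symm i)
  let π : (Fin t.card → R) →ₗ[R] Ω[R⁄K] :=
    Fintype.linearCombination R (fun i => KaehlerDifferential.D K R (f i))
  have hπ : Function.Surjective π := by
    rw [← LinearMap.range_eq_top, Fintype.range_linearCombination, ← top_le_iff,
      ← KaehlerDifferential.span_range_derivation, hspan, Submodule.span_le]
    intro x hx
    refine Submodule.subset_span ⟨e ⟨x, hx⟩, ?_⟩
    simp [f, hg]
  obtain ⟨σ, hσ⟩ := Module.projective_lifting_property π LinearMap.id hπ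
  refine ⟨t.card, f, fun i => ((LinearMap.proj i ∘ₗ σ).compDer (KaehlerDifferential.D K R)),
    fun τ => ?_⟩
  ext a
  have h := LinearMap.congr_fun hσ (KaehlerDifferential.D K R a)
  have h2 := congrArg τ.liftKaehlerDifferential h
  simp only [LinearMap.comp_apply, LinearMap.id_apply, Derivation.liftKaehlerDifferential_comp_D,
    π, Fintype.linearCombination_apply, map_sum, map_smul, smul_eq_mul] at h2
  rw [← h2]
  have h3 : ∀ s : Finset (Fin t.card), (∑ i ∈ s, τ (f i) •
      ((LinearMap.proj i ∘ₗ σ).compDer (KaehlerDifferential.D K R) : Derivation K R R)) a =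
        ∑ i ∈ s, σ (KaehlerDifferential.D K R a) i * τ (f i) := by
    intro s
    induction s using Finset.cons_induction with
    | empty => simp
    | cons i s hi ih =>
      rw [Finset.sum_cons, Finset.sum_cons, Derivation.add_apply, ih]
      simp [mul_comm]
  exact (h3 _).symm

end DualBasis

/-- A ring `A` with images of `R` and of the derivations of `R` satisfying the usual relations. -/
structure DiffRep (R A : Type*) [CommRing R] [Algebra ℂ R] [Ring A] where
  mu : R →+* A
  delta : Derivation ℂ R R → A
  delta_add : ∀ τ τ', delta (τ + τ') = delta τ + delta τ'
  delta_smul : ∀ r τ, delta (r • τ) = mu r * delta τ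
  delta_mul : ∀ τ r, delta τ * mu r = mu r * delta τ + mu (τ r)
  delta_bracket : ∀ τ τ', delta ⁅τ, τ'⁆ = delta τ * delta τ' - delta τ' * delta τ

namespace DiffRep

variable {R A : Type*} [CommRing R] [Algebra ℂ R] [Ring A] (C : DiffRep R A)

/-- `Fil C n g`: `g` is an expression of order less than `n`. -/
inductive Fil : ℕ → A → Prop
  | zero : Fil 0 0
  | base (r : R) : Fil 1 (C.mu r)
  | add {n g h} : Fil n g → Fil n h → Fil n (g + h)
  | mono {n g} : Fil n g → Fil (n + 1) g
  | mulDer {n g} (τ : Derivation ℂ R R) : Fil n g → Fil (n + 1) (g * C.delta τ)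

variable {C}

lemma Fil.zero' (n : ℕ) : C.Fil n 0 := by
  induction n with
  | zero => exact .zero
  | succ n ih => exact .mono ih

lemma Fil.mul_left {n : ℕ} {g} (r : R) (h : C.Fil n g) : C.Fil n (C.mu r * g) := by
  induction h with
  | zero => rw [mul_zero]; exact .zero
  | base s => rw [← map_mul]; exact .base _
  | add _ _ ih ih' => rw [mul_add]; exact .add ih ih'
  | mono _ ih => exact .mono ih
  | mulDer τ _ ih => rw [← mul_assoc]; exact .mulDer τ ih

lemma Fil.neg {n : ℕ} {g} (h : C.Fil n g) : C.Fil n (-g) := by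
  have := h.mul_left (-1)
  rwa [map_neg, map_one, neg_one_mul] at this

lemma Fil.sub {n : ℕ} {g g'} (h : C.Fil n g) (h' : C.Fil n g') : C.Fil n (g - g') := by
  rw [sub_eq_add_neg]; exact .add h h'.neg

lemma Fil.sum {n : ℕ} {ι : Type*} (s : Finset ι) (g : ι → _) (h : ∀ i ∈ s, C.Fil n (g i)) :
    C.Fil n (∑ i ∈ s, g i) :=
  Finset.sum_induction g (C.Fil n) (fun _ _ => .add) (.zero' n) h

lemma Fil.mul_right {n : ℕ} {g} (r : R) (h : C.Fil n g) : C.Fil n (g * C.mu r) := by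
  induction h generalizing r with
  | zero => rw [zero_mul]; exact .zero
  | base s => rw [← map_mul]; exact .base _
  | add _ _ ih ih' => rw [add_mul]; exact .add (ih r) (ih' r)
  | mono _ ih => exact .mono (ih r)
  | mulDer τ _ ih =>
    rw [mul_assoc, C.delta_mul, mul_add, ← mul_assoc]
    exact .add (.mulDer τ (ih r)) (.mono (ih _))

lemma Fil.eq_zero {g} (h : C.Fil 0 g) : g = 0 := by
  generalize hn : 0 = n at h
  induction h with
  | zero => rfl
  | add _ _ ih ih' => rw [ih hn, ih' hn, add_zero]
  | base | mono | mulDer => omega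

lemma Fil.comm {n : ℕ} {g} (r : R) (h : C.Fil n g) :
    C.Fil (n - 1) (g * C.mu r - C.mu r * g) := by
  induction h with
  | zero => rw [zero_mul, mul_zero, sub_zero]; exact .zero
  | base s => rw [← map_mul, ← map_mul, mul_comm, sub_self]; exact .zero
  | @add n g h _ _ ih ih' =>
    rw [show (g + h) * C.mu r - C.mu r * (g + h) = (g * C.mu r - C.mu r * g) +
      (h * C.mu r - C.mu r * h) by noncomm_ring]
    exact .add ih ih'
  | @mono n g hg ih =>
    cases n with
    | zero => rw [hg.eq_zero, zero_mul, mul_zero, sub_zero]; exact .zero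
    | succ n => exact .mono ih
  | @mulDer n g τ hg ih =>
    rw [mul_assoc, C.delta_mul, mul_add, ← mul_assoc, ← mul_assoc]
    rw [show ∀ a b c : A, a * C.delta τ + b - c * C.delta τ =
      (a - c) * C.delta τ + b by intros; rw [sub_mul]; abel]
    refine .add ?_ (hg.mul_right _)
    cases n with
    | zero => rw [hg.eq_zero, zero_mul, mul_zero, sub_zero, zero_mul]; exact .zero
    | succ n => exact .mulDer τ ih

lemma Fil.euler {m : ℕ} {f : Fin m → R} {ξ : Fin m → Derivation ℂ R R}
    (hξ : ∀ τ : Derivation ℂ R R, τ = ∑ i, τ (f i) • ξ i) {n : ℕ} {g} (h : C.Fil n g) :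
    C.Fil (n - 1) (∑ i, (g * C.mu (f i) - C.mu (f i) * g) * C.delta (ξ i) -
      (n - 1) • g) := by
  induction h with
  | zero => simpa using Fil.zero
  | base s =>
    have : ∀ i, C.mu s * C.mu (f i) - C.mu (f i) * C.mu s = 0 := fun i => by
      rw [← map_mul, ← map_mul, mul_comm, sub_self]
    simpa [this] using Fil.zero
  | @add n g h _ _ ih ih' =>
    convert Fil.add ih ih' using 1
    rw [sub_add_sub_comm, ← Finset.sum_add_distrib, smul_add]
    congr 1
    refine Finset.sum_congr rfl fun i _ => ?_
    rw [← add_mul]; congr 1; noncomm_ring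
  | @mono n g hg ih =>
    cases n with
    | zero => rw [hg.eq_zero]; simpa using Fil.zero
    | succ n =>
      have h2 := Fil.sub (.mono ih) hg
      rw [sub_sub, Nat.add_sub_cancel] at h2
      rw [Nat.add_sub_cancel, add_smul, one_smul]
      exact h2
  | @mulDer n h τ hh ih =>
    cases n with
    | zero => rw [hh.eq_zero]; simpa using Fil.zero
    | succ k =>
      have e1 : C.delta τ = ∑ i, C.mu (τ (f i)) * C.delta (ξ i) := by
        have hz : C.delta 0 = 0 := by
          have := C.delta_smul 0 0
          rwa [map_zero, zero_mul, zero_smul] at this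
        let φ : Derivation ℂ R R →+ A :=
          ⟨⟨C.delta, hz⟩, C.delta_add⟩
        have := congrArg φ (hξ τ)
        rw [map_sum] at this
        refine this.trans (Finset.sum_congr rfl fun i _ => C.delta_smul _ _)
      have e2 : ∀ i, (h * C.delta τ * C.mu (f i) - C.mu (f i) * (h * C.delta τ)) *
          C.delta (ξ i) = (h * C.mu (f i) - C.mu (f i) * h) * C.delta (ξ i) *
            C.delta τ + h * (C.mu (τ (f i)) * C.delta (ξ i)) +
            (h * C.mu (f i) - C.mu (f i) * h) * C.delta ⁅τ, ξ i⁆ := fun i => by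
        rw [C.delta_bracket, mul_assoc h, C.delta_mul]
        simp only [mul_add, add_mul, sub_mul, mul_sub, mul_assoc]
        abel
      have e3 : (∑ i, (h * C.delta τ * C.mu (f i) - C.mu (f i) * (h * C.delta τ)) *
          C.delta (ξ i)) - (k + 1) • (h * C.delta τ) =
          (∑ i, (h * C.mu (f i) - C.mu (f i) * h) * C.delta (ξ i) - k • h) *
            C.delta τ +
            ∑ i, (h * C.mu (f i) - C.mu (f i) * h) * C.delta ⁅τ, ξ i⁆ := by
        rw [Finset.sum_congr rfl fun i _ => e2 i, Finset.sum_add_distrib, Finset.sum_add_distrib,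
          ← Finset.sum_mul, ← Finset.mul_sum, ← e1, sub_mul, add_smul, one_smul, smul_mul_assoc]
        abel
      rw [Nat.add_sub_cancel, e3]
      exact .add (.mulDer τ ih) (Fil.sum _ _ fun i _ => .mulDer _ (hh.comm (f i)))


lemma Fil.exists_mu {g} (h : C.Fil 1 g) : ∃ r, g = C.mu r := by
  generalize hn : 1 = n at h
  induction h with
  | zero => omega
  | base r => exact ⟨r, rfl⟩
  | add _ _ ih ih' =>
    obtain ⟨r, rfl⟩ := ih hn
    obtain ⟨s, rfl⟩ := ih' hn
    exact ⟨r + s, (map_add _ _ _).symm⟩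
  | @mono n g hg _ =>
    obtain rfl : n = 0 := by omega
    exact ⟨0, by rw [hg.eq_zero, map_zero]⟩
  | @mulDer n g τ hg _ =>
    obtain rfl : n = 0 := by omega
    exact ⟨0, by rw [hg.eq_zero, map_zero, zero_mul]⟩

/-- An expression that acts as zero on `R` is zero. -/
lemma Fil.eq_zero_of_map {S : Type*} [Ring S] (p : A →+* S) (hp : ∀ r, p (C.mu r) = 0 → r = 0)
    {m : ℕ} {f : Fin m → R} {ξ : Fin m → Derivation ℂ R R}
    (hξ : ∀ τ : Derivation ℂ R R, τ = ∑ i, τ (f i) • ξ i) {n : ℕ} {g} (h : C.Fil n g)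
    (h0 : p g = 0) : g = 0 := by
  induction n generalizing g with
  | zero => exact h.eq_zero
  | succ n ih =>
    have hc : ∀ i, g * C.mu (f i) - C.mu (f i) * g = 0 := fun i => by
      refine ih (h.comm (f i)) ?_
      simp [h0]
    have he := h.euler hξ
    simp only [hc, zero_mul, Finset.sum_const_zero, zero_sub, Nat.add_sub_cancel] at he
    rcases Nat.eq_zero_or_pos n with rfl | hn
    · obtain ⟨r, rfl⟩ := h.exists_mu
      rw [hp r h0, map_zero]
    · have h2 := he.neg.mul_left (algebraMap ℂ R (n : ℂ)⁻¹)
      refine ih ?_ h0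
      have hn' : (n : ℂ) ≠ 0 := by exact_mod_cast hn.ne'
      have h3 : algebraMap ℂ R (n : ℂ)⁻¹ * (n : R) = 1 := by
        rw [← map_natCast (algebraMap ℂ R), ← map_mul, inv_mul_cancel₀ hn', map_one]
      have h4 : C.mu (algebraMap ℂ R (n : ℂ)⁻¹) * (n : A) = 1 := by
        rw [← map_natCast C.mu, ← map_mul, h3, map_one]
      rwa [neg_neg, nsmul_eq_mul, ← mul_assoc, h4, one_mul] at h2

lemma Fil.le {n k : ℕ} {g} (h : C.Fil n g) : C.Fil (n + k) g := by
  induction k with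
  | zero => exact h
  | succ k ih => exact .mono ih

lemma Fil.mul {n m : ℕ} {g h} (hg : C.Fil n g) (hh : C.Fil m h) : ∃ k, C.Fil k (g * h) := by
  induction hh with
  | zero => exact ⟨0, by rw [mul_zero]; exact .zero⟩
  | base r => exact ⟨n, hg.mul_right r⟩
  | add _ _ ih ih' =>
    obtain ⟨k, hk⟩ := ih
    obtain ⟨l, hl⟩ := ih'
    exact ⟨k + l, by rw [mul_add]; exact .add hk.le (add_comm l k ▸ hl.le)⟩
  | mono _ ih => exact ih
  | mulDer τ _ ih =>
    obtain ⟨k, hk⟩ := ih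
    exact ⟨k + 1, by rw [← mul_assoc]; exact .mulDer τ hk⟩

variable (C) in
/-- The subring generated by `R` and the derivations. -/
def gen : Subring A := Subring.closure (Set.range C.mu ∪ Set.range C.delta)

lemma exists_fil {g : A} (hg : g ∈ C.gen) : ∃ n, C.Fil n g := by
  induction hg using Subring.closure_induction with
  | mem x hx =>
    rcases hx with ⟨r, rfl⟩ | ⟨τ, rfl⟩
    · exact ⟨1, .base r⟩
    · refine ⟨2, ?_⟩
      have := Fil.mulDer τ (Fil.base (C := C) 1)
      rwa [map_one, one_mul] at this
  | zero => exact ⟨0, .zero⟩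
  | one => exact ⟨1, by rw [← map_one C.mu]; exact .base 1⟩
  | add x y _ _ hx hy =>
    obtain ⟨k, hk⟩ := hx
    obtain ⟨l, hl⟩ := hy
    exact ⟨k + l, .add hk.le (add_comm l k ▸ hl.le)⟩
  | neg x _ hx => obtain ⟨k, hk⟩ := hx; exact ⟨k, hk.neg⟩
  | mul x y _ _ hx hy =>
    obtain ⟨k, hk⟩ := hx
    obtain ⟨l, hl⟩ := hy
    exact hk.mul hl

end DiffRep

namespace FlatConnection

variable {R M : Type*} [CommRing R] [Algebra ℂ R] [AddCommGroup M] [Module R M]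
variable (C : FlatConnection ℂ R M)

/-- `R` and the derivations acting simultaneously on `R` and on `M`. -/
def rep : DiffRep R (Module.End ℂ R × AddMonoid.End M) where
  mu := (Algebra.lmul ℂ R : R →+* Module.End ℂ R).prod (Module.toAddMonoidEnd R M)
  delta τ := ((τ : R →ₗ[ℂ] R), C.nabla τ)
  delta_add τ τ' := Prod.ext (by ext x; simp) (AddMonoidHom.ext fun m => C.nabla_add τ τ' m)
  delta_smul r τ := Prod.ext (by ext x; simp) (AddMonoidHom.ext fun m => C.nabla_smul r τ m)
  delta_mul τ r := Prod.ext (by ext x; simp [mul_comm x])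
    (AddMonoidHom.ext fun m => C.leibniz τ r m)
  delta_bracket τ τ' := Prod.ext (by
    ext x
    simp [LieRing.of_associative_ring_bracket])
    (AddMonoidHom.ext fun m => C.flat τ τ' m)

lemma exists_act (L : diffOps ℂ R) : ∃ T : AddMonoid.End M, ((L : Module.End ℂ R), T) ∈ C.rep.gen := by
  obtain ⟨L, hL⟩ := L
  have hmu : ∀ r, C.rep.mu r ∈ C.rep.gen := fun r => Subring.subset_closure (Or.inl ⟨r, rfl⟩)
  induction hL using Algebra.adjoin_induction with
  | mem x hx =>
    rcases hx with ⟨r, rfl⟩ | ⟨τ, rfl⟩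
    · exact ⟨_, hmu r⟩
    · exact ⟨_, Subring.subset_closure (Or.inr ⟨τ, rfl⟩)⟩
  | algebraMap c =>
    refine ⟨Module.toAddMonoidEnd R M (algebraMap ℂ R c), ?_⟩
    convert hmu (algebraMap ℂ R c) using 1
    refine Prod.ext ?_ rfl
    ext x; simp [rep, Algebra.smul_def]
  | add x y _ _ hx hy =>
    obtain ⟨S, hS⟩ := hx
    obtain ⟨T, hT⟩ := hy
    exact ⟨S + T, add_mem hS hT⟩
  | mul x y _ _ hx hy =>
    obtain ⟨S, hS⟩ := hx
    obtain ⟨T, hT⟩ := hy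
    exact ⟨S * T, mul_mem hS hT⟩

variable [Algebra.FormallySmooth ℂ R] [Algebra.EssFiniteType ℂ R]

lemma act_unique {L : Module.End ℂ R} {S T : AddMonoid.End M} (hS : (L, S) ∈ C.rep.gen)
    (hT : (L, T) ∈ C.rep.gen) : S = T := by
  obtain ⟨n, f, ξ, hξ⟩ := exists_dualBasis (K := ℂ) (R := R)
  obtain ⟨k, hk⟩ := DiffRep.exists_fil (sub_mem hS hT)
  have := hk.eq_zero_of_map (RingHom.fst _ _)
    (fun r hr => by
      have := LinearMap.congr_fun hr 1
      simpa [rep] using this) hξ (sub_self L)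
  exact sub_eq_zero.mp (congrArg Prod.snd this)

/-- The action of the ring of differential operators on a module with a flat connection: elements
of `R` act by multiplication and derivations act through the connection. -/
def act : diffOps ℂ R →+* AddMonoid.End M where
  toFun L := (C.exists_act L).choose
  map_one' := C.act_unique (C.exists_act 1).choose_spec (one_mem _)
  map_zero' := C.act_unique (C.exists_act 0).choose_spec (zero_mem _)
  map_add' L L' := C.act_unique (C.exists_act (L + L')).choose_spec
    (add_mem (C.exists_act L).choose_spec (C.exists_act L').choose_spec)
  map_mul' L L' := C.act_unique (C.exists_act (L * L')).choose_spec
    (mul_mem (C.exists_act L).choose_spec (C.exists_act L').choose_spec)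

lemma act_mulOp (r : R) (m : M) : C.act (mulOp ℂ r) m = r • m := by
  have h : C.rep.mu r ∈ C.rep.gen := Subring.subset_closure (Or.inl ⟨r, rfl⟩)
  exact DFunLike.congr_fun (C.act_unique (C.exists_act (mulOp ℂ r)).choose_spec h) m

lemma act_derOp (τ : Derivation ℂ R R) (m : M) : C.act (derOp τ) m = C.nabla τ m := by
  have h : C.rep.delta τ ∈ C.rep.gen := Subring.subset_closure (Or.inr ⟨τ, rfl⟩)
  exact DFunLike.congr_fun (C.act_unique (C.exists_act (derOp τ)).choose_spec h) m

lemma act_mem (S : Submodule R M) (hS : ∀ τ, ∀ m ∈ S, C.nabla τ m ∈ S) (L : diffOps ℂ R) {m : M}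
    (hm : m ∈ S) : C.act L m ∈ S := by
  have key : ∀ g ∈ C.rep.gen, ∀ m ∈ S, g.2 m ∈ S := by
    intro g hg
    induction hg using Subring.closure_induction with
    | mem x hx =>
      rcases hx with ⟨r, rfl⟩ | ⟨τ, rfl⟩
      · exact fun m hm => S.smul_mem r hm
      · exact fun m hm => hS τ m hm
    | zero => exact fun m _ => S.zero_mem
    | one => exact fun m hm => hm
    | add x y _ _ hx hy => exact fun m hm => S.add_mem (hx m hm) (hy m hm)
    | neg x _ hx => exact fun m hm => S.neg_mem (hx m hm)
    | mul x y _ _ hx hy => exact fun m hm => hx _ (hy m hm)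
  exact key _ (C.exists_act L).choose_spec m hm

end FlatConnection
end DiffOps

section FlatAux

variable {σ R W X : Type*} [Fintype σ] [CommRing R] [Algebra ℂ R] [Ring W] [AddCommGroup X]
  (t : R →+ W →+ X) (c : σ → R) (p : σ → W) (N : Derivation ℂ R R → X →+ X)

lemma flat_aux (hp : ∀ s s', p s * p s' = p s' * p s)
    (hN : ∀ τ e w, N τ (t e w) = t (τ e) w + ∑ s, t (e * τ (c s)) (p s * w))
    (τ τ' : Derivation ℂ R R) (e : R) (w : W) :
    N ⁅τ, τ'⁆ (t e w) = N τ (N τ' (t e w)) - N τ' (N τ (t e w)) := by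
  have key : ∀ τ τ' : Derivation ℂ R R, N τ (N τ' (t e w)) =
      t (τ (τ' e)) w + ∑ s, t (τ' e * τ (c s)) (p s * w) +
        (∑ s, t (e * τ (τ' (c s))) (p s * w) + ∑ s, t (τ e * τ' (c s)) (p s * w) +
          ∑ s, ∑ u, t (e * τ' (c s) * τ (c u)) (p u * (p s * w))) := by
    intro τ τ'
    rw [hN, map_add, map_sum, hN, ← Finset.sum_add_distrib, ← Finset.sum_add_distrib]
    congr 1
    refine Finset.sum_congr rfl fun s _ => ?_
    rw [hN, Derivation.leibniz, smul_eq_mul, smul_eq_mul, map_add,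
      AddMonoidHom.add_apply, mul_comm (τ' (c s))]
  have hs : ∑ s, ∑ u, t (e * τ' (c s) * τ (c u)) (p u * (p s * w)) =
      ∑ s, ∑ u, t (e * τ (c s) * τ' (c u)) (p u * (p s * w)) := by
    rw [Finset.sum_comm]
    refine Finset.sum_congr rfl fun s _ => Finset.sum_congr rfl fun u _ => ?_
    rw [← mul_assoc, ← mul_assoc, hp, mul_right_comm]
  have hb : ∑ s, t (e * (⁅τ, τ'⁆ : Derivation ℂ R R) (c s)) (p s * w) =
      ∑ s, t (e * τ (τ' (c s))) (p s * w) - ∑ s, t (e * τ' (τ (c s))) (p s * w) := by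
    rw [← Finset.sum_sub_distrib]
    refine Finset.sum_congr rfl fun s _ => ?_
    rw [Derivation.commutator_apply, mul_sub, map_sub, AddMonoidHom.sub_apply]
  rw [key, key, hN, hs, hb, Derivation.commutator_apply, map_sub, AddMonoidHom.sub_apply]
  abel

end FlatAux

section PullBack

variable {σ : Type*}

/-- The ring `D_{ℂ[μ]}` of differential operators on the polynomial ring `ℂ[μ]`. -/
def Weyl (σ : Type*) : Type _ := diffOps ℂ (MvPolynomial σ ℂ)

instance : Ring (Weyl σ) := inferInstanceAs (Ring (diffOps ℂ (MvPolynomial σ ℂ)))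

/-- Multiplication by a polynomial, as an element of `D_{ℂ[μ]}`. -/
def weylC : MvPolynomial σ ℂ →+* Weyl σ where
  toFun := mulOp ℂ
  map_one' := Subtype.ext (map_one (Algebra.lmul ℂ (MvPolynomial σ ℂ)))
  map_zero' := Subtype.ext (map_zero (Algebra.lmul ℂ (MvPolynomial σ ℂ)))
  map_mul' p q := Subtype.ext (map_mul (Algebra.lmul ℂ (MvPolynomial σ ℂ)) p q)
  map_add' p q := Subtype.ext (map_add (Algebra.lmul ℂ (MvPolynomial σ ℂ)) p q)

/-- `ℂ[μ]` acts on `D_{ℂ[μ]}` by multiplication from the left. -/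
instance : Module (MvPolynomial σ ℂ) (Weyl σ) :=
  Module.compHom (Weyl σ) weylC

lemma weyl_smul_def (p : MvPolynomial σ ℂ) (w : Weyl σ) : p • w = weylC p * w := rfl

/-- The operator `∂/∂μ_s`. -/
def partialOp (s : σ) : Weyl σ := derOp (MvPolynomial.pderiv s)

lemma partialOp_comm (s t : σ) : partialOp s * partialOp t = partialOp t * partialOp s := by
  refine Subtype.ext (LinearMap.ext fun p => ?_)
  change MvPolynomial.pderiv s (MvPolynomial.pderiv t p) =
    MvPolynomial.pderiv t (MvPolynomial.pderiv s p)
  have h : ⁅(MvPolynomial.pderiv s : Derivation ℂ (MvPolynomial σ ℂ) (MvPolynomial σ ℂ)),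
      (MvPolynomial.pderiv t : Derivation ℂ (MvPolynomial σ ℂ) (MvPolynomial σ ℂ))⁆ = 0 := by
    classical
    refine MvPolynomial.derivation_ext fun i => ?_
    rw [Derivation.commutator_apply, MvPolynomial.pderiv_X, MvPolynomial.pderiv_X]
    simp [Pi.single_apply, apply_ite]
  have := Derivation.congr_fun h p
  rw [Derivation.commutator_apply] at this
  exact sub_eq_zero.mp this

lemma partialOp_commute (s t : σ) : Commute (partialOp s) (partialOp t) := partialOp_comm s t

lemma partialOp_smul (s : σ) (p : MvPolynomial σ ℂ) (w : Weyl σ) :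
    partialOp s * p • w = p • (partialOp s * w) + MvPolynomial.pderiv s p • w := by
  simp only [weyl_smul_def, ← mul_assoc, ← add_mul]
  congr 1
  refine Subtype.ext (LinearMap.ext fun q => ?_)
  change MvPolynomial.pderiv s (p * q) = p * MvPolynomial.pderiv s q + MvPolynomial.pderiv s p * q
  simp [mul_comm q]

variable (R : Type*) [CommRing R] [Algebra (MvPolynomial σ ℂ) R]

variable (σ) in
/-- `(D_{ℂ[μ]})^* = R ⊗ D_{ℂ[μ]}`, the tensor product over `ℂ[μ]`. -/
def PullBack : Type _ := R ⊗[MvPolynomial σ ℂ] Weyl σ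

namespace PullBack

instance : AddCommGroup (PullBack σ R) :=
  inferInstanceAs (AddCommGroup (R ⊗[MvPolynomial σ ℂ] Weyl σ))

instance : Module R (PullBack σ R) :=
  inferInstanceAs (Module R (R ⊗[MvPolynomial σ ℂ] Weyl σ))

variable {R}

/-- The element `e ⊗ w` of the pull-back. -/
def tmul : R →+ Weyl σ →+ PullBack σ R :=
  AddMonoidHom.mk' (fun e => AddMonoidHom.mk' (fun w => e ⊗ₜ[MvPolynomial σ ℂ] w)
    (TensorProduct.tmul_add e)) (fun e e' => by ext w; exact TensorProduct.add_tmul e e' w)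

lemma smul_tmul (r e : R) (w : Weyl σ) : r • tmul e w = tmul (r * e) w := rfl

lemma tmul_smul (p : MvPolynomial σ ℂ) (e : R) (w : Weyl σ) :
    tmul e (p • w) = tmul (p • e) w := (TensorProduct.smul_tmul p e w).symm

lemma induction {q : PullBack σ R → Prop} (h0 : q 0) (ht : ∀ e w, q (tmul e w))
    (ha : ∀ x y, q x → q y → q (x + y)) (x : PullBack σ R) : q x :=
  TensorProduct.induction_on x h0 ht ha

/-- Additive maps out of the pull-back. -/
def lift (f : R →+ Weyl σ →+ PullBack σ R)
    (hf : ∀ (p : MvPolynomial σ ℂ) (e : R) (w : Weyl σ), f (p • e) w = f e (p • w)) :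
    PullBack σ R →+ PullBack σ R := TensorProduct.liftAddHom f hf

lemma lift_tmul (f : R →+ Weyl σ →+ PullBack σ R) (hf) (e : R) (w : Weyl σ) :
    lift f hf (tmul e w) = f e w := rfl

end PullBack

open PullBack (tmul)

/-- The image `λₛ` of `μₛ` in `R`. -/
def coef (s : σ) : R := algebraMap (MvPolynomial σ ℂ) R (MvPolynomial.X s)

variable [Fintype σ] [Algebra ℂ R] [IsScalarTower ℂ (MvPolynomial σ ℂ) R]

lemma chain_rule (τ : Derivation ℂ R R) (p : MvPolynomial σ ℂ) :
    τ (algebraMap _ R p) = ∑ s, τ (algebraMap (MvPolynomial σ ℂ) R (MvPolynomial.X s)) *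
      algebraMap _ R (MvPolynomial.pderiv s p) := by
  classical
  induction p using MvPolynomial.induction_on with
  | C c =>
    rw [← MvPolynomial.algebraMap_eq, ← IsScalarTower.algebraMap_apply]
    simp
  | add p q hp hq => simp only [map_add, hp, hq, mul_add, Finset.sum_add_distrib]
  | mul_X p i hp =>
    simp only [map_mul, Derivation.leibniz, hp, smul_eq_mul, MvPolynomial.pderiv_X, map_add,
      mul_add, Finset.sum_add_distrib]
    congr 1
    · simp [Pi.single_apply, apply_ite, mul_comm]
    · rw [Finset.mul_sum]
      exact Finset.sum_congr rfl fun s _ => by ring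

/-- The action `τ(e ⊗ w) = τ(e) ⊗ w + ∑ₛ e τ(λₛ) ⊗ (∂/∂μₛ) w` of a derivation `τ` of `R` on the
pull-back, where `λₛ` is the image of `μₛ` in `R`. -/
def pullNabla (τ : Derivation ℂ R R) : PullBack σ R →+ PullBack σ R :=
  PullBack.lift
    (AddMonoidHom.mk' (fun e => AddMonoidHom.mk' (fun w => tmul (τ e) w +
        ∑ s, tmul (e * τ (coef R s)) (partialOp s * w))
      (fun w w' => by
        simp only [mul_add, map_add, Finset.sum_add_distrib]; abel))
      (fun e e' => by
        ext w
        simp only [AddMonoidHom.mk'_apply, AddMonoidHom.add_apply, map_add, add_mul,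
          Finset.sum_add_distrib]
        abel))
    (fun p e w => by
      simp only [AddMonoidHom.mk'_apply, partialOp_smul, map_add, Finset.sum_add_distrib,
        PullBack.tmul_smul]
      have h : τ (p • e) = p • τ e + ∑ s, MvPolynomial.pderiv s p • (e * τ (coef R s)) := by
        rw [Algebra.smul_def, Derivation.leibniz, chain_rule, smul_eq_mul, smul_eq_mul,
          Finset.mul_sum, Algebra.smul_def]
        congr 1
        refine Finset.sum_congr rfl fun s _ => ?_
        rw [Algebra.smul_def, coef]; ring
      rw [h, map_add, map_sum, AddMonoidHom.add_apply, AddMonoidHom.finsetSum_apply]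
      simp only [smul_mul_assoc]
      abel)

lemma pullNabla_tmul (τ : Derivation ℂ R R) (e : R) (w : Weyl σ) :
    pullNabla R τ (tmul e w) = tmul (τ e) w +
        ∑ s, tmul (e * τ (coef R s)) (partialOp s * w) := rfl

/-- The pull-back as a module with a flat connection. -/
def pullConnection : FlatConnection ℂ R (PullBack σ R) where
  nabla := pullNabla R
  nabla_add τ τ' m := by
    induction m using PullBack.induction with
    | h0 => simp
    | ha x y hx hy => simp only [map_add, hx, hy]; abel
    | ht e w =>
      simp only [pullNabla_tmul, Derivation.add_apply, mul_add, map_add, AddMonoidHom.add_apply,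
        Finset.sum_add_distrib]
      abel
  nabla_smul r τ m := by
    induction m using PullBack.induction with
    | h0 => simp
    | ha x y hx hy => simp only [map_add, hx, hy, smul_add]
    | ht e w =>
      simp only [pullNabla_tmul, Derivation.smul_apply, smul_add, Finset.smul_sum,
        PullBack.smul_tmul, smul_eq_mul, mul_left_comm]
  leibniz τ r m := by
    induction m using PullBack.induction with
    | h0 => simp
    | ha x y hx hy => simp only [map_add, hx, hy, smul_add]; abel
    | ht e w =>
      simp only [pullNabla_tmul, smul_add, Finset.smul_sum, Derivation.leibniz,
        PullBack.smul_tmul, smul_eq_mul, mul_assoc, map_add, AddMonoidHom.add_apply, mul_comm e]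
      abel
  flat τ τ' m := by
    induction m using PullBack.induction with
    | h0 => simp
    | ha x y hx hy => simp only [map_add, hx, hy]; abel
    | ht e w =>
      exact flat_aux tmul (coef R) partialOp (pullNabla R)
        partialOp_comm (pullNabla_tmul R) τ τ' e w

section Ideal

/-- The image of `R ⊗ I` in `R ⊗ D_{ℂ[μ]}`, for a left ideal `I`: it is spanned over `R` by the
`1 ⊗ w` with `w` in `I`. -/
def pullIdeal (I : Ideal (Weyl σ)) : Submodule R (PullBack σ R) :=
  Submodule.span R {x | ∃ w ∈ I, x = tmul 1 w}

lemma pullNabla_mem (I : Ideal (Weyl σ)) (τ : Derivation ℂ R R) (x : PullBack σ R)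
    (hx : x ∈ pullIdeal R I) : pullNabla R τ x ∈ pullIdeal R I := by
  have hmem : ∀ (e : R), ∀ w ∈ I, tmul e w ∈ pullIdeal R I := fun e w hw => by
    have := (pullIdeal R I).smul_mem e (Submodule.subset_span ⟨w, hw, rfl⟩ :
      tmul (1 : R) w ∈ pullIdeal R I)
    rwa [PullBack.smul_tmul, mul_one] at this
  induction hx using Submodule.span_induction with
  | mem x hx =>
    obtain ⟨w, hw, rfl⟩ := hx
    rw [pullNabla_tmul]
    exact add_mem (hmem _ _ hw) (sum_mem fun s _ => hmem _ _ (I.mul_mem_left _ hw))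
  | zero => rw [map_zero]; exact zero_mem _
  | add x y _ _ hx hy => rw [map_add]; exact add_mem hx hy
  | smul r x hx h =>
    rw [show pullNabla R τ (r • x) = r • pullNabla R τ x + τ r • x from
      (pullConnection R).leibniz τ r x]
    exact add_mem (Submodule.smul_mem _ _ h) (Submodule.smul_mem _ _ hx)

variable [Algebra.FormallySmooth ℂ R] [Algebra.EssFiniteType ℂ R]

/-- The left ideal of all `L` in `D_R` with `ρ(L) = L · (1 ⊗ 1)` in the image of `R ⊗ I`. -/
def restrictIdeal (I : Ideal (Weyl σ)) : Ideal (diffOps ℂ R) where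
  carrier := {L | (pullConnection R).act L (tmul 1 1) ∈ pullIdeal R I}
  zero_mem' := by
    rw [Set.mem_ofPred_eq, map_zero]; exact zero_mem (pullIdeal R I)
  add_mem' {L L'} h h' := by
    rw [Set.mem_ofPred_eq, map_add]; exact add_mem (S := Submodule R (PullBack σ R)) h h'
  smul_mem' L L' h := by
    rw [Set.mem_ofPred_eq, smul_eq_mul, map_mul]
    exact (pullConnection R).act_mem _ (fun τ m hm => pullNabla_mem R I τ m hm) L h

end Ideal
end PullBack

section Extension

variable (R B : Type*) [CommRing R] [CommRing B] [Algebra R B]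

/-- The algebra of all relative differential forms of `B` over `R`. -/
abbrev Forms := ExteriorAlgebra B (Ω[B⁄R])

variable {B} in
/-- The exact one-form `db`. -/
def dB (b : B) : Forms R B := ExteriorAlgebra.ι B (KaehlerDifferential.D R B b)

variable {B} in
lemma dB_mul (a b : B) : dB R (a * b) = a • dB R b + b • dB R a := by
  simp [dB]

variable {B} in
lemma dB_add (a b : B) : dB R (a + b) = dB R a + dB R b := by simp [dB]

variable {B} in
lemma dB_algebraMap (r : R) : dB R (algebraMap R B r) = 0 := by simp [dB]

variable {B} in
lemma dB_anticomm (a b : B) : dB R a * dB R b = - (dB R b * dB R a) :=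
  eq_neg_of_add_eq_zero_left (ExteriorAlgebra.ι_add_mul_swap _ _)

/-- Initial data for an additive operator `T` on forms with `T (b x) = b T x + δ b * x` and
`T (db * x) = Δ b * x + s db * T x`: a derivation of degree `0` for `s = 1`, an antiderivation of
degree `1` for `s = -1`. -/
structure OpData where
  δ : B →+ Forms R B
  Δ : B →+ Forms R B
  s : ℤ
  leibniz : ∀ a b, δ (a * b) = a • δ b + b • δ a
  comm : ∀ a b, s • (dB R a * δ b) = δ b * dB R a
  vanish : ∀ r : R, Δ (algebraMap R B r) = 0
  leibniz' : ∀ a b, Δ (a * b) = a • Δ b + b • Δ a + δ a * dB R b + δ b * dB R a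
  anti_self : ∀ a, Δ a * dB R a + s • (dB R a * Δ a) = 0
  anti : ∀ a b, Δ a * dB R b + s • (dB R a * Δ b) + (Δ b * dB R a + s • (dB R b * Δ a)) = 0

variable {R B}

/-- Pairs of forms, with the scalar action `b • (x, y) = (b x, b y + δ b * x)`. -/
@[ext] structure OpData.Pair (P : OpData R B) where
  fst : Forms R B
  snd : Forms R B

namespace OpData

variable (P : OpData R B)

def pairEquiv : P.Pair ≃ Forms R B × Forms R B where
  toFun p := (p.fst, p.snd)
  invFun p := ⟨p.1, p.2⟩
  left_inv _ := rfl
  right_inv _ := rfl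

instance : AddCommGroup P.Pair := P.pairEquiv.addCommGroup

@[simp] lemma fst_add (p q : P.Pair) : (p + q).fst = p.fst + q.fst := rfl
@[simp] lemma snd_add (p q : P.Pair) : (p + q).snd = p.snd + q.snd := rfl
@[simp] lemma fst_zero : (0 : P.Pair).fst = 0 := rfl
@[simp] lemma snd_zero : (0 : P.Pair).snd = 0 := rfl

instance : SMul B P.Pair := ⟨fun b p => ⟨b • p.fst, b • p.snd + P.δ b * p.fst⟩⟩

@[simp] lemma fst_smul (b : B) (p : P.Pair) : (b • p).fst = b • p.fst := rfl
@[simp] lemma snd_smul (b : B) (p : P.Pair) : (b • p).snd = b • p.snd + P.δ b * p.fst := rfl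

lemma δ_one : P.δ 1 = 0 := by
  have := P.leibniz 1 1
  simpa using this

instance : Module B P.Pair where
  one_smul p := by ext <;> simp [δ_one]
  mul_smul a b p := by
    ext
    · simp [mul_smul]
    · simp only [snd_smul, fst_smul, P.leibniz, add_mul, smul_mul_assoc, smul_add, mul_smul,
        mul_smul_comm]
      abel
  smul_zero b := by ext <;> simp
  smul_add b p q := by
    ext
    · simp
    · simp only [snd_smul, fst_add, snd_add, smul_add, mul_add]; abel
  add_smul a b p := by
    ext
    · simp [add_smul]
    · simp only [snd_smul, snd_add, map_add, add_smul, add_mul]; abel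
  zero_smul p := by ext <;> simp

instance : Module R P.Pair := Module.compHom _ (algebraMap R B)

instance : IsScalarTower R B P.Pair where
  smul_assoc r b p := by
    change (r • b) • p = algebraMap R B r • b • p
    rw [Algebra.smul_def, mul_smul]

/-- Left multiplication by `db`, together with its effect under the operator. -/
def mulD (b : B) : Module.End B P.Pair where
  toFun p := ⟨dB R b * p.fst, P.Δ b * p.fst + P.s • (dB R b * p.snd)⟩
  map_add' p q := by
    ext
    · simp [mul_add]
    · simp only [fst_add, snd_add, mul_add, smul_add]; abel
  map_smul' a p := by
    ext
    · simp
    · simp only [fst_smul, snd_smul, mul_add, smul_add, RingHom.id_apply, mul_smul_comm,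
        ← mul_assoc]
      rw [← P.comm, smul_mul_assoc, smul_comm a P.s]
      abel

@[simp] lemma mulD_fst (b : B) (p : P.Pair) : (P.mulD b p).fst = dB R b * p.fst := rfl
@[simp] lemma mulD_snd (b : B) (p : P.Pair) :
    (P.mulD b p).snd = P.Δ b * p.fst + P.s • (dB R b * p.snd) := rfl

lemma mulD_add (a b : B) : P.mulD (a + b) = P.mulD a + P.mulD b := by
  ext p
  · simp [dB_add, add_mul]
  · simp only [mulD_snd, LinearMap.add_apply, snd_add, map_add, dB_add, add_mul, smul_add]
    abel

lemma mulD_mul (a b : B) : P.mulD (a * b) = a • P.mulD b + b • P.mulD a := by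
  ext p
  · simp [dB_mul, add_mul]
  · simp only [LinearMap.add_apply, LinearMap.smul_apply,
      snd_add, snd_smul, mulD_snd, mulD_fst, P.leibniz', dB_mul, add_mul, smul_mul_assoc,
      smul_add, smul_comm P.s, mul_assoc]
    abel

lemma mulD_algebraMap (r : R) : P.mulD (algebraMap R B r) = 0 := by
  ext p <;> simp [dB_algebraMap, P.vanish]

/-- The derivation `b ↦ mulD b`. -/
def mulDer : Derivation R B (Module.End B P.Pair) :=
  Derivation.mk'
    { toFun := P.mulD
      map_add' := P.mulD_add
      map_smul' r b := by
        rw [Algebra.smul_def, mulD_mul, mulD_algebraMap, smul_zero, add_zero, algebraMap_smul]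
        rfl }
    P.mulD_mul

lemma mulD_anticomm (a b : B) : P.mulD a * P.mulD b + P.mulD b * P.mulD a = 0 := by
  ext p
  · have := dB_anticomm R a b
    simp only [LinearMap.add_apply, Module.End.mul_apply, fst_add, mulD_fst, ← mul_assoc, this]
    simp
  · have h := congrArg (· * p.fst) (P.anti a b)
    have h2 := dB_anticomm R a b
    simp only [add_mul, smul_mul_assoc, zero_mul, mul_assoc] at h
    simp only [LinearMap.add_apply, Module.End.mul_apply, snd_add, mulD_fst, mulD_snd, mul_add,
      smul_add, mul_smul_comm, LinearMap.zero_apply, snd_zero]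
    rw [← mul_assoc (dB R a) (dB R b) p.snd, h2, ← h]
    simp only [neg_mul, mul_assoc, smul_neg]
    abel

/-- The universal extension of `mulDer` to one-forms. -/
def mulForm : Ω[B⁄R] →ₗ[B] Module.End B P.Pair := P.mulDer.liftKaehlerDifferential

@[simp] lemma mulForm_D (b : B) : P.mulForm (KaehlerDifferential.D R B b) = P.mulD b :=
  P.mulDer.liftKaehlerDifferential_comp_D b

lemma omega_induction {p : Ω[B⁄R] → Prop} (h0 : p 0) (hD : ∀ b, p (KaehlerDifferential.D R B b))
    (ha : ∀ x y, p x → p y → p (x + y)) (hs : ∀ (b : B) x, p x → p (b • x)) (x : Ω[B⁄R]) : p x := by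
  have hx : x ∈ Submodule.span B (Set.range (KaehlerDifferential.D R B)) := by
    rw [KaehlerDifferential.span_range_derivation]; trivial
  induction hx using Submodule.span_induction with
  | mem x h => obtain ⟨b, rfl⟩ := h; exact hD b
  | zero => exact h0
  | add x y _ _ hx hy => exact ha x y hx hy
  | smul b x _ hx => exact hs b x hx

lemma mulForm_anticomm (x y : Ω[B⁄R]) :
    P.mulForm x * P.mulForm y + P.mulForm y * P.mulForm x = 0 := by
  induction x using omega_induction with
  | h0 => simp
  | hD a =>
    induction y using omega_induction with
    | h0 => simp
    | hD b => simpa using P.mulD_anticomm a b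
    | ha x y hx hy =>
      rw [map_add, mul_add, add_mul, add_add_add_comm, hx, hy, add_zero]
    | hs b x hx => rw [map_smul, mul_smul_comm, smul_mul_assoc, ← smul_add, hx, smul_zero]
  | ha x y hx hy => rw [map_add, mul_add, add_mul, add_add_add_comm, hx, hy, add_zero]
  | hs b x hx => rw [map_smul, mul_smul_comm, smul_mul_assoc, ← smul_add, hx, smul_zero]

lemma mulForm_sq (x : Ω[B⁄R]) : P.mulForm x * P.mulForm x = 0 := by
  induction x using omega_induction with
  | h0 => simp
  | hD a =>
    ext p
    · simp [← mul_assoc, dB]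
    · simp only [mulForm_D, Module.End.mul_apply, mulD_fst, mulD_snd]
      have h := congrArg (· * p.fst) (P.anti_self a)
      simp only [add_mul, smul_mul_assoc, zero_mul, mul_assoc] at h
      simp only [mul_add, smul_add, mul_smul_comm, ← add_assoc, h, zero_add]
      simp [← mul_assoc, dB]
  | ha x y hx hy =>
    have := P.mulForm_anticomm x y
    rw [map_add, mul_add, add_mul, add_mul, hx, hy, zero_add, add_zero, add_comm, this]
  | hs b x hx => rw [map_smul, mul_smul_comm, smul_mul_assoc, hx, smul_zero, smul_zero]

/-- The algebra homomorphism whose second component is the operator. -/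
def lift : Forms R B →ₐ[B] Module.End B P.Pair :=
  ExteriorAlgebra.lift B ⟨P.mulForm, P.mulForm_sq⟩

lemma lift_dB (b : B) : P.lift (dB R b) = P.mulD b := by
  simp [lift, dB]

/-- The operator on forms determined by the data. -/
def op : Forms R B →+ Forms R B where
  toFun x := (P.lift x ⟨1, 0⟩).snd
  map_zero' := by simp
  map_add' x y := by simp

lemma forms_induction {p : Forms R B → Prop} (h1 : p 1) (ha : ∀ x y, p x → p y → p (x + y))
    (hs : ∀ (b : B) x, p x → p (b • x)) (hD : ∀ (b : B) x, p x → p (dB R b * x))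
    (x : Forms R B) : p x := by
  have h0 : p 0 := by simpa using hs 0 1 h1
  suffices h : ∀ y, p y → p (x * y) by simpa using h 1 h1
  induction x using ExteriorAlgebra.induction with
  | algebraMap b => intro y hy; rw [← Algebra.smul_def]; exact hs b y hy
  | ι w =>
    intro y hy
    induction w using omega_induction with
    | h0 => simpa using h0
    | hD b => exact hD b y hy
    | ha u v hu hv => rw [map_add, add_mul]; exact ha _ _ hu hv
    | hs b u hu => rw [map_smul, smul_mul_assoc]; exact hs _ _ hu
  | mul a b iha ihb => intro y hy; rw [mul_assoc]; exact iha _ (ihb _ hy)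
  | add a b iha ihb => intro y hy; rw [add_mul]; exact ha _ _ (iha _ hy) (ihb _ hy)

lemma lift_fst (x : Forms R B) : (P.lift x ⟨1, 0⟩).fst = x := by
  induction x using forms_induction with
  | h1 => simp
  | ha x y hx hy => simp [hx, hy]
  | hs b x hx => simp [hx]
  | hD b x hx => simp [lift_dB, hx]

lemma op_one : P.op 1 = 0 := by simp [op]

lemma op_smul (b : B) (x : Forms R B) : P.op (b • x) = b • P.op x + P.δ b * x := by
  simp [op, lift_fst]

lemma op_dB_mul (b : B) (x : Forms R B) :
    P.op (dB R b * x) = P.Δ b * x + P.s • (dB R b * P.op x) := by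
  simp [op, lift_dB, lift_fst]

end OpData

variable (R B) in
/-- Data of the exterior derivative: `b ↦ db`, `db ↦ 0`. -/
def extData : OpData R B where
  δ := (ExteriorAlgebra.ι B).toAddMonoidHom.comp (KaehlerDifferential.D R B : B →ₗ[R] _).toAddMonoidHom
  Δ := 0
  s := -1
  leibniz a b := dB_mul R a b
  comm a b := by
    change (-1 : ℤ) • (dB R a * dB R b) = dB R b * dB R a
    rw [dB_anticomm R b a]; simp
  vanish r := by simp
  leibniz' a b := by
    have := dB_anticomm R b a
    simp only [AddMonoidHom.zero_apply, smul_zero, zero_add]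
    exact (add_eq_zero_iff_eq_neg.mpr (dB_anticomm R a b)).symm
  anti_self a := by simp
  anti a b := by simp

variable (R B) in
/-- The exterior derivative `d`. It is `R`-linear, `d (b db₁ ⋯ dbₙ) = db db₁ ⋯ dbₙ`. -/
def extD : Forms R B →ₗ[R] Forms R B where
  toFun := (extData R B).op
  map_add' := map_add _
  map_smul' r x := by
    have h := (extData R B).op_smul (algebraMap R B r) x
    have h0 : (extData R B).δ (algebraMap R B r) = 0 := dB_algebraMap R r
    rw [h0, zero_mul, add_zero, algebraMap_smul, algebraMap_smul] at h
    exact h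

lemma extD_one : extD R B 1 = 0 := (extData R B).op_one

lemma extD_smul (b : B) (x : Forms R B) : extD R B (b • x) = b • extD R B x + dB R b * x :=
  (extData R B).op_smul b x

lemma extD_dB_mul (b : B) (x : Forms R B) : extD R B (dB R b * x) = -(dB R b * extD R B x) := by
  have := (extData R B).op_dB_mul b x
  rw [show (extData R B).s = -1 from rfl, show (extData R B).Δ b = 0 from rfl, zero_mul, zero_add,
    neg_one_smul] at this
  exact this

lemma extD_extD (x : Forms R B) : extD R B (extD R B x) = 0 := by
  induction x using OpData.forms_induction with
  | h1 => simp [extD_one]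
  | ha x y hx hy => simp [hx, hy]
  | hs b x hx => simp [extD_smul, extD_dB_mul, hx]
  | hD b x hx => simp [extD_dB_mul, hx]

section Lie

variable {K : Type*} [CommRing K] [Algebra K R] [Algebra K B]

/-- The derivation `θ` of `B` lifts the derivation `τ` of `R`. -/
def IsLift (τ : Derivation K R R) (θ : Derivation K B B) : Prop :=
  ∀ r, θ (algebraMap R B r) = algebraMap R B (τ r)

/-- Data of the Lie derivative along `θ`: `b ↦ θ b`, `db ↦ d(θ b)`. -/
def lieData {τ : Derivation K R R} {θ : Derivation K B B} (h : IsLift τ θ) : OpData R B where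
  δ := (algebraMap B (Forms R B)).toAddMonoidHom.comp (θ : B →ₗ[K] B).toAddMonoidHom
  Δ := (extData R B).δ.comp (θ : B →ₗ[K] B).toAddMonoidHom
  s := 1
  leibniz a b := by simp [Algebra.smul_def]
  comm a b := by simpa using (Algebra.commutes (θ b) (dB R a)).symm
  vanish r := by
    change dB R (θ _) = 0
    rw [h, dB_algebraMap]
  leibniz' a b := by
    change dB R (θ _) = a • dB R (θ b) + b • dB R (θ a) + algebraMap B (Forms R B) (θ a) * _
      + algebraMap B (Forms R B) (θ b) * _
    simp only [Derivation.leibniz, dB_add, smul_eq_mul, dB_mul, ← Algebra.smul_def]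
    abel
  anti_self a := by
    change dB R (θ a) * dB R a + (1 : ℤ) • (dB R a * dB R (θ a)) = 0
    rw [dB_anticomm]; simp
  anti a b := by
    change dB R (θ a) * dB R b + (1 : ℤ) • (dB R a * dB R (θ b)) + (dB R (θ b) * dB R a +
      (1 : ℤ) • (dB R b * dB R (θ a))) = 0
    rw [dB_anticomm R (θ a) b, dB_anticomm R a (θ b)]; simp

/-- The Lie derivative along `θ` on relative forms: the derivation of degree `0` with `b ↦ θ b`
and `db ↦ d(θ b)`. -/
def lieD {τ : Derivation K R R} {θ : Derivation K B B} (h : IsLift τ θ) :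
    Forms R B →+ Forms R B := (lieData h).op

variable {τ τ' : Derivation K R R} {θ θ' : Derivation K B B} (h : IsLift τ θ) (h' : IsLift τ' θ')

lemma lieD_one : lieD h 1 = 0 := (lieData h).op_one

lemma lieD_smul (b : B) (x : Forms R B) : lieD h (b • x) = b • lieD h x + θ b • x := by
  rw [Algebra.smul_def (θ b)]
  exact (lieData h).op_smul b x

lemma lieD_dB_mul (b : B) (x : Forms R B) :
    lieD h (dB R b * x) = dB R (θ b) * x + dB R b * lieD h x := by
  have := (lieData h).op_dB_mul b x
  rw [show (lieData h).s = 1 from rfl, one_smul] at this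
  exact this

lemma lieD_base_smul (r : R) (x : Forms R B) : lieD h (r • x) = r • lieD h x + τ r • x := by
  rw [← algebraMap_smul B r x, lieD_smul, h]; simp

lemma extD_lieD (x : Forms R B) : extD R B (lieD h x) = lieD h (extD R B x) := by
  induction x using OpData.forms_induction with
  | h1 => simp [extD_one, lieD_one]
  | ha x y hx hy => simp [hx, hy]
  | hs b x hx => simp only [lieD_smul, extD_smul, lieD_dB_mul, map_add, hx]; abel
  | hD b x hx => simp only [extD_dB_mul, lieD_dB_mul, map_add, map_neg, hx]; abel

lemma isLift_add (h : IsLift τ θ) (h' : IsLift τ' θ') : IsLift (τ + τ') (θ + θ') := fun r => by simp [h r, h' r]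

lemma isLift_smul (h : IsLift τ θ) (r : R) [IsScalarTower K R B] :
    IsLift (r • τ) (algebraMap R B r • θ) := fun s => by simp [h s, Algebra.smul_def]

lemma isLift_bracket (h : IsLift τ θ) (h' : IsLift τ' θ') : IsLift ⁅τ, τ'⁆ ⁅θ, θ'⁆ := fun r => by
  simp [Derivation.commutator_apply, h _, h' _]

lemma lieD_add (x : Forms R B) : lieD (isLift_add h h') x = lieD h x + lieD h' x := by
  induction x using OpData.forms_induction with
  | h1 => simp [lieD_one]
  | ha x y hx hy => simp only [map_add, hx, hy]; abel
  | hs b x hx => simp only [lieD_smul, hx, Derivation.add_apply, add_smul, smul_add]; abel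
  | hD b x hx => simp only [lieD_dB_mul, hx, Derivation.add_apply, dB_add, add_mul, mul_add]; abel

lemma lieD_base (r : R) [IsScalarTower K R B] (x : Forms R B) :
    lieD (isLift_smul h r) x = r • lieD h x := by
  rw [← algebraMap_smul B r (lieD h x)]
  induction x using OpData.forms_induction with
  | h1 => simp [lieD_one]
  | ha x y hx hy => simp only [map_add, hx, hy, smul_add]
  | hs b x hx =>
    simp only [lieD_smul, hx, Derivation.smul_apply, smul_add, smul_eq_mul, mul_smul]
    rw [smul_comm b]
  | hD b x hx =>
    simp only [lieD_dB_mul, hx, Derivation.smul_apply, smul_eq_mul, dB_mul, dB_algebraMap,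
      smul_zero, add_zero, smul_add, smul_mul_assoc, mul_smul_comm]

lemma lieD_bracket (x : Forms R B) :
    lieD (isLift_bracket h h') x = lieD h (lieD h' x) - lieD h' (lieD h x) := by
  induction x using OpData.forms_induction with
  | h1 => simp [lieD_one]
  | ha x y hx hy => simp only [map_add, hx, hy]; abel
  | hs b x hx =>
    simp only [lieD_smul, hx, Derivation.commutator_apply, map_add, sub_smul, smul_sub]; abel
  | hD b x hx =>
    have e : ∀ a c : B, dB R (a - c) = dB R a - dB R c := fun a c => by simp [dB]
    simp only [lieD_dB_mul, hx, Derivation.commutator_apply, map_add, e, sub_mul, mul_sub]; abel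

end Lie

section Degree

/-- Contraction of forms with an `R`-derivation of `B`. -/
def contr (v : Derivation R B B) : Forms R B →ₗ[B] Forms R B :=
  CliffordAlgebra.contractLeft (Q := (0 : QuadraticForm B (Ω[B⁄R]))) v.liftKaehlerDifferential

lemma contr_one (v : Derivation R B B) : contr v 1 = 0 := CliffordAlgebra.contractLeft_one _ _

lemma contr_dB_mul (v : Derivation R B B) (b : B) (x : Forms R B) :
    contr v (dB R b * x) = v b • x - dB R b * contr v x := by
  have := CliffordAlgebra.contractLeft_ι_mul (Q := (0 : QuadraticForm B (Ω[B⁄R])))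
    v.liftKaehlerDifferential (KaehlerDifferential.D R B b) x
  rw [Derivation.liftKaehlerDifferential_comp_D] at this
  exact this

lemma grade_induction {n : ℕ} {p : Forms R B → Prop} (ha : ∀ x y, p x → p y → p (x + y))
    (hs : ∀ (b : B) x, x ∈ ⋀[B]^(n + 1) Ω[B⁄R] → p x → p (b • x))
    (hD : ∀ (b : B) y, y ∈ ⋀[B]^n Ω[B⁄R] → p (dB R b * y)) {x : Forms R B}
    (hx : x ∈ ⋀[B]^(n + 1) Ω[B⁄R]) : p x := by
  change x ∈ LinearMap.range (ExteriorAlgebra.ι B (M := Ω[B⁄R])) ^ (n + 1) at hx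
  rw [pow_succ'] at hx
  induction hx using Submodule.mul_induction_on' with
  | mem_mul_mem m hm y hy =>
    obtain ⟨w, rfl⟩ := hm
    have hmem : ∀ w, ExteriorAlgebra.ι B w * y ∈ ⋀[B]^(n + 1) Ω[B⁄R] := fun w => by
      change _ ∈ LinearMap.range (ExteriorAlgebra.ι B (M := Ω[B⁄R])) ^ (n + 1)
      rw [pow_succ']; exact Submodule.mul_mem_mul ⟨w, rfl⟩ hy
    induction w using OpData.omega_induction with
    | h0 => simpa [dB] using hD 0 y hy
    | hD b => exact hD b y hy
    | ha u v hu hv => rw [map_add, add_mul]; exact ha _ _ hu hv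
    | hs b u hu => rw [map_smul, smul_mul_assoc]; exact hs _ _ (hmem u) hu
  | add a _ b _ iha ihb => exact ha _ _ iha ihb

lemma dB_mul_mem {n : ℕ} (b : B) {y : Forms R B} (hy : y ∈ ⋀[B]^n Ω[B⁄R]) :
    dB R b * y ∈ ⋀[B]^(n + 1) Ω[B⁄R] := by
  change _ ∈ LinearMap.range (ExteriorAlgebra.ι B (M := Ω[B⁄R])) ^ (n + 1)
  rw [pow_succ']; exact Submodule.mul_mem_mul ⟨_, rfl⟩ hy

lemma mem_grade_zero {x : Forms R B} (hx : x ∈ ⋀[B]^0 Ω[B⁄R]) : ∃ b : B, x = b • 1 := by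
  change x ∈ LinearMap.range (ExteriorAlgebra.ι B (M := Ω[B⁄R])) ^ 0 at hx
  rw [pow_zero] at hx
  obtain ⟨b, rfl⟩ := Submodule.mem_one.mp hx
  exact ⟨b, Algebra.algebraMap_eq_smul_one b⟩

lemma one_mem_grade : (1 : Forms R B) ∈ ⋀[B]^0 Ω[B⁄R] := by
  change _ ∈ LinearMap.range (ExteriorAlgebra.ι B (M := Ω[B⁄R])) ^ 0
  rw [pow_zero]; exact Submodule.one_le.mp le_rfl

lemma extD_mem {n : ℕ} {x : Forms R B} (hx : x ∈ ⋀[B]^n Ω[B⁄R]) :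
    extD R B x ∈ ⋀[B]^(n + 1) Ω[B⁄R] := by
  induction n generalizing x with
  | zero =>
    obtain ⟨b, rfl⟩ := mem_grade_zero hx
    rw [extD_smul, extD_one, smul_zero, zero_add (dB R b * 1)]
    exact dB_mul_mem (R := R) b one_mem_grade
  | succ n ih =>
    refine grade_induction (p := fun z => extD R B z ∈ ⋀[B]^(n + 1 + 1) Ω[B⁄R])
      ?_ ?_ ?_ hx
    · intro x y hx hy
      rw [map_add]; exact add_mem hx hy
    · intro b x hx h
      rw [extD_smul]; exact add_mem (Submodule.smul_mem _ _ h) (dB_mul_mem _ hx)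
    · intro b y hy
      rw [extD_dB_mul]; exact neg_mem (dB_mul_mem _ (ih hy))

lemma contr_mem {n : ℕ} (v : Derivation R B B) {x : Forms R B} (hx : x ∈ ⋀[B]^(n + 1) Ω[B⁄R]) :
    contr v x ∈ ⋀[B]^n Ω[B⁄R] := by
  induction n generalizing x with
  | zero =>
    refine grade_induction (p := fun z => contr v z ∈ ⋀[B]^0 Ω[B⁄R])
      ?_ ?_ ?_ hx
    · intro x y hx hy
      rw [map_add]; exact add_mem hx hy
    · intro b x hx h
      rw [map_smul]; exact Submodule.smul_mem _ _ h
    · intro b y hy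
      obtain ⟨c, rfl⟩ := mem_grade_zero hy
      rw [contr_dB_mul, map_smul, contr_one, smul_zero, mul_zero, sub_zero]
      exact Submodule.smul_mem _ _ (Submodule.smul_mem _ _ one_mem_grade)
  | succ n ih =>
    refine grade_induction (p := fun z => contr v z ∈ ⋀[B]^(n + 1) Ω[B⁄R])
      ?_ ?_ ?_ hx
    · intro x y hx hy
      rw [map_add]; exact add_mem hx hy
    · intro b x hx h
      rw [map_smul]; exact Submodule.smul_mem _ _ h
    · intro b y hy
      rw [contr_dB_mul]; exact sub_mem (Submodule.smul_mem _ _ hy) (dB_mul_mem _ (ih hy))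

lemma contr_grade_zero (v : Derivation R B B) {x : Forms R B} (hx : x ∈ ⋀[B]^0 Ω[B⁄R]) :
    contr v x = 0 := by
  obtain ⟨b, rfl⟩ := mem_grade_zero hx
  rw [map_smul, contr_one, smul_zero]

variable {K : Type*} [CommRing K] [Algebra K R] [Algebra K B]
variable {τ : Derivation K R R} {θ θ' : Derivation K B B}

lemma lieD_mem (h : IsLift τ θ) {n : ℕ} {x : Forms R B} (hx : x ∈ ⋀[B]^n Ω[B⁄R]) :
    lieD h x ∈ ⋀[B]^n Ω[B⁄R] := by
  induction n generalizing x with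
  | zero =>
    obtain ⟨b, rfl⟩ := mem_grade_zero hx
    rw [lieD_smul, lieD_one, smul_zero, zero_add]
    exact Submodule.smul_mem _ _ one_mem_grade
  | succ n ih =>
    refine grade_induction (p := fun z => lieD h z ∈ ⋀[B]^(n + 1) Ω[B⁄R])
      ?_ ?_ ?_ hx
    · intro x y hx hy
      rw [map_add]; exact add_mem hx hy
    · intro b x hx h
      rw [lieD_smul]; exact add_mem (Submodule.smul_mem _ _ h) (Submodule.smul_mem _ _ hx)
    · intro b y hy
      rw [lieD_dB_mul]; exact add_mem (dB_mul_mem _ hy) (dB_mul_mem _ (ih hy))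

/-- The difference of two lifts of a derivation is `R`-linear. -/
def vertical (h : IsLift τ θ) (h' : IsLift τ θ') : Derivation R B B :=
  Derivation.mk'
    { toFun := fun b => θ b - θ' b
      map_add' := fun a b => by simp only [map_add]; abel
      map_smul' := fun r b => by
        rw [Algebra.smul_def]
        simp only [Derivation.leibniz, h r, h' r, RingHom.id_apply, smul_eq_mul, Algebra.smul_def]
        ring }
    (fun a b => by
      simp only [LinearMap.coe_mk, AddHom.coe_mk, Derivation.leibniz, smul_eq_mul]; ring)

/-- Cartan's formula. -/
lemma lieD_sub (h : IsLift τ θ) (h' : IsLift τ θ') (x : Forms R B) :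
    lieD h x - lieD h' x =
      extD R B (contr (vertical h h') x) + contr (vertical h h') (extD R B x) := by
  have hv : ∀ b, vertical h h' b = θ b - θ' b := fun b => rfl
  induction x using OpData.forms_induction with
  | h1 => simp [lieD_one, contr_one, extD_one]
  | ha x y hx hy =>
    simp only [map_add]
    rw [add_add_add_comm, ← hx, ← hy]; abel
  | hs b x hx =>
    simp only [lieD_smul, map_smul, extD_smul, map_add, contr_dB_mul]
    rw [hv, sub_smul]
    rw [show ∀ A C D E : Forms R B, A + C + (D + (E - C)) = A + D + E by intros; abel,
      ← smul_add, ← hx, smul_sub]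
    abel
  | hD b x hx =>
    have e : dB R (θ b) * x - dB R (θ' b) * x = dB R (θ b - θ' b) * x := by
      rw [← sub_mul]; simp [dB]
    simp only [lieD_dB_mul, extD_dB_mul, map_sub, map_neg, extD_smul, contr_dB_mul]
    rw [hv, ← e]
    have := congrArg (dB R b * ·) hx
    simp only [mul_sub, mul_add] at this
    rw [show ∀ A C D E F G : Forms R B, A + C - (D + E) = A - D + (C - E) by intros; abel, this]
    · abel
    · exact 0
    · exact 0

end Degree

section Cohomology

variable (R B)

/-- Closed relative `n`-forms. -/
def closedForms (n : ℕ) : Submodule R (Forms R B) :=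
  (⋀[B]^n Ω[B⁄R]).restrictScalars R ⊓ LinearMap.ker (extD R B)

/-- Exact relative `n`-forms: `d` of the `(n - 1)`-forms, and `0` for `n = 0`. -/
def exactForms : ℕ → Submodule R (Forms R B)
  | 0 => ⊥
  | n + 1 => ((⋀[B]^n Ω[B⁄R]).restrictScalars R).map (extD R B)

/-- The relative algebraic de Rham cohomology `Hⁿ` of `Spec B` over `Spec R`. -/
abbrev HdR (n : ℕ) : Type _ :=
  closedForms R B n ⧸ (exactForms R B n).submoduleOf (closedForms R B n)

variable {R B}

/-- The class of a closed `n`-form. -/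
def HdR.mk {n : ℕ} (ω : ⋀[B]^n Ω[B⁄R]) (hω : extD R B ω = 0) : HdR R B n :=
  Submodule.Quotient.mk ⟨(ω : Forms R B), ω.2, hω⟩

variable {K : Type*} [CommRing K] [Algebra K R] [Algebra K B]
variable {τ τ' : Derivation K R R} {θ θ' : Derivation K B B}

/-- The Lie derivative on closed forms. -/
def lieZ (h : IsLift τ θ) (n : ℕ) : closedForms R B n →+ closedForms R B n where
  toFun x := ⟨lieD h x, lieD_mem h x.2.1, by
    have : extD R B x = 0 := x.2.2
    change extD R B (lieD h x) = 0
    rw [extD_lieD, this, map_zero]⟩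
  map_zero' := by ext; simp
  map_add' x y := by ext; simp

lemma lieD_exact (h : IsLift τ θ) {n : ℕ} {x : Forms R B} (hx : x ∈ exactForms R B n) :
    lieD h x ∈ exactForms R B n := by
  cases n with
  | zero =>
    have : x = 0 := hx
    rw [this, map_zero]; exact zero_mem _
  | succ n =>
    obtain ⟨y, hy, rfl⟩ := hx
    exact ⟨lieD h y, lieD_mem h hy, extD_lieD h y⟩

/-- The operator on cohomology induced by the Lie derivative. -/
def lieH (h : IsLift τ θ) (n : ℕ) : HdR R B n →+ HdR R B n :=
  QuotientAddGroup.map _ _ (lieZ h n) (fun _ hx => lieD_exact h hx)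

lemma lieH_mk (h : IsLift τ θ) {n : ℕ} (x : closedForms R B n) :
    lieH h n (Submodule.Quotient.mk x) = Submodule.Quotient.mk (lieZ h n x) := rfl

lemma lieH_congr (h : IsLift τ θ) (h' : IsLift τ θ') (n : ℕ) : lieH h n = lieH h' n := by
  ext x
  obtain ⟨x, rfl⟩ := Submodule.Quotient.mk_surjective _ x
  rw [lieH_mk, lieH_mk, Submodule.Quotient.eq]
  change lieD h (x : Forms R B) - lieD h' (x : Forms R B) ∈ exactForms R B n
  have hd : extD R B (x : Forms R B) = 0 := x.2.2
  have hx : (x : Forms R B) ∈ ⋀[B]^n Ω[B⁄R] := x.2.1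
  rw [lieD_sub, hd, map_zero, add_zero]
  cases n with
  | zero => rw [contr_grade_zero _ hx, map_zero]; exact zero_mem _
  | succ n => exact ⟨_, contr_mem _ hx, rfl⟩

end Cohomology

section Lifting

variable {K : Type*} [CommRing K] [Algebra K R] [Algebra K B] [IsScalarTower K R B]

lemma exists_ringHom_section [Algebra.FormallySmooth R B] {C : Type*} [CommRing C]
    (ψ : R →+* C) (π : C →+* B) (hπ : Function.Surjective π) (hker : RingHom.ker π ^ 2 = ⊥)
    (hc : π.comp ψ = algebraMap R B) :
    ∃ s : B →+* C, π.comp s = RingHom.id B ∧ s.comp (algebraMap R B) = ψ := by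
  let _ := ψ.toAlgebra
  let π' : C →ₐ[R] B := { π with commutes' := fun r => RingHom.congr_fun hc r }
  let s := Algebra.FormallySmooth.liftOfSurjective (AlgHom.id R B) π' hπ
    ⟨2, hker⟩
  have hs := Algebra.FormallySmooth.comp_liftOfSurjective (AlgHom.id R B) π' hπ ⟨2, hker⟩
  exact ⟨s.toRingHom, congrArg AlgHom.toRingHom hs, s.comp_algebraMap⟩

/-- Derivations of the base lift to formally smooth algebras. -/
lemma exists_isLift [Algebra.FormallySmooth R B] (τ : Derivation K R R) :
    ∃ θ : Derivation K B B, IsLift τ θ := by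
  let ψ : R →+* TrivSqZeroExt B B :=
    { toFun := fun r => TrivSqZeroExt.inl (algebraMap R B r) +
        TrivSqZeroExt.inr (algebraMap R B (τ r))
      map_one' := by ext <;> simp
      map_mul' := fun a b => by
        ext
        · simp
        · simp only [TrivSqZeroExt.snd_mul, TrivSqZeroExt.snd_add, TrivSqZeroExt.snd_inl,
            TrivSqZeroExt.snd_inr, TrivSqZeroExt.fst_add, TrivSqZeroExt.fst_inl,
            TrivSqZeroExt.fst_inr, Derivation.leibniz, map_add, smul_eq_mul, map_mul,
            MulOpposite.smul_eq_mul_unop, MulOpposite.unop_op]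
          ring
      map_zero' := by ext <;> simp
      map_add' := fun a b => by
        ext
        · simp
        · simp only [TrivSqZeroExt.snd_add, TrivSqZeroExt.snd_inl, TrivSqZeroExt.snd_inr, map_add]
          ring }
  obtain ⟨s, hs, hs'⟩ := exists_ringHom_section ψ (TrivSqZeroExt.fstHom B B B).toRingHom
    (fun b => ⟨TrivSqZeroExt.inl b, rfl⟩) (TrivSqZeroExt.kerIdeal_sq B B)
    (by ext r; simp [ψ])
  have h1 : ∀ b, (s b).fst = b := fun b => RingHom.congr_fun hs b
  have h2 : ∀ r, (s (algebraMap R B r)).snd = algebraMap R B (τ r) := fun r => by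
    rw [show s (algebraMap R B r) = ψ r from RingHom.congr_fun hs' r]
    change TrivSqZeroExt.snd (TrivSqZeroExt.inl (algebraMap R B r) +
      TrivSqZeroExt.inr (algebraMap R B (τ r))) = _
    rw [TrivSqZeroExt.snd_add, TrivSqZeroExt.snd_inl, TrivSqZeroExt.snd_inr, zero_add]
  have hl : ∀ a b, (s (a * b)).snd = a * (s b).snd + b * (s a).snd := fun a b => by
    rw [map_mul, TrivSqZeroExt.snd_mul, h1, h1]; simp [mul_comm]
  refine ⟨Derivation.mk'
    { toFun := fun b => (s b).snd
      map_add' := fun a b => by simp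
      map_smul' := fun k b => by
        rw [Algebra.smul_def, hl, IsScalarTower.algebraMap_apply K R B, h2]
        simp [Algebra.smul_def, IsScalarTower.algebraMap_apply K R B] } hl, h2⟩

end Lifting
section Connection

variable {K : Type*} [CommRing K] [Algebra K R] [Algebra K B] [IsScalarTower K R B]

variable (K R B) in
/-- The Gauss–Manin connection on `Hⁿ` of a formally smooth `R`-algebra `B`: a derivation `τ` of `R`
acts through the Lie derivative along a derivation of `B` that lifts `τ`. -/
def gaussManin [Algebra.FormallySmooth R B] (n : ℕ) : FlatConnection K R (HdR R B n) where
  nabla τ := lieH (exists_isLift (B := B) τ).choose_spec n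
  nabla_add τ τ' m := by
    rw [lieH_congr (exists_isLift (τ + τ')).choose_spec (isLift_add (exists_isLift τ).choose_spec
      (exists_isLift τ').choose_spec)]
    obtain ⟨x, rfl⟩ := Submodule.Quotient.mk_surjective _ m
    simp only [lieH_mk, ← Submodule.Quotient.mk_add]
    exact congrArg _ (Subtype.ext (lieD_add _ _ _))
  nabla_smul r τ m := by
    rw [lieH_congr (exists_isLift (r • τ)).choose_spec
      (isLift_smul (exists_isLift τ).choose_spec r)]
    obtain ⟨x, rfl⟩ := Submodule.Quotient.mk_surjective _ m
    simp only [lieH_mk, ← Submodule.Quotient.mk_smul]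
    exact congrArg _ (Subtype.ext (lieD_base _ _ _))
  leibniz τ r m := by
    obtain ⟨x, rfl⟩ := Submodule.Quotient.mk_surjective _ m
    simp only [lieH_mk, ← Submodule.Quotient.mk_smul, ← Submodule.Quotient.mk_add]
    exact congrArg _ (Subtype.ext (lieD_base_smul _ _ _))
  flat τ τ' m := by
    rw [lieH_congr (exists_isLift ⁅τ, τ'⁆).choose_spec (isLift_bracket
      (exists_isLift τ).choose_spec (exists_isLift τ').choose_spec)]
    obtain ⟨x, rfl⟩ := Submodule.Quotient.mk_surjective _ m
    simp only [lieH_mk, ← Submodule.Quotient.mk_sub]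
    exact congrArg _ (Subtype.ext (lieD_bracket _ _ _))

/-- Any lift of `τ` computes the Gauss–Manin connection. -/
lemma gaussManin_mk [Algebra.FormallySmooth R B] {n : ℕ} {τ : Derivation K R R}
    {θ : Derivation K B B} (h : IsLift τ θ) (x : closedForms R B n) :
    (gaussManin R B K n).nabla τ (Submodule.Quotient.mk x) = Submodule.Quotient.mk (lieZ h n x) :=
  DFunLike.congr_fun (lieH_congr (exists_isLift τ).choose_spec h n) _

end Connection
end Extension

section Hypergeometric

variable {N r : ℕ} {m : Fin r → ℕ}

/-- The group of relations among the lattice points `(d_{j,i}, e_j)`. -/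
def latticeRel (d : (Σ j, Fin (m j)) → Fin N →₀ ℕ) : AddSubgroup ((Σ j, Fin (m j)) → ℤ) where
  carrier := {b | (∀ k, ∑ s, b s * (d s k : ℤ) = 0) ∧ ∀ j, ∑ i, b ⟨j, i⟩ = 0}
  zero_mem' := by simp
  add_mem' {a b} ha hb := by
    refine ⟨fun k => ?_, fun j => ?_⟩
    · simp only [Pi.add_apply, add_mul, Finset.sum_add_distrib, ha.1, hb.1, add_zero]
    · simp only [Pi.add_apply, Finset.sum_add_distrib, ha.2, hb.2, add_zero]
  neg_mem' {a} ha := by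
    refine ⟨fun k => ?_, fun j => ?_⟩
    · simp only [Pi.neg_apply, neg_mul, Finset.sum_neg_distrib, ha.1, neg_zero]
    · simp only [Pi.neg_apply, Finset.sum_neg_distrib, ha.2, neg_zero]

/-- The monomial `∏ₛ (∂/∂μₛ)^{aₛ}`. -/
def partialPow {σ : Type*} [Fintype σ] (a : σ → ℕ) : Weyl σ :=
  Finset.univ.noncommProd (fun s => partialOp s ^ a s)
    (fun s _ t _ _ => (partialOp_commute s t).pow_pow _ _)

/-- The operator `□_b`. -/
def box {σ : Type*} [Fintype σ] (b : σ → ℤ) : Weyl σ :=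
  partialPow (fun s => (b s).toNat) - partialPow (fun s => (-b s).toNat)

/-- The Euler operator `μₛ ∂/∂μₛ`. -/
def euler {σ : Type*} (s : σ) : Weyl σ := weylC (MvPolynomial.X s) * partialOp s

/-- The left ideal `I(u, v)` of `D_{ℂ[μ]}`, generated by the operators `□_b`, `Z_k + u_k + 1` and
`Z_{N+k} + v_k + 1`. -/
def hypIdeal (d : (Σ j, Fin (m j)) → Fin N →₀ ℕ) (u : Fin N →₀ ℕ) (v : Fin r →₀ ℕ) :
    Ideal (Weyl (Σ j, Fin (m j))) :=
  Ideal.span ({w | ∃ b ∈ latticeRel d, w = box b} ∪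
    (Set.range fun k : Fin N => ∑ s, d s k • euler s + ((u k + 1 : ℕ) : Weyl (Σ j, Fin (m j)))) ∪
    Set.range fun k : Fin r => ∑ i, euler ⟨k, i⟩ + ((v k + 1 : ℕ) : Weyl (Σ j, Fin (m j))))

variable {R : Type*} [CommRing R] [Algebra ℂ R]

/-- The left ideal `I_R(u, v)` of `D_R`, for the homomorphism `ℂ[μ] → R` with `μ_{j,i} ↦ λ_{j,i}`. -/
def hypIdealOver [Algebra.FormallySmooth ℂ R] [Algebra.EssFiniteType ℂ R]
    (d : (Σ j, Fin (m j)) → Fin N →₀ ℕ) (lam : (Σ j, Fin (m j)) → R)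
    (u : Fin N →₀ ℕ) (v : Fin r →₀ ℕ) : Ideal (diffOps ℂ R) :=
  letI : Algebra (MvPolynomial (Σ j, Fin (m j)) ℂ) R := (MvPolynomial.aeval lam).toAlgebra
  haveI : IsScalarTower ℂ (MvPolynomial (Σ j, Fin (m j)) ℂ) R :=
    IsScalarTower.of_algebraMap_eq fun c => ((MvPolynomial.aeval lam).commutes c).symm
  restrictIdeal R (hypIdeal d u v)

/-- The polynomials `f_j = ∑ᵢ λ_{j,i} x^{d_{j,i}}`. -/
def poly (d : (Σ j, Fin (m j)) → Fin N →₀ ℕ) (lam : (Σ j, Fin (m j)) → R) (j : Fin r) :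
    MvPolynomial (Fin N) R :=
  ∑ i, MvPolynomial.monomial (d ⟨j, i⟩) (lam ⟨j, i⟩)

end Hypergeometric

section CompleteIntersection

variable {R : Type*} [CommRing R] {N r : ℕ} (f : Fin r → MvPolynomial (Fin N) R)

/-- The coordinate ring `B = R[x₁, …, x_N] / (f₁, …, f_r)`. -/
abbrev CoordRing : Type _ := MvPolynomial (Fin N) R ⧸ Ideal.span (Set.range f)

/-- `f₁, …, f_r` define a smooth complete intersection in affine `N`-space over `R`: their common
zero scheme is smooth over `R`, of relative dimension `N - r` at each of its points. -/
structure IsSmoothCompleteIntersection : Prop where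
  smooth : Algebra.Smooth R (CoordRing f)
  rank : ∀ p : PrimeSpectrum (CoordRing f),
    Module.rankAtStalk (Ω[CoordRing f⁄R]) p + r = N

/-- The Gauss–Manin connection on the de Rham cohomology of a smooth complete intersection. -/
def IsSmoothCompleteIntersection.connection [Algebra ℂ R] {f : Fin r → MvPolynomial (Fin N) R}
    (hf : IsSmoothCompleteIntersection f) (n : ℕ) : FlatConnection ℂ R (HdR R (CoordRing f) n) :=
  haveI := hf.smooth
  gaussManin R (CoordRing f) ℂ n

variable (S : Finset (Fin N)) (hS : S.card = r)

/-- The Jacobian determinant of `f₁, …, f_r` in the variables with indices in `S`, listed in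
increasing order. -/
def jac : CoordRing f :=
  Matrix.det (Matrix.of fun j k : Fin r =>
    Ideal.Quotient.mk (Ideal.span (Set.range f)) (MvPolynomial.pderiv (S.orderEmbOfFin hS k) (f j)))

/-- The sign of the permutation that lists the complement of `S`, and then `S`, in increasing
order. -/
def sgn : ℤ := (-1) ^ ((Sᶜ ×ˢ S).filter fun p => p.2 < p.1).card

/-- The wedge product of the `dxᵢ` for `i` not in `S`, in increasing order. -/
def dxCompl : ⋀[CoordRing f]^(N - r) Ω[CoordRing f⁄R] :=
  exteriorPower.ιMulti (CoordRing f) (N - r) fun k =>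
    KaehlerDifferential.D R (CoordRing f) (Ideal.Quotient.mk _ (MvPolynomial.X
      (Sᶜ.orderEmbOfFin (by rw [Finset.card_compl, Fintype.card_fin, hS]) k)))

/-- `ω` is the form `ω_u`: for every `S` with `r` elements, over the open set where `J_S` is
invertible, it is `sgn S · x^u / J_S` times the wedge product of the `dxᵢ` with `i` not in `S`. -/
def IsOmega (u : Fin N →₀ ℕ) (ω : ⋀[CoordRing f]^(N - r) Ω[CoordRing f⁄R]) : Prop :=
  ∀ (S : Finset (Fin N)) (hS : S.card = r),
    (LocalizedModule.mk ω 1 : LocalizedModule (Submonoid.powers (jac f S hS)) _) =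
      LocalizedModule.mk
        ((sgn S • Ideal.Quotient.mk _ (MvPolynomial.monomial u 1) : CoordRing f) • dxCompl f S hS)
        ⟨jac f S hS, Submonoid.mem_powers _⟩

end CompleteIntersection

end RelDeRham

end

/-!
Write `F = ∑ⱼ yⱼ fⱼ`. The proof makes sense of the formal integrals
`Φ(a, v) = ∫ x^a y^v exp F dx dy`, for `a ∈ ℕ^N` and `v ∈ ℕ^r`, as classes in the relative de Rham
cohomology of the complete intersection `Y`. Differentiation under the integral sign with respect to
a derivation `τ` of `R` gives
`∇_τ Φ(a, v) = ∑_{j,i} τ(λ_{j,i}) Φ(a + d_{j,i}, v + e_j)`,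
and the vanishing of the integrals of `∂/∂x_k (x_k x^a y^v exp F)` and `∂/∂y_j (y_j x^a y^v exp F)`
gives the linear relations
`(a_k + 1) Φ(a, v) + ∑_{j,i} d_{j,i}(k) λ_{j,i} Φ(a + d_{j,i}, v + e_j) = 0`, and likewise for `v_j`.

These identities imply that `I_R(u, 0)` kills `Φ(u, 0)`. Indeed `D_{ℂ[μ]}` acts on the free
`ℂ[μ]`-module on symbols `e_{(a, v)}` that satisfy the same differential equations with `μ` in place
of `λ`; there `∂/∂μ_{j,i}` is a translation of indices, so that the `□_b` kill all symbols, and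
`Z_k + u_k + 1` sends `e_{(u, 0)}` to the relation above (`weylAct_box_single`,
`weylAct_euler_single`). The map `e ⊗ w ↦ e (w e_{(u, 0)})(Φ)` from `R ⊗ D_{ℂ[μ]}` is horizontal, so
the claim follows: `act_eq_zero_of_mem_restrictIdeal` and `act_eq_zero_of_mem_hypIdealOver`.

To construct `Φ`, let `C` be the coordinate ring of a neighbourhood of `Y` in affine space on which
the Jacobian matrix of `f` has a right inverse, and let `φⱼ ∈ C` be the image of `fⱼ`. There are
derivations `θⱼ` of `C` over `R` with `θᵢ φⱼ = δᵢⱼ`. A top form `ω` on `Spec C` is divisible by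
`dφ₁ ∧ ⋯ ∧ dφ_r`, and the restriction of the quotient to `Y` is its residue `resForm`, a closed form.
Integration by parts turns multiplication by `yⱼ` into `-∂/∂φⱼ`, that is, minus the Lie derivative
along `θⱼ`. Modulo Lie derivatives along derivations over `R` that kill all `φⱼ`, these operators
commute, and the residue kills such Lie derivatives in cohomology, by Cartan's formula
(`TopQuot.res`). So `Φ(a, v)` is defined as the class of the residue of `(-∂/∂φ)^v (x^a dx)`
(`resFamily`), and the identities are `nabla_resFamily`, `resFamily_relation_inl` and
`resFamily_relation_inr`. Since `Φ(u, 0)` is the residue of `± x^u dx₁ ∧ ⋯ ∧ dx_N`, expanding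
`dφ₁ ∧ ⋯ ∧ dφ_r` in terms of Jacobian determinants identifies it with the class of `ω_u`
(`det_smul_resForm_volForm`).

The right inverse of the Jacobian matrix on `Y` comes from the Jacobian criterion
(`exists_jacMat_mul_eq_one`). It also shows that the maximal minors `J_σ` generate the unit ideal of
the coordinate ring of `Y` (`span_minors_eq_top`), which gives the uniqueness of `ω_u`.
-/

noncomputable section

namespace RelDeRham

/-! ### Horizontal maps -/

section Horizontal

variable {R M : Type*} [CommRing R] [Algebra ℂ R] [Algebra.FormallySmooth ℂ R]
  [Algebra.EssFiniteType ℂ R] [AddCommGroup M] [Module R M]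

lemma FlatConnection.act_algebraMap (C : FlatConnection ℂ R M) (c : ℂ) (m : M) :
    C.act (algebraMap ℂ (diffOps ℂ R) c) m = algebraMap ℂ R c • m := by
  rw [← C.act_mulOp]
  congr 2
  refine Subtype.ext (LinearMap.ext fun x => ?_)
  change c • x = algebraMap ℂ R c * x
  rw [Algebra.smul_def]

lemma FlatConnection.act_add_apply (C : FlatConnection ℂ R M) (L L' : diffOps ℂ R) (m : M) :
    C.act (L + L') m = C.act L m + C.act L' m := by rw [map_add]; rfl

lemma FlatConnection.act_mul_apply (C : FlatConnection ℂ R M) (L L' : diffOps ℂ R) (m : M) :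
    C.act (L * L') m = C.act L (C.act L' m) := by rw [map_mul]; rfl

/-- An `R`-linear map that is compatible with the connections commutes with the action of `D_R`. -/
lemma FlatConnection.act_map {M' : Type*} [AddCommGroup M'] [Module R M']
    (C : FlatConnection ℂ R M) (C' : FlatConnection ℂ R M') (T : M →ₗ[R] M')
    (hT : ∀ τ m, T (C.nabla τ m) = C'.nabla τ (T m)) (L : diffOps ℂ R) (m : M) :
    T (C.act L m) = C'.act L (T m) := by
  obtain ⟨L, hL⟩ := L
  induction hL using Algebra.adjoin_induction generalizing m with
  | mem x hx =>
    rcases hx with ⟨r, rfl⟩ | ⟨τ, rfl⟩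
    · exact ((congrArg T (C.act_mulOp r m)).trans (map_smul T r m)).trans (C'.act_mulOp r _).symm
    · exact ((congrArg T (C.act_derOp τ m)).trans (hT τ m)).trans (C'.act_derOp τ _).symm
  | algebraMap c =>
    exact ((congrArg T (C.act_algebraMap c m)).trans (map_smul T _ m)).trans
      (C'.act_algebraMap c _).symm
  | add x y hx hy ihx ihy =>
    exact ((congrArg T (C.act_add_apply ⟨x, hx⟩ ⟨y, hy⟩ m)).trans ((map_add T _ _).trans
      (congrArg₂ (· + ·) (ihx m) (ihy m)))).trans (C'.act_add_apply ⟨x, hx⟩ ⟨y, hy⟩ (T m)).symm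
  | mul x y hx hy ihx ihy =>
    exact ((congrArg T (C.act_mul_apply ⟨x, hx⟩ ⟨y, hy⟩ m)).trans ((ihx _).trans
      (congrArg _ (ihy m)))).trans (C'.act_mul_apply ⟨x, hx⟩ ⟨y, hy⟩ (T m)).symm

end Horizontal

/-! ### The module of formal exponentials -/

section Exponential

variable {σ A : Type*} [Fintype σ] [AddCommMonoid A] (α : σ → A)

/-- The operator `p e_a ↦ τ(p) e_a + ∑ₛ p τ(μₛ) e_{a + αₛ}` on the free `ℂ[μ]`-module with basis
`e_a`. The symbol `e_a` stands for the product of a monomial with exponent `a` and the exponential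
of `∑ₛ μₛ x^{αₛ}`. -/
def expNabla (τ : Derivation ℂ (MvPolynomial σ ℂ) (MvPolynomial σ ℂ)) :
    (A →₀ MvPolynomial σ ℂ) →+ (A →₀ MvPolynomial σ ℂ) :=
  Finsupp.liftAddHom fun a =>
    AddMonoidHom.mk' (fun p => Finsupp.single a (τ p) +
      ∑ s, Finsupp.single (a + α s) (p * τ (MvPolynomial.X s))) fun p q => by
        simp only [map_add, Finsupp.single_add, add_mul, Finset.sum_add_distrib]
        abel

lemma expNabla_single (τ : Derivation ℂ (MvPolynomial σ ℂ) (MvPolynomial σ ℂ)) (a : A)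
    (p : MvPolynomial σ ℂ) : expNabla α τ (Finsupp.single a p) = Finsupp.single a (τ p) +
      ∑ s, Finsupp.single (a + α s) (p * τ (MvPolynomial.X s)) := by
  rw [expNabla, Finsupp.liftAddHom_apply_single]; rfl

lemma expNabla_bracket (τ τ' : Derivation ℂ (MvPolynomial σ ℂ) (MvPolynomial σ ℂ)) (a : A)
    (p : MvPolynomial σ ℂ) : expNabla α ⁅τ, τ'⁆ (Finsupp.single a p) =
      expNabla α τ (expNabla α τ' (Finsupp.single a p)) -
        expNabla α τ' (expNabla α τ (Finsupp.single a p)) := by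
  have key : ∀ τ τ' : Derivation ℂ (MvPolynomial σ ℂ) (MvPolynomial σ ℂ),
      expNabla α τ (expNabla α τ' (Finsupp.single a p)) =
      Finsupp.single a (τ (τ' p)) +
        ∑ s, Finsupp.single (a + α s) (τ' p * τ (MvPolynomial.X s)) +
        (∑ s, Finsupp.single (a + α s) (p * τ (τ' (MvPolynomial.X s))) +
          ∑ s, Finsupp.single (a + α s) (τ p * τ' (MvPolynomial.X s)) +
          ∑ s, ∑ t, Finsupp.single (a + α s + α t)
            (p * τ' (MvPolynomial.X s) * τ (MvPolynomial.X t))) := by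
    intro τ τ'
    rw [expNabla_single, map_add, map_sum, expNabla_single, ← Finset.sum_add_distrib,
      ← Finset.sum_add_distrib]
    congr 1
    refine Finset.sum_congr rfl fun s _ => ?_
    rw [expNabla_single, Derivation.leibniz, smul_eq_mul, smul_eq_mul, Finsupp.single_add,
      mul_comm (τ' (MvPolynomial.X s))]
  have hs : ∑ s, ∑ t, Finsupp.single (a + α s + α t)
        (p * τ' (MvPolynomial.X s) * τ (MvPolynomial.X t)) =
      ∑ s, ∑ t, Finsupp.single (a + α s + α t)
        (p * τ (MvPolynomial.X s) * τ' (MvPolynomial.X t)) := by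
    rw [Finset.sum_comm]
    refine Finset.sum_congr rfl fun s _ => Finset.sum_congr rfl fun t _ => ?_
    rw [add_right_comm, mul_right_comm]
  have hb : ∑ s, Finsupp.single (a + α s) (p * (⁅τ, τ'⁆ :
        Derivation ℂ (MvPolynomial σ ℂ) (MvPolynomial σ ℂ)) (MvPolynomial.X s)) =
      ∑ s, Finsupp.single (a + α s) (p * τ (τ' (MvPolynomial.X s))) -
        ∑ s, Finsupp.single (a + α s) (p * τ' (τ (MvPolynomial.X s))) := by
    rw [← Finset.sum_sub_distrib]
    refine Finset.sum_congr rfl fun s _ => ?_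
    rw [Derivation.commutator_apply, mul_sub, Finsupp.single_sub]
  rw [key, key, expNabla_single, hs, hb, Derivation.commutator_apply, Finsupp.single_sub]
  abel

/-- The free `ℂ[μ]`-module on the `e_a`, with the connection `expNabla`. -/
def expConnection : FlatConnection ℂ (MvPolynomial σ ℂ) (A →₀ MvPolynomial σ ℂ) where
  nabla := expNabla α
  nabla_add τ τ' m := by
    induction m using Finsupp.induction_linear with
    | zero => simp
    | add x y hx hy => simp only [map_add, hx, hy]; abel
    | single a p =>
      simp only [expNabla_single, Derivation.add_apply, mul_add, Finsupp.single_add,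
        Finset.sum_add_distrib]
      abel
  nabla_smul q τ m := by
    induction m using Finsupp.induction_linear with
    | zero => simp
    | add x y hx hy => simp only [map_add, hx, hy, smul_add]
    | single a p =>
      simp only [expNabla_single, Derivation.smul_apply, smul_add, Finset.smul_sum,
        Finsupp.smul_single, smul_eq_mul, mul_left_comm]
  leibniz τ q m := by
    induction m using Finsupp.induction_linear with
    | zero => simp
    | add x y hx hy => simp only [map_add, hx, hy, smul_add]; abel
    | single a p =>
      simp only [Finsupp.smul_single, smul_eq_mul, expNabla_single, smul_add, Finset.smul_sum,
        Derivation.leibniz, mul_assoc, Finsupp.single_add, mul_comm p]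
      abel
  flat τ τ' m := by
    induction m using Finsupp.induction_linear with
    | zero => simp
    | add x y hx hy => simp only [map_add, hx, hy]; abel
    | single a p => exact expNabla_bracket α τ τ' a p

/-- The action of `D_{ℂ[μ]}` on the free module on the `e_a`. -/
def weylAct : Weyl σ →+* AddMonoid.End (A →₀ MvPolynomial σ ℂ) := (expConnection α).act

lemma weylAct_add (w w' : Weyl σ) (m : A →₀ MvPolynomial σ ℂ) :
    weylAct α (w + w') m = weylAct α w m + weylAct α w' m := by rw [map_add]; rfl

lemma weylAct_mul (w w' : Weyl σ) (m : A →₀ MvPolynomial σ ℂ) :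
    weylAct α (w * w') m = weylAct α w (weylAct α w' m) := by rw [map_mul]; rfl

lemma weylAct_weylC (p : MvPolynomial σ ℂ) (m : A →₀ MvPolynomial σ ℂ) :
    weylAct α (weylC p) m = p • m := (expConnection α).act_mulOp p m

lemma weylAct_smul (p : MvPolynomial σ ℂ) (w : Weyl σ) (m : A →₀ MvPolynomial σ ℂ) :
    weylAct α (p • w) m = p • weylAct α w m := by
  rw [weyl_smul_def, weylAct_mul, weylAct_weylC]

lemma weylAct_partialOp (s : σ) (m : A →₀ MvPolynomial σ ℂ) :
    weylAct α (partialOp s) m = expNabla α (MvPolynomial.pderiv s) m :=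
  (expConnection α).act_derOp _ m

lemma weylAct_partialOp_single (s : σ) (a : A) :
    weylAct α (partialOp s) (Finsupp.single a 1) = Finsupp.single (a + α s) 1 := by
  classical
  rw [weylAct_partialOp, expNabla_single, Derivation.map_one_eq_zero, Finsupp.single_zero,
    zero_add, Finset.sum_eq_single s]
  · simp
  · intro t _ h
    rw [MvPolynomial.pderiv_X_of_ne h, mul_zero, Finsupp.single_zero]
  · simp

lemma weylAct_partialOp_pow_single (s : σ) (n : ℕ) (a : A) :
    weylAct α (partialOp s ^ n) (Finsupp.single a 1) = Finsupp.single (a + n • α s) 1 := by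
  induction n generalizing a with
  | zero => simp
  | succ n ih =>
    rw [pow_succ, weylAct_mul, weylAct_partialOp_single, ih, succ_nsmul',
      add_assoc]

lemma weylAct_partialPow_single (n : σ → ℕ) (a : A) :
    weylAct α (partialPow n) (Finsupp.single a 1) = Finsupp.single (a + ∑ s, n s • α s) 1 := by
  classical
  unfold partialPow
  suffices h : ∀ (S : Finset σ) (h : Set.Pairwise (S : Set σ)
      (Function.onFun Commute fun s => partialOp s ^ n s)),
      weylAct α (S.noncommProd (fun s => partialOp s ^ n s) h) (Finsupp.single a 1) =
        Finsupp.single (a + ∑ s ∈ S, n s • α s) 1 from h _ _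
  intro S
  induction S using Finset.induction_on with
  | empty => intro h; simp
  | insert s S hs ih =>
    intro h
    rw [Finset.noncommProd_insert_of_notMem _ _ _ _ hs, weylAct_mul, ih,
      weylAct_partialOp_pow_single, Finset.sum_insert hs, add_assoc,
      add_comm (∑ s ∈ S, n s • α s)]

/-- Operators `□_b` kill `e_a` if `b` is a relation among the `αₛ`. -/
lemma weylAct_box_single (b : σ → ℤ) (hb : ∑ s, (b s).toNat • α s = ∑ s, (-b s).toNat • α s)
    (a : A) : weylAct α (box b) (Finsupp.single a 1) = 0 := by
  rw [← sub_self (weylAct α (partialPow fun s => (b s).toNat) (Finsupp.single a 1))]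
  nth_rewrite 2 [weylAct_partialPow_single]
  rw [hb, ← weylAct_partialPow_single, box, map_sub]
  rfl

/-- The relation `(ℓ(a) + 1) e_a + ∑ₛ ℓ(αₛ) μₛ e_{a + αₛ}`. It is the derivative of `x e_a` with
respect to a coordinate `x` that occurs with the exponent `ℓ(a)` in the monomial of exponent `a`. -/
def expRel (l : A →+ ℕ) (a : A) : A →₀ MvPolynomial σ ℂ :=
  Finsupp.single a ((l a + 1 : ℕ) : MvPolynomial σ ℂ) +
    ∑ s, Finsupp.single (a + α s) (l (α s) • MvPolynomial.X s)

lemma expNabla_expRel (τ : Derivation ℂ (MvPolynomial σ ℂ) (MvPolynomial σ ℂ)) (l : A →+ ℕ)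
    (a : A) : expNabla α τ (expRel α l a) = ∑ s, τ (MvPolynomial.X s) • expRel α l (a + α s) := by
  have e1 : expNabla α τ (Finsupp.single a ((l a + 1 : ℕ) : MvPolynomial σ ℂ)) =
      ∑ s, Finsupp.single (a + α s) (((l a + 1 : ℕ) : MvPolynomial σ ℂ) *
        τ (MvPolynomial.X s)) := by
    rw [expNabla_single, Derivation.map_natCast, Finsupp.single_zero, zero_add]
  have e2 : ∀ s, expNabla α τ (Finsupp.single (a + α s) (l (α s) • MvPolynomial.X s)) =
      Finsupp.single (a + α s) (l (α s) • τ (MvPolynomial.X s)) +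
        ∑ t, Finsupp.single (a + α s + α t) (l (α s) • MvPolynomial.X s * τ (MvPolynomial.X t)) :=
    fun s => by rw [expNabla_single, map_nsmul]
  rw [expRel, map_add, map_sum, e1, Finset.sum_congr rfl fun s _ => e2 s, Finset.sum_add_distrib,
    Finset.sum_comm, ← add_assoc, ← Finset.sum_add_distrib, ← Finset.sum_add_distrib]
  refine Finset.sum_congr rfl fun s _ => ?_
  rw [expRel, smul_add, Finset.smul_sum, Finsupp.smul_single, ← Finsupp.single_add]
  congr 1
  · congr 1
    rw [map_add]
    simp only [nsmul_eq_mul, smul_eq_mul]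
    push_cast
    ring
  · refine Finset.sum_congr rfl fun t _ => ?_
    rw [Finsupp.smul_single, smul_eq_mul, mul_comm, add_right_comm]

/-- The operators `∑ₛ ℓ(αₛ) μₛ ∂/∂μₛ + ℓ(a) + 1` turn `e_a` into `expRel α ℓ a`. -/
lemma weylAct_euler_single (l : A →+ ℕ) (a : A) :
    weylAct α (∑ s, l (α s) • euler s + ((l a + 1 : ℕ) : Weyl σ)) (Finsupp.single a 1) =
      expRel α l a := by
  rw [weylAct_add, map_sum, map_natCast, AddMonoid.End.natCast_apply, expRel, add_comm]
  congr 1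
  · rw [Finsupp.smul_single, nsmul_eq_mul, mul_one]
  · refine (AddMonoidHom.finsetSum_apply _ _ _).trans (Finset.sum_congr rfl fun s _ => ?_)
    refine (congrArg (fun g : AddMonoid.End _ => g _) (map_nsmul _ _ _)).trans ?_
    change l (α s) • weylAct α (euler s) (Finsupp.single a 1) = _
    rw [euler, weylAct_mul,
      weylAct_partialOp_single, weylAct_weylC, Finsupp.smul_single, smul_eq_mul, mul_one,
      Finsupp.smul_single]

/-- The submodule spanned by the relations `expRel`, for the degree functions `ℓ k`. -/
def expRels {κ : Type*} (l : κ → A →+ ℕ) :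
    Submodule (MvPolynomial σ ℂ) (A →₀ MvPolynomial σ ℂ) :=
  Submodule.span _ (Set.range fun p : κ × A => expRel α (l p.1) p.2)

lemma weylAct_mem {κ : Type*} (l : κ → A →+ ℕ) (w : Weyl σ) {m : A →₀ MvPolynomial σ ℂ}
    (hm : m ∈ expRels α l) : weylAct α w m ∈ expRels α l := by
  refine (expConnection α).act_mem (expRels α l) (fun τ m hm => ?_) w hm
  induction hm using Submodule.span_induction with
  | mem x hx =>
    obtain ⟨⟨k, a⟩, rfl⟩ := hx
    refine (expNabla_expRel α τ (l k) a).symm ▸ sum_mem fun s _ => Submodule.smul_mem _ _ ?_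
    exact Submodule.subset_span ⟨(k, a + α s), rfl⟩
  | zero => rw [map_zero]; exact zero_mem _
  | add x y _ _ hx hy => rw [map_add]; exact add_mem hx hy
  | smul q x hx h =>
    rw [(expConnection α).leibniz]
    exact add_mem (Submodule.smul_mem _ _ h) (Submodule.smul_mem _ _ hx)

section Specialize

variable {α} {R H : Type*} [CommRing R] [Algebra ℂ R] [Algebra (MvPolynomial σ ℂ) R]
  [IsScalarTower ℂ (MvPolynomial σ ℂ) R] [AddCommGroup H] [Module R H]

/-- The semilinear map `p e_a ↦ p(λ) Φ(a)`. -/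
def expEval (Φ : A → H) : (A →₀ MvPolynomial σ ℂ) →+ H :=
  Finsupp.liftAddHom fun a => AddMonoidHom.mk' (fun p => algebraMap _ R p • Φ a)
    fun p q => by rw [map_add, add_smul]

omit [Fintype σ] [AddCommMonoid A] [Algebra ℂ R] [IsScalarTower ℂ (MvPolynomial σ ℂ) R] in
lemma expEval_single (Φ : A → H) (a : A) (p : MvPolynomial σ ℂ) :
    expEval (R := R) Φ (Finsupp.single a p) = algebraMap _ R p • Φ a := by
  rw [expEval, Finsupp.liftAddHom_apply_single]; rfl

omit [Fintype σ] [AddCommMonoid A] [Algebra ℂ R] [IsScalarTower ℂ (MvPolynomial σ ℂ) R] in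
lemma expEval_smul (Φ : A → H) (q : MvPolynomial σ ℂ) (m : A →₀ MvPolynomial σ ℂ) :
    expEval (R := R) Φ (q • m) = algebraMap _ R q • expEval (R := R) Φ m := by
  induction m using Finsupp.induction_linear with
  | zero => simp
  | add x y hx hy => simp only [smul_add, map_add, hx, hy]
  | single a p => rw [Finsupp.smul_single, expEval_single, expEval_single, smul_eq_mul, map_mul,
      mul_smul]

variable (C : FlatConnection ℂ R H) {Φ : A → H}

lemma nabla_expEval (hΦ : ∀ τ a, C.nabla τ (Φ a) = ∑ s, τ (coef R s) • Φ (a + α s))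
    (τ : Derivation ℂ R R) (m : A →₀ MvPolynomial σ ℂ) :
    C.nabla τ (expEval (R := R) Φ m) = ∑ s, τ (coef R s) • expEval (R := R) Φ
      (weylAct α (partialOp s) m) := by
  classical
  induction m using Finsupp.induction_linear with
  | zero => simp
  | add x y hx hy => simp only [map_add, hx, hy, smul_add, Finset.sum_add_distrib]
  | single a p =>
    have e : ∀ s, expEval (R := R) Φ (weylAct α (partialOp s) (Finsupp.single a p)) =
        algebraMap _ R (MvPolynomial.pderiv s p) • Φ a + algebraMap _ R p • Φ (a + α s) := by
      intro s
      rw [weylAct_partialOp, expNabla_single, map_add, map_sum, expEval_single,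
        Finset.sum_eq_single s]
      · rw [expEval_single, MvPolynomial.pderiv_X_self, mul_one]
      · intro t _ h
        rw [MvPolynomial.pderiv_X_of_ne h, mul_zero, Finsupp.single_zero, map_zero]
      · simp
    rw [Finset.sum_congr rfl fun s _ => by rw [e s, smul_add], Finset.sum_add_distrib,
      expEval_single, C.leibniz, hΦ, chain_rule, Finset.sum_smul, Finset.smul_sum, add_comm]
    congr 1
    · exact Finset.sum_congr rfl fun s _ => by rw [mul_smul]; rfl
    · exact Finset.sum_congr rfl fun s _ => smul_comm _ _ _

/-- The map `e ⊗ w ↦ e • (w e_a)(Φ)` on the pull-back. -/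
def pullEvalHom (α : σ → A) (Φ : A → H) (a : A) : PullBack σ R →+ H :=
  TensorProduct.liftAddHom
    (AddMonoidHom.mk' (fun e => AddMonoidHom.mk'
      (fun w : Weyl σ => e • expEval (R := R) Φ (weylAct α w (Finsupp.single a 1)))
      fun w w' => by rw [weylAct_add, map_add, smul_add])
      fun e e' => by ext w; exact add_smul _ _ _)
    fun p e w => by
      change (p • e) • expEval (R := R) Φ _ = e • expEval (R := R) Φ _
      rw [weylAct_smul, expEval_smul, Algebra.smul_def, mul_smul, smul_comm]

/-- The map `pullEvalHom`, as an `R`-linear map. -/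
def pullEval (α : σ → A) (Φ : A → H) (a : A) : PullBack σ R →ₗ[R] H where
  toFun := pullEvalHom α Φ a
  map_add' := map_add _
  map_smul' r x := by
    induction x using PullBack.induction with
    | h0 => simp
    | ha x y hx hy => simp only [smul_add, map_add, hx, hy]
    | ht e w =>
      rw [PullBack.smul_tmul]
      exact mul_smul r e _

omit [Algebra ℂ R] [IsScalarTower ℂ (MvPolynomial σ ℂ) R] in
lemma pullEval_tmul (a : A) (e : R) (w : Weyl σ) : pullEval α Φ a (PullBack.tmul e w) =
    e • expEval (R := R) Φ (weylAct α w (Finsupp.single a 1)) := rfl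

lemma pullEval_nabla (hΦ : ∀ τ a, C.nabla τ (Φ a) = ∑ s, τ (coef R s) • Φ (a + α s)) (a : A)
    (τ : Derivation ℂ R R) (x : PullBack σ R) :
    pullEval α Φ a ((pullConnection R).nabla τ x) = C.nabla τ (pullEval α Φ a x) := by
  induction x using PullBack.induction with
  | h0 => simp
  | ha x y hx hy => simp only [map_add, hx, hy]
  | ht e w =>
    change pullEval α Φ a (pullNabla R τ _) = _
    rw [pullNabla_tmul, map_add, map_sum, pullEval_tmul, pullEval_tmul, C.leibniz,
      nabla_expEval C hΦ, Finset.smul_sum, add_comm]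
    congr 1
    refine Finset.sum_congr rfl fun s _ => ?_
    rw [pullEval_tmul, weylAct_mul, mul_smul]

/-- If a family `Φ` of elements of a module with connection satisfies the differential equations of
the `e_a`, then `L ∈ D_R` kills `Φ a` whenever `L (1 ⊗ 1)` lies in the image of a left ideal whose
elements kill `e_a` modulo the relations satisfied by `Φ`. -/
lemma act_eq_zero_of_mem_restrictIdeal [Algebra.FormallySmooth ℂ R] [Algebra.EssFiniteType ℂ R]
    (hΦ : ∀ τ a, C.nabla τ (Φ a) = ∑ s, τ (coef R s) • Φ (a + α s)) {κ : Type*} (l : κ → A →+ ℕ)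
    (hl : ∀ k a, (l k a + 1) • Φ a + ∑ s, l k (α s) • coef R s • Φ (a + α s) = 0) (a : A)
    (S : Set (Weyl σ)) (hS : ∀ w ∈ S, weylAct α w (Finsupp.single a 1) ∈ expRels α l)
    {L : diffOps ℂ R} (hL : L ∈ restrictIdeal R (Ideal.span S)) : C.act L (Φ a) = 0 := by
  have h0 : ∀ m ∈ expRels α l, expEval (R := R) Φ m = 0 := fun m hm => by
    induction hm using Submodule.span_induction with
    | mem x hx =>
      obtain ⟨⟨k, b⟩, rfl⟩ := hx
      rw [← hl k b]
      simp only [expRel, map_add, map_sum, expEval_single, map_nsmul, map_natCast, Nat.cast_smul_eq_nsmul,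
        smul_assoc]
      rfl
    | zero => exact map_zero _
    | add x y _ _ hx hy => rw [map_add, hx, hy, add_zero]
    | smul q x _ h => rw [expEval_smul, h, smul_zero]
  have hI : ∀ w ∈ Ideal.span S, weylAct α w (Finsupp.single a 1) ∈ expRels α l := fun w hw => by
    induction hw using Submodule.span_induction with
    | mem w hw => exact hS w hw
    | zero => rw [map_zero]; exact zero_mem _
    | add x y _ _ hx hy => rw [map_add]; exact add_mem hx hy
    | smul v w _ h =>
      rw [smul_eq_mul, map_mul]
      exact weylAct_mem α l v h
  have hk : ∀ x ∈ pullIdeal R (Ideal.span S), pullEval α Φ a x = 0 := fun x hx => by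
    induction hx using Submodule.span_induction with
    | mem x hx =>
      obtain ⟨w, hw, rfl⟩ := hx
      rw [pullEval_tmul, h0 _ (hI w hw), smul_zero]
    | zero => exact map_zero _
    | add x y _ _ hx hy => rw [map_add, hx, hy, add_zero]
    | smul q x _ h => rw [map_smul, h, smul_zero]
  have h1 : Φ a = pullEval (R := R) α Φ a (PullBack.tmul 1 1) := by
    rw [pullEval_tmul, map_one, one_smul, AddMonoid.End.one_apply, expEval_single, map_one,
      one_smul]
  rw [h1, ← (pullConnection R).act_map C _ (pullEval_nabla C hΦ a)]
  exact hk _ hL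

end Specialize
end Exponential

/-! ### The operators of the hypergeometric ideal -/

section Lattice

variable {N r : ℕ} {m : Fin r → ℕ} (d : (Σ j, Fin (m j)) → Fin N →₀ ℕ)

/-- The lattice point `(d_{j,i}, e_j)`. The second component, a vector of natural numbers, is
written as a multiset. -/
def latticePt (s : Σ j, Fin (m j)) : (Fin N →₀ ℕ) × Multiset (Fin r) := (d s, {s.1})

/-- The coordinate functions of a lattice point. -/
def latticeDeg : Fin N ⊕ Fin r → (Fin N →₀ ℕ) × Multiset (Fin r) →+ ℕ
  | .inl k => (Finsupp.applyAddHom k).comp (AddMonoidHom.fst _ _)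
  | .inr j => (Multiset.countAddMonoidHom j).comp (AddMonoidHom.snd _ _)

@[simp] lemma latticeDeg_inr (j : Fin r) (a : (Fin N →₀ ℕ) × Multiset (Fin r)) :
    latticeDeg (.inr j) a = a.2.count j := rfl

lemma latticeDeg_injective {a b : (Fin N →₀ ℕ) × Multiset (Fin r)}
    (h : ∀ k, latticeDeg k a = latticeDeg k b) : a = b :=
  Prod.ext (Finsupp.ext fun k => h (.inl k)) (Multiset.ext.mpr fun j => h (.inr j))

lemma sum_latticePt_inr {M : Type*} [AddCommMonoid M] (j : Fin r) (g : (Σ j, Fin (m j)) → M) :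
    ∑ s, latticeDeg (.inr j) (latticePt d s) • g s = ∑ i, g ⟨j, i⟩ := by
  rw [Fintype.sum_sigma, Finset.sum_eq_single j]
  · simp [latticePt]
  · intro j' _ h
    refine Finset.sum_eq_zero fun i _ => ?_
    simp [latticePt, h.symm]
  · simp

lemma sum_toNat_latticePt {b : (Σ j, Fin (m j)) → ℤ} (hb : b ∈ latticeRel d) :
    ∑ s, (b s).toNat • latticePt d s = ∑ s, (-b s).toNat • latticePt d s := by
  refine latticeDeg_injective fun k => ?_
  rw [map_sum, map_sum]
  simp only [map_nsmul]
  zify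
  rw [← sub_eq_zero, ← Finset.sum_sub_distrib]
  have e : ∀ s, (((b s).toNat • latticeDeg k (latticePt d s) : ℕ) : ℤ) -
      ((-b s).toNat • latticeDeg k (latticePt d s) : ℕ) =
        latticeDeg k (latticePt d s) • b s := by
    intro s
    rw [smul_eq_mul, smul_eq_mul, nsmul_eq_mul, Nat.cast_mul, Nat.cast_mul, ← sub_mul,
      Int.toNat_sub_toNat_neg, mul_comm]
  rw [Finset.sum_congr rfl fun s _ => e s]
  cases k with
  | inl k =>
    rw [← hb.1 k]
    refine Finset.sum_congr rfl fun s _ => ?_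
    rw [nsmul_eq_mul, mul_comm]; rfl
  | inr j => rw [sum_latticePt_inr, hb.2 j]

variable {R H : Type*} [CommRing R] [Algebra ℂ R] [Algebra.FormallySmooth ℂ R]
  [Algebra.EssFiniteType ℂ R] [AddCommGroup H] [Module R H]

/-- A family `Φ` indexed by lattice points that satisfies the differential equations of the
`x^a y^v exp(∑_j y_j f_j)`, modulo derivatives with respect to the `x_k` and the `y_j`, gives
solutions of the equations in `I_R(u, 0)`. -/
lemma act_eq_zero_of_mem_hypIdealOver (C : FlatConnection ℂ R H)
    (Φ : (Fin N →₀ ℕ) × Multiset (Fin r) → H) (lam : (Σ j, Fin (m j)) → R)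
    (hΦ : ∀ τ a, C.nabla τ (Φ a) = ∑ s, τ (lam s) • Φ (a + latticePt d s))
    (hl : ∀ k a, (latticeDeg k a + 1) • Φ a +
      ∑ s, latticeDeg k (latticePt d s) • lam s • Φ (a + latticePt d s) = 0)
    (u : Fin N →₀ ℕ) {L : diffOps ℂ R} (hL : L ∈ hypIdealOver d lam u 0) :
    C.act L (Φ (u, 0)) = 0 := by
  let _ : Algebra (MvPolynomial (Σ j, Fin (m j)) ℂ) R := (MvPolynomial.aeval lam).toAlgebra
  have : IsScalarTower ℂ (MvPolynomial (Σ j, Fin (m j)) ℂ) R :=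
    IsScalarTower.of_algebraMap_eq fun c => ((MvPolynomial.aeval lam).commutes c).symm
  have hc : ∀ s, coef R s = lam s := fun s => MvPolynomial.aeval_X lam s
  refine act_eq_zero_of_mem_restrictIdeal (α := latticePt d) C (fun τ a => ?_) latticeDeg
    (fun k a => ?_) (u, 0) _ ?_ hL
  · simpa only [hc] using hΦ τ a
  · simpa only [hc] using hl k a
  · rintro w ((⟨b, hb, rfl⟩ | ⟨k, rfl⟩) | ⟨j, rfl⟩)
    · rw [weylAct_box_single _ _ (sum_toNat_latticePt d hb)]
      exact zero_mem _
    · refine Submodule.subset_span ⟨(.inl k, (u, 0)), ?_⟩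
      exact (weylAct_euler_single _ _ _).symm
    · refine Submodule.subset_span ⟨(.inr j, (u, 0)), ?_⟩
      refine (weylAct_euler_single _ _ _).symm.trans ?_
      rw [sum_latticePt_inr, latticeDeg_inr, Multiset.count_zero]
      rfl

end Lattice

/-! ### Functoriality of differential forms -/

section Functoriality

variable {R C B : Type*} [CommRing R] [CommRing C] [CommRing B] [Algebra R C] [Algebra R B]
  [Algebra C B] [IsScalarTower R C B]

variable (R C B) in
/-- The map from one-forms of `C` to forms of `B`. -/
def oneFormsMap : Ω[C⁄R] →ₗ[C] Forms R B :=
  (ExteriorAlgebra.ι B).restrictScalars C ∘ₗ KaehlerDifferential.map R R C B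

lemma oneFormsMap_sq (x : Ω[C⁄R]) : oneFormsMap R C B x * oneFormsMap R C B x = 0 :=
  ExteriorAlgebra.ι_sq_zero _

variable (R C B) in
/-- The map on differential forms induced by a homomorphism `C → B` of `R`-algebras. -/
def formsMap : Forms R C →ₐ[C] Forms R B :=
  ExteriorAlgebra.lift C ⟨oneFormsMap R C B, oneFormsMap_sq⟩

lemma formsMap_dB (c : C) : formsMap R C B (dB R c) = dB R (algebraMap C B c) := by
  rw [formsMap, dB, ExteriorAlgebra.lift_ι_apply]
  simp [dB, oneFormsMap]

lemma formsMap_smul (c : C) (x : Forms R C) :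
    formsMap R C B (c • x) = algebraMap C B c • formsMap R C B x := by
  rw [map_smul, algebraMap_smul]

lemma formsMap_extD (x : Forms R C) :
    formsMap R C B (extD R C x) = extD R B (formsMap R C B x) := by
  induction x using OpData.forms_induction with
  | h1 => rw [extD_one, map_one, extD_one, map_zero]
  | ha x y hx hy => simp only [map_add, hx, hy]
  | hs b x hx => simp only [formsMap_smul, extD_smul, map_add, map_mul, formsMap_dB, hx]
  | hD b x hx => simp only [map_mul, formsMap_dB, extD_dB_mul, map_neg, hx]

lemma formsMap_mem {n : ℕ} {x : Forms R C} (hx : x ∈ ⋀[C]^n Ω[C⁄R]) :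
    formsMap R C B x ∈ ⋀[B]^n Ω[B⁄R] := by
  induction n generalizing x with
  | zero =>
    obtain ⟨c, rfl⟩ := mem_grade_zero hx
    rw [formsMap_smul, map_one]
    exact Submodule.smul_mem _ _ one_mem_grade
  | succ n ih =>
    refine grade_induction (p := fun z => formsMap R C B z ∈ ⋀[B]^(n + 1) Ω[B⁄R])
      (fun x y hx hy => ?_) (fun b x hx h => ?_) (fun b y hy => ?_) hx
    · rw [map_add]; exact add_mem hx hy
    · rw [formsMap_smul]; exact Submodule.smul_mem _ _ h
    · rw [map_mul, formsMap_dB]; exact dB_mul_mem _ (ih hy)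

lemma formsMap_lieD {K : Type*} [CommRing K] [Algebra K R] [Algebra K C] [Algebra K B]
    {τ : Derivation K R R} {θ : Derivation K C C} {θ' : Derivation K B B} (h : IsLift τ θ)
    (h' : IsLift τ θ') (hθ : ∀ c, θ' (algebraMap C B c) = algebraMap C B (θ c)) (x : Forms R C) :
    formsMap R C B (lieD h x) = lieD h' (formsMap R C B x) := by
  induction x using OpData.forms_induction with
  | h1 => rw [lieD_one, map_one, lieD_one, map_zero]
  | ha x y hx hy => simp only [map_add, hx, hy]
  | hs b x hx => simp only [formsMap_smul, lieD_smul, map_add, hθ, hx]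
  | hD b x hx => simp only [map_mul, formsMap_dB, lieD_dB_mul, map_add, hθ, hx]

end Functoriality

/-! ### Division of forms by `df₁ ∧ ⋯ ∧ df_r` -/

section Division

variable {R C : Type*} [CommRing R] [CommRing C] [Algebra R C] {ι : Type*} (φ : ι → C)
  (θ : ι → Derivation R C C)

/-- The product `dφ_{i₁} ∧ ⋯ ∧ dφ_{iₖ}` over a list of indices. -/
def dProd (l : List ι) : Forms R C := (l.map fun i => dB R (φ i)).prod

@[simp] lemma dProd_nil : dProd (R := R) φ [] = 1 := rfl

@[simp] lemma dProd_cons (i : ι) (l : List ι) :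
    dProd (R := R) φ (i :: l) = dB R (φ i) * dProd φ l := rfl

/-- Successive contraction with the derivations in a list. -/
def contrList : List ι → Forms R C →ₗ[C] Forms R C
  | [] => LinearMap.id
  | i :: l => contrList l ∘ₗ contr (θ i)

@[simp] lemma contrList_nil (x : Forms R C) : contrList θ [] x = x := rfl

@[simp] lemma contrList_cons (i : ι) (l : List ι) (x : Forms R C) :
    contrList θ (i :: l) x = contrList θ l (contr (θ i) x) := rfl

lemma contrList_mem {n : ℕ} (l : List ι) {x : Forms R C} (hx : x ∈ ⋀[C]^n Ω[C⁄R]) :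
    contrList θ l x ∈ ⋀[C]^(n - l.length) Ω[C⁄R] := by
  induction l generalizing n x with
  | nil => exact hx
  | cons i l ih =>
    rw [contrList_cons, List.length_cons]
    cases n with
    | zero => rw [contr_grade_zero _ hx, map_zero]; exact zero_mem _
    | succ n => rw [Nat.add_sub_add_right]; exact ih (contr_mem _ hx)

lemma dProd_mem (l : List ι) : dProd φ l ∈ ⋀[C]^l.length Ω[C⁄R] := by
  induction l with
  | nil => exact one_mem_grade
  | cons i l ih => exact dB_mul_mem _ ih

lemma dB_mul_dProd (c : C) (l : List ι) :
    dB R c * dProd φ l = (-1 : ℤ) ^ l.length • (dProd φ l * dB R c) := by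
  induction l with
  | nil => simp
  | cons i l ih =>
    rw [dProd_cons, ← mul_assoc, dB_anticomm, neg_mul, mul_assoc, ih, List.length_cons, pow_succ,
      mul_neg_one, neg_smul, mul_smul_comm, mul_assoc]

lemma extD_dProd_mul (l : List ι) (x : Forms R C) :
    extD R C (dProd φ l * x) = (-1 : ℤ) ^ l.length • (dProd φ l * extD R C x) := by
  induction l with
  | nil => simp
  | cons i l ih =>
    rw [dProd_cons, mul_assoc, extD_dB_mul, ih, List.length_cons, pow_succ, mul_neg_one, neg_smul,
      mul_smul_comm, mul_assoc]

lemma lieD_dProd_mul {K : Type*} [CommRing K] [Algebra K R] [Algebra K C] {τ : Derivation K R R}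
    {E : Derivation K C C} (h : IsLift τ E) (l : List ι) (hE : ∀ i ∈ l, dB R (E (φ i)) = 0)
    (x : Forms R C) : lieD h (dProd φ l * x) = dProd φ l * lieD h x := by
  induction l with
  | nil => simp
  | cons i l ih =>
    rw [dProd_cons, mul_assoc, lieD_dB_mul, hE i (by simp), ih fun j hj => hE j (by simp [hj]),
      mul_assoc, zero_mul, zero_add]

lemma contr_dProd_mul (v : Derivation R C C) (l : List ι) (hv : ∀ i ∈ l, v (φ i) = 0)
    (x : Forms R C) : contr v (dProd φ l * x) = (-1 : ℤ) ^ l.length • (dProd φ l * contr v x) := by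
  induction l with
  | nil => simp
  | cons i l ih =>
    rw [dProd_cons, mul_assoc, contr_dB_mul, hv i (by simp), zero_smul, zero_sub,
      ih fun j hj => hv j (by simp [hj]), List.length_cons, pow_succ, mul_neg_one, neg_smul,
      mul_smul_comm, mul_assoc]

variable {φ θ}

/-- A form that is killed by the `dφᵢ` is divisible by their product; the quotient is found by
contraction. -/
lemma dProd_mul_contrList [DecidableEq ι] (hθ : ∀ i j, θ i (φ j) = if i = j then 1 else 0)
    (l : List ι) (hl : l.Nodup) (x : Forms R C) (hx : ∀ i ∈ l, dB R (φ i) * x = 0) :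
    dProd φ l * contrList θ l x = x := by
  induction l generalizing x with
  | nil => simp
  | cons i l ih =>
    obtain ⟨hi, hl⟩ := List.nodup_cons.mp hl
    rw [contrList_cons, dProd_cons, mul_assoc, ih hl]
    · have := contr_dB_mul (θ i) (φ i) x
      rw [hx i (by simp), map_zero, hθ, if_pos rfl, one_smul] at this
      exact (sub_eq_zero.mp this.symm).symm
    · intro j hj
      have := contr_dB_mul (θ i) (φ j) x
      rw [hx j (by simp [hj]), map_zero, hθ, if_neg (by rintro rfl; exact hi hj), zero_smul,
        zero_sub, eq_comm, neg_eq_zero] at this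
      exact this

/-- The quotient in a division by the product of the `dφᵢ` is unique modulo multiples of the
`dφᵢ`. -/
lemma map_eq_zero_of_dProd_mul_eq_zero [DecidableEq ι] {A : Type*} [AddGroup A]
    (p : Forms R C →+ A) (hθ : ∀ i j, θ i (φ j) = if i = j then 1 else 0)
    (l : List ι) (hl : l.Nodup) (hp : ∀ i ∈ l, ∀ y, p (dB R (φ i) * y) = 0)
    (z : Forms R C) (hz : dProd φ l * z = 0) : p z = 0 := by
  induction l generalizing z with
  | nil => rw [dProd_nil, one_mul] at hz; rw [hz, map_zero]
  | cons i l ih =>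
    obtain ⟨hi, hl⟩ := List.nodup_cons.mp hl
    rw [dProd_cons, mul_assoc] at hz
    have h1 := contr_dB_mul (θ i) (φ i) (dProd φ l * z)
    rw [hz, map_zero, hθ, if_pos rfl, one_smul, contr_dProd_mul φ (θ i) l fun j hj => by
      rw [hθ, if_neg (by rintro rfl; exact hi hj)], mul_smul_comm, ← mul_assoc, dB_mul_dProd,
      smul_mul_assoc, smul_smul, ← mul_pow, neg_one_mul, neg_neg, one_pow, one_smul, mul_assoc,
      ← mul_sub] at h1
    have h2 := ih hl (fun j hj => hp j (by simp [hj])) _ h1.symm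
    rwa [map_sub, hp i (by simp), sub_zero] at h2

end Division

/-! ### Lie derivatives of top forms -/

section Top

variable {R C : Type*} [CommRing R] [CommRing C] [Algebra R C]

lemma contr_eq_sum {ι : Type*} (s : Finset ι) (c : ι → C) (θ : ι → Derivation R C C)
    (v : Derivation R C C) (hv : ∀ b, v b = ∑ i ∈ s, c i * θ i b) (x : Forms R C) :
    contr v x = ∑ i ∈ s, c i • contr (θ i) x := by
  induction x using OpData.forms_induction with
  | h1 => simp [contr_one]
  | ha x y hx hy => simp only [map_add, hx, hy, smul_add, Finset.sum_add_distrib]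
  | hs b x hx => simp only [map_smul, hx, Finset.smul_sum, smul_comm b]
  | hD b x hx =>
    simp only [contr_dB_mul, hx, hv, smul_sub, Finset.sum_sub_distrib, Finset.sum_smul, mul_smul,
      Finset.mul_sum, mul_smul_comm]

variable (R C) in
/-- The `n`-forms that are closed and killed by multiplication with all one-forms, such as the
forms of top degree. -/
def topForms (n : ℕ) : Submodule C (Forms R C) where
  carrier := {x | x ∈ ⋀[C]^n Ω[C⁄R] ∧ extD R C x = 0 ∧ ∀ c, dB R c * x = 0}
  zero_mem' := ⟨zero_mem _, map_zero _, fun _ => mul_zero _⟩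
  add_mem' {x y} hx hy := ⟨add_mem hx.1 hy.1, by rw [map_add, hx.2.1, hy.2.1, add_zero],
    fun c => by rw [mul_add, hx.2.2, hy.2.2, add_zero]⟩
  smul_mem' b x hx := ⟨Submodule.smul_mem _ _ hx.1,
    by rw [extD_smul, hx.2.1, hx.2.2, smul_zero, add_zero],
    fun c => by rw [mul_smul_comm, hx.2.2, smul_zero]⟩

variable {K : Type*} [CommRing K] [Algebra K R] [Algebra K C] {n : ℕ}

lemma lieD_mem_topForms {τ : Derivation K R R} {E : Derivation K C C} (h : IsLift τ E)
    {x : Forms R C} (hx : x ∈ topForms R C n) : lieD h x ∈ topForms R C n := by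
  refine ⟨lieD_mem h hx.1, by rw [extD_lieD, hx.2.1, map_zero], fun c => ?_⟩
  have := lieD_dB_mul h c x
  rwa [hx.2.2, hx.2.2, map_zero, zero_add, eq_comm] at this

lemma lieD_zero (h : IsLift (0 : Derivation K R R) (0 : Derivation K C C)) (x : Forms R C) :
    lieD h x = 0 := by
  induction x using OpData.forms_induction with
  | h1 => exact lieD_one h
  | ha x y hx hy => rw [map_add, hx, hy, add_zero]
  | hs b x hx => rw [lieD_smul, hx]; simp
  | hD b x hx => rw [lieD_dB_mul, hx]; simp [dB]

variable [IsScalarTower K R C]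

/-- A derivation over `R` is a lift of the zero derivation. -/
lemma isLift_restrictScalars (v : Derivation R C C) :
    IsLift (0 : Derivation K R R) (v.restrictScalars K) := fun r => by
  simp

/-- If the difference of two lifts of a derivation is a combination of the `θᵢ` with coefficients
`cᵢ`, then the Lie derivatives of a top form `x` differ by those of the `cᵢ x` along the `θᵢ`. -/
lemma lieD_sub_eq_sum {ι : Type*} [Fintype ι] {τ : Derivation K R R} {E W : Derivation K C C}
    (hE : IsLift τ E) (hW : IsLift τ W) (c : ι → C) (θ : ι → Derivation R C C)
    (hc : ∀ b, W b = E b - ∑ i, c i * θ i b) {x : Forms R C} (hx : x ∈ topForms R C n) :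
    lieD hW x = lieD hE x -
      ∑ i, lieD (isLift_restrictScalars (K := K) (θ i)) (c i • x) := by
  have h0 : IsLift (0 : Derivation K R R) (0 : Derivation K C C) := fun r => by simp
  have h1 : ∀ i, lieD (isLift_restrictScalars (K := K) (θ i)) (c i • x) =
      extD R C (c i • contr (θ i) x) := fun i => by
    have hi := lieD_sub (isLift_restrictScalars (K := K) (θ i)) h0 (c i • x)
    rw [lieD_zero, sub_zero, ((topForms R C n).smul_mem (c i) hx).2.1, map_zero, add_zero] at hi
    rw [hi, map_smul, contr_eq_sum Finset.univ (fun _ : Unit => 1) (fun _ => θ i) _ fun b => ?_]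
    · simp
    · change θ i b - 0 = _
      simp
  have h2 := lieD_sub hE hW x
  rw [hx.2.1, map_zero, add_zero, contr_eq_sum Finset.univ c θ _ fun b => ?_, map_sum] at h2
  · rw [Finset.sum_congr rfl fun i _ => h1 i, ← h2, sub_sub_cancel]
  · change E b - W b = _
    rw [hc, sub_sub_cancel]

end Top

/-! ### Products of commuting operators -/

section Words

variable {R Q ι : Type*} [CommRing R] [AddCommGroup Q] [Module R Q] (l : ι → Module.End R Q)

/-- The product of the commuting operators `lⱼ` over a multiset of indices `j`. -/
def wordOp (hl : ∀ i j, l i * l j = l j * l i) (M : Multiset ι) : Module.End R Q :=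
  haveI : LeftCommutative fun j (T : Module.End R Q) => l j * T :=
    ⟨fun i j T => by rw [← mul_assoc, hl, mul_assoc]⟩
  M.foldr (fun j T => l j * T) 1

variable {l} (hl : ∀ i j, l i * l j = l j * l i)

@[simp] lemma wordOp_zero : wordOp l hl 0 = 1 := rfl

@[simp] lemma wordOp_cons (j : ι) (M : Multiset ι) :
    wordOp l hl (j ::ₘ M) = l j * wordOp l hl M :=
  haveI : LeftCommutative fun j (T : Module.End R Q) => l j * T :=
    ⟨fun i j T => by rw [← mul_assoc, hl, mul_assoc]⟩
  Multiset.foldr_cons (fun j (T : Module.End R Q) => l j * T) 1 j M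

lemma apply_wordOp (D : Q →+ Q) (hD : ∀ j q, D (l j q) = l j (D q)) (M : Multiset ι) (q : Q) :
    D (wordOp l hl M q) = wordOp l hl M (D q) := by
  induction M using Multiset.induction_on with
  | empty => simp
  | cons j M ih => simp only [wordOp_cons, Module.End.mul_apply, hD, ih]

lemma wordOp_apply (j : ι) (M : Multiset ι) (q : Q) :
    wordOp l hl M (l j q) = wordOp l hl (j ::ₘ M) q := by
  rw [wordOp_cons]
  exact (apply_wordOp hl (l j).toAddMonoidHom
    (fun i q => LinearMap.congr_fun (hl j i) q) M q).symm

/-- The commutation relation `[∂ⱼ^k, xⱼ] = k ∂ⱼ^{k-1}`, for operators `lⱼ = -∂ⱼ` and `pⱼ = xⱼ`. -/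
lemma wordOp_cons_apply_mul [DecidableEq ι] (p : ι → Q → Q)
    (hp : ∀ i j q, l i (p j q) = p j (l i q) - if i = j then q else 0) (j : ι) (M : Multiset ι)
    (q : Q) : wordOp l hl (j ::ₘ M) (p j q) =
      p j (wordOp l hl (j ::ₘ M) q) - (M.count j + 1) • wordOp l hl M q := by
  induction M using Multiset.induction_on generalizing q with
  | empty => rw [wordOp_cons]; simp [hp]
  | cons i M ih =>
    rw [Multiset.cons_swap, wordOp_cons, Module.End.mul_apply, ih, map_sub, map_nsmul, hp]
    rw [wordOp_cons hl i M, Module.End.mul_apply, Module.End.mul_apply]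
    by_cases hij : i = j
    · subst hij
      rw [Multiset.count_cons_self, if_pos rfl, wordOp_cons, Module.End.mul_apply]
      rw [add_smul (M.count i + 1) 1, one_smul]
      abel
    · rw [if_neg hij, Multiset.count_cons_of_ne (Ne.symm hij), sub_zero]

end Words

/-! ### Residue forms along a complete intersection -/

section Residue

variable {K R C B : Type*} [CommRing K] [CommRing R] [CommRing C] [CommRing B] [Algebra K R]
  [Algebra K C] [Algebra K B] [Algebra R C] [Algebra R B] [Algebra C B]
  [IsScalarTower R C B] {r : ℕ} (n : ℕ) (φ : Fin r → C)

variable (K R) in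
/-- The span of the Lie derivatives of top forms along derivations over `R` that kill all `φⱼ`. -/
def vertForms : Submodule R (Forms R C) :=
  Submodule.span R {y | ∃ (E : Derivation K C C) (h : IsLift (0 : Derivation K R R) E)
    (x : Forms R C), x ∈ topForms R C n ∧ (∀ j, E (φ j) = 0) ∧ y = lieD h x}

variable (K R) in
/-- Top forms modulo Lie derivatives along derivations over `R` that kill all `φⱼ`. -/
abbrev TopQuot : Type _ :=
  (topForms R C n).restrictScalars R ⧸
    (vertForms K R n φ).submoduleOf ((topForms R C n).restrictScalars R)

/-- The class of a top form. -/
def TopQuot.mk (x : topForms R C n) : TopQuot K R n φ :=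
  Submodule.Quotient.mk (p := (vertForms K R n φ).submoduleOf
    ((topForms R C n).restrictScalars R)) ⟨x.1, x.2⟩

namespace TopQuot

variable {n φ}

lemma mk_surjective (q : TopQuot K R n φ) : ∃ x, mk n φ x = q := by
  obtain ⟨x, rfl⟩ := Submodule.Quotient.mk_surjective _ q
  exact ⟨⟨x.1, x.2⟩, rfl⟩

lemma mk_add (x y : topForms R C n) : (mk n φ (x + y) : TopQuot K R n φ) = mk n φ x + mk n φ y :=
  rfl

lemma mk_sub (x y : topForms R C n) : (mk n φ (x - y) : TopQuot K R n φ) = mk n φ x - mk n φ y :=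
  rfl

lemma mk_smul (a : R) (x : topForms R C n) :
    (mk n φ (a • x) : TopQuot K R n φ) = a • mk n φ x := rfl

lemma mk_sum {ι : Type*} (s : Finset ι) (x : ι → topForms R C n) :
    (mk n φ (∑ i ∈ s, x i) : TopQuot K R n φ) = ∑ i ∈ s, mk n φ (x i) :=
  map_sum (AddMonoidHom.mk' (mk (K := K) n φ) mk_add) x s

lemma mk_eq_mk {x y : topForms R C n} :
    (mk n φ x : TopQuot K R n φ) = mk n φ y ↔ (x - y : Forms R C) ∈ vertForms K R n φ :=
  Submodule.Quotient.eq _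

lemma mk_eq_zero {x : topForms R C n} :
    (mk n φ x : TopQuot K R n φ) = 0 ↔ (x : Forms R C) ∈ vertForms K R n φ :=
  Submodule.Quotient.mk_eq_zero _

end TopQuot

variable {n φ}

lemma smul_mem_vertForms (c : C) (hc : ∀ E : Derivation K C C,
    IsLift (0 : Derivation K R R) E → (∀ j, E (φ j) = 0) → E c = 0) {x : Forms R C}
    (hx : x ∈ vertForms K R n φ) : c • x ∈ vertForms K R n φ := by
  induction hx using Submodule.span_induction with
  | mem x hx =>
    obtain ⟨E, h, x, hx, hE, rfl⟩ := hx
    refine Submodule.subset_span ⟨E, h, c • x, Submodule.smul_mem _ _ hx, hE, ?_⟩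
    rw [lieD_smul, hc E h hE, zero_smul, add_zero]
  | zero => rw [smul_zero]; exact zero_mem _
  | add x y _ _ hx hy => rw [smul_add]; exact add_mem hx hy
  | smul a x _ h => rw [smul_comm]; exact Submodule.smul_mem _ _ h

lemma lieD_mem_vertForms {τ : Derivation K R R} {E : Derivation K C C} (h : IsLift τ E)
    (hE : ∀ j, ∃ a, E (φ j) = algebraMap R C a) {x : Forms R C}
    (hx : x ∈ vertForms K R n φ) : lieD h x ∈ vertForms K R n φ := by
  induction hx using Submodule.span_induction with
  | mem x hx =>
    obtain ⟨W, hW, x, hx, hWφ, rfl⟩ := hx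
    have hb : IsLift (0 : Derivation K R R) ⁅E, W⁆ := by
      have := isLift_bracket h hW
      rwa [lie_zero] at this
    have e : lieD h (lieD hW x) = lieD hb x + lieD hW (lieD h x) := by
      rw [← sub_eq_iff_eq_add]
      exact (lieD_bracket h hW x).symm
    rw [e]
    refine add_mem (Submodule.subset_span ⟨_, hb, x, hx, fun j => ?_, rfl⟩)
      (Submodule.subset_span ⟨_, hW, _, lieD_mem_topForms h hx, hWφ, rfl⟩)
    obtain ⟨a, ha⟩ := hE j
    rw [Derivation.commutator_apply, hWφ, ha, hW, map_zero, Derivation.zero_apply, map_zero,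
      sub_zero]
  | zero => rw [map_zero]; exact zero_mem _
  | add x y _ _ hx hy => rw [map_add]; exact add_mem hx hy
  | smul a x hx h' =>
    rw [lieD_base_smul]
    exact add_mem (Submodule.smul_mem _ _ h') (Submodule.smul_mem _ _ hx)

namespace TopQuot

/-- The Lie derivative of classes of top forms. It is defined along derivations that map the `φⱼ` to
elements of `R`, since those preserve `vertForms`. -/
def lie {τ : Derivation K R R} {E : Derivation K C C} (h : IsLift τ E)
    (hE : ∀ j, ∃ a, E (φ j) = algebraMap R C a) : TopQuot K R n φ →+ TopQuot K R n φ :=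
  QuotientAddGroup.map _ _
    { toFun := fun x => ⟨lieD h x, lieD_mem_topForms h x.2⟩
      map_zero' := by ext; simp
      map_add' := fun x y => by ext; simp }
    fun _ hx => lieD_mem_vertForms h hE hx

lemma lie_mk {τ : Derivation K R R} {E : Derivation K C C} (h : IsLift τ E)
    (hE : ∀ j, ∃ a, E (φ j) = algebraMap R C a) (x : topForms R C n) :
    lie h hE (mk n φ x) = mk n φ ⟨lieD h x, lieD_mem_topForms h x.2⟩ := rfl

/-- Multiplication of classes of top forms by a function that is killed by all derivations over `R`
that kill the `φⱼ`. -/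
def mul (c : C) (hc : ∀ E : Derivation K C C,
    IsLift (0 : Derivation K R R) E → (∀ j, E (φ j) = 0) → E c = 0) :
    TopQuot K R n φ →+ TopQuot K R n φ :=
  QuotientAddGroup.map _ _
    { toFun := fun x => ⟨c • x.1, Submodule.smul_mem _ c x.2⟩
      map_zero' := by ext; simp
      map_add' := fun x y => by ext; simp }
    fun _ hx => smul_mem_vertForms c hc hx

lemma mul_mk (c : C) (hc : ∀ E : Derivation K C C,
    IsLift (0 : Derivation K R R) E → (∀ j, E (φ j) = 0) → E c = 0) (x : topForms R C n) :
    mul c hc (mk n φ x) = mk n φ (c • x) := rfl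

lemma lie_comm {τ τ' : Derivation K R R} {E E' : Derivation K C C} (h : IsLift τ E)
    (hE : ∀ j, ∃ a, E (φ j) = algebraMap R C a) (h' : IsLift τ' E')
    (hE' : ∀ j, ∃ a, E' (φ j) = algebraMap R C a) (hτ : ⁅τ, τ'⁆ = 0)
    (hc : ∀ j, E (E' (φ j)) = E' (E (φ j))) (q : TopQuot K R n φ) :
    lie h hE (lie h' hE' q) = lie h' hE' (lie h hE q) := by
  obtain ⟨x, rfl⟩ := mk_surjective q
  have hb : IsLift (0 : Derivation K R R) ⁅E, E'⁆ := hτ ▸ isLift_bracket h h'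
  rw [lie_mk, lie_mk, lie_mk, lie_mk, mk_eq_mk]
  refine Submodule.subset_span ⟨_, hb, x, x.2, fun j => ?_, (lieD_bracket h h' (x : Forms R C)).symm⟩
  rw [Derivation.commutator_apply, hc, sub_self]

lemma lie_smul {E : Derivation K C C} (h : IsLift (0 : Derivation K R R) E)
    (hE : ∀ j, ∃ a, E (φ j) = algebraMap R C a) (a : R) (q : TopQuot K R n φ) :
    lie h hE (a • q) = a • lie h hE q := by
  obtain ⟨x, rfl⟩ := mk_surjective q
  rw [← mk_smul, lie_mk, lie_mk, ← mk_smul]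
  congr 1
  refine Subtype.ext ((lieD_base_smul h a (x : Forms R C)).trans ?_)
  rw [Derivation.zero_apply, zero_smul, add_zero]
  rfl

lemma lie_mul {E : Derivation K C C} {τ : Derivation K R R} (h : IsLift τ E)
    (hE : ∀ j, ∃ a, E (φ j) = algebraMap R C a) (j : Fin r) (a : R)
    (ha : E (φ j) = algebraMap R C a) (hj) (q : TopQuot K R n φ) :
    lie h hE (mul (φ j) hj q) = mul (φ j) hj (lie h hE q) + a • q := by
  obtain ⟨x, rfl⟩ := mk_surjective q
  rw [mul_mk, lie_mk, lie_mk, mul_mk, ← mk_smul, ← mk_add]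
  congr 1
  refine Subtype.ext ((lieD_smul h (φ j) (x : Forms R C)).trans ?_)
  rw [ha, algebraMap_smul]
  rfl

end TopQuot

variable (θ : Fin r → Derivation R C C)
  (hθ : ∀ i j, θ i (φ j) = if i = j then 1 else 0) (hφ : ∀ j, algebraMap C B (φ j) = 0)

include hθ hφ in
lemma formsMap_eq_zero (z : Forms R C) (hz : dProd φ (List.finRange r) * z = 0) :
    formsMap R C B z = 0 :=
  map_eq_zero_of_dProd_mul_eq_zero (formsMap R C B).toAddMonoidHom hθ _ (List.nodup_finRange r)
    (fun i _ y => by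
      change formsMap R C B (dB R (φ i) * y) = 0
      rw [map_mul, formsMap_dB, hφ]; simp [dB]) z hz

include hθ in
lemma dProd_mul_contrList_top {x : Forms R C} (hx : x ∈ topForms R C n) :
    dProd φ (List.finRange r) * contrList θ (List.finRange r) x = x :=
  dProd_mul_contrList hθ _ (List.nodup_finRange r) x fun _ _ => hx.2.2 _

/-- The residue form of a top form `x`: the restriction `ω` of a quotient of `x` by
`dφ₁ ∧ ⋯ ∧ dφ_r`. -/
def resForm (B : Type*) [CommRing B] [Algebra R B] [Algebra C B] [IsScalarTower R C B]
    (x : Forms R C) : Forms R B :=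
  formsMap R C B (contrList θ (List.finRange r) x)

include hθ hφ in
/-- The residue form can be computed with any quotient. -/
lemma resForm_eq {x z : Forms R C} (hx : x ∈ topForms R C n)
    (hz : dProd φ (List.finRange r) * z = x) : resForm θ B x = formsMap R C B z := by
  rw [resForm, ← sub_eq_zero, ← map_sub]
  refine formsMap_eq_zero θ hθ hφ _ ?_
  rw [mul_sub, dProd_mul_contrList_top θ hθ hx, hz, sub_self]

lemma resForm_smul (c : C) (x : Forms R C) :
    resForm θ B (c • x) = algebraMap C B c • resForm θ B x := by
  rw [resForm, map_smul, formsMap_smul, resForm]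

lemma resForm_mem {x : Forms R C} (hx : x ∈ topForms R C n) :
    resForm θ B x ∈ ⋀[B]^(n - r) Ω[B⁄R] := by
  have := contrList_mem θ (List.finRange r) hx.1
  rw [List.length_finRange] at this
  exact formsMap_mem this

include hθ hφ in
lemma extD_resForm {x : Forms R C} (hx : x ∈ topForms R C n) :
    extD R B (resForm θ B x) = 0 := by
  rw [resForm, ← formsMap_extD]
  refine formsMap_eq_zero θ hθ hφ _ ?_
  have := extD_dProd_mul φ (List.finRange r) (contrList θ (List.finRange r) x)
  rw [dProd_mul_contrList_top θ hθ hx, hx.2.1] at this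
  have h2 := congrArg (((-1 : ℤ) ^ (List.finRange r).length) • ·) this
  simp only [smul_zero, smul_smul, ← mul_pow, neg_one_mul, neg_neg, one_pow, one_smul] at h2
  exact h2.symm

include hθ hφ in
/-- Residues commute with Lie derivatives along derivations that kill the `φⱼ`. -/
lemma resForm_lieD {τ : Derivation K R R} {W : Derivation K C C} {W' : Derivation K B B}
    (h : IsLift τ W) (h' : IsLift τ W') (hW : ∀ c, W' (algebraMap C B c) = algebraMap C B (W c))
    (hWφ : ∀ j, W (φ j) = 0) {x : Forms R C} (hx : x ∈ topForms R C n) :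
    resForm θ B (lieD h x) = lieD h' (resForm θ B x) := by
  rw [resForm_eq θ hθ hφ (lieD_mem_topForms h hx) (z := lieD h (contrList θ (List.finRange r) x)),
    formsMap_lieD h h' hW, resForm]
  rw [← lieD_dProd_mul φ h _ fun j _ => by simp [hWφ j, dB], dProd_mul_contrList_top θ hθ hx]

/-- The cohomology class of the residue form. -/
def resClass : (topForms R C n).restrictScalars R →ₗ[R] HdR R B (n - r) where
  toFun x := Submodule.Quotient.mk
    ⟨resForm θ B x, resForm_mem θ x.2, extD_resForm θ hθ hφ x.2⟩
  map_add' x y := by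
    rw [← Submodule.Quotient.mk_add]
    exact congrArg _ (Subtype.ext (by simp [resForm]))
  map_smul' a x := by
    rw [RingHom.id_apply, ← Submodule.Quotient.mk_smul]
    refine congrArg _ (Subtype.ext ?_)
    change resForm θ B (a • (x : Forms R C)) = a • resForm θ B (x : Forms R C)
    rw [← algebraMap_smul C a, resForm_smul, ← IsScalarTower.algebraMap_apply, algebraMap_smul]

/-- A derivation that kills generators of the kernel of a surjection descends. -/
lemma exists_derivation_of_surjective (hs : Function.Surjective (algebraMap C B))
    (hk : ∀ c, algebraMap C B c = 0 → c ∈ Ideal.span (Set.range φ))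
    (hφ : ∀ j, algebraMap C B (φ j) = 0)
    [IsScalarTower K C B] (W : Derivation K C C)
    (hW : ∀ j, W (φ j) = 0) : ∃ W' : Derivation K B B,
      ∀ c, W' (algebraMap C B c) = algebraMap C B (W c) := by
  have e : ∀ z ∈ Ideal.span (Set.range φ), algebraMap C B z = 0 := fun z hz => by
    have : Ideal.span (Set.range φ) ≤ RingHom.ker (algebraMap C B) := by
      rw [Ideal.span_le]; rintro _ ⟨j, rfl⟩; exact hφ j
    exact this hz
  have h0 : ∀ c, algebraMap C B c = 0 → algebraMap C B (W c) = 0 := fun c hc => by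
    have h1 := hk c hc
    clear hc
    induction h1 using Submodule.span_induction with
    | mem x hx => obtain ⟨j, rfl⟩ := hx; rw [hW, map_zero]
    | zero => rw [map_zero, map_zero]
    | add x y hx hy ihx ihy => rw [map_add, map_add, ihx, ihy, add_zero]
    | smul a x hx ih =>
      rw [smul_eq_mul, Derivation.leibniz, smul_eq_mul, smul_eq_mul, map_add, map_mul, map_mul,
        e x hx, ih, mul_zero, zero_mul, add_zero]
  have h1 : ∀ c c', algebraMap C B c = algebraMap C B c' →
      algebraMap C B (W c) = algebraMap C B (W c') := fun c c' h => by
    rw [← sub_eq_zero, ← map_sub, ← map_sub]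
    exact h0 _ (by rw [map_sub, h, sub_self])
  choose g hg using hs
  refine ⟨Derivation.mk'
    { toFun := fun b => algebraMap C B (W (g b))
      map_add' := fun a b => by
        rw [← map_add, ← map_add]
        exact h1 _ _ (by rw [map_add, hg, hg, hg])
      map_smul' := fun k b => by
        rw [RingHom.id_apply, h1 _ (k • g b), W.map_smul, Algebra.smul_def, Algebra.smul_def, map_mul,
          ← IsScalarTower.algebraMap_apply]
        rw [hg, Algebra.smul_def, Algebra.smul_def, map_mul, hg,
          ← IsScalarTower.algebraMap_apply] } fun a b => ?_, fun c => h1 _ _ (hg _)⟩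
  change algebraMap C B (W (g (a * b))) = a • algebraMap C B (W (g b)) +
    b • algebraMap C B (W (g a))
  rw [h1 _ (g a * g b) (by rw [map_mul, hg, hg, hg]), Derivation.leibniz, map_add, smul_eq_mul,
    smul_eq_mul, map_mul, map_mul, hg, hg, smul_eq_mul, smul_eq_mul]

end Residue

/-! ### The residue map on cohomology -/

section Period

variable {K R C B : Type*} [CommRing K] [CommRing R] [CommRing C] [CommRing B] [Algebra K R]
  [Algebra K C] [Algebra K B] [Algebra R C] [Algebra R B] [Algebra C B]
  [IsScalarTower R C B] [IsScalarTower K R B] [IsScalarTower K C B]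
  {r n : ℕ} {φ : Fin r → C}
  (θ : Fin r → Derivation R C C)
  (hθ : ∀ i j, θ i (φ j) = if i = j then 1 else 0) (hφ : ∀ j, algebraMap C B (φ j) = 0)
  (hs : Function.Surjective (algebraMap C B))
  (hk : ∀ c, algebraMap C B c = 0 → c ∈ Ideal.span (Set.range φ))

lemma resClass_apply (x : (topForms R C n).restrictScalars R) : resClass θ hθ hφ x =
    (Submodule.Quotient.mk ⟨resForm θ B x, resForm_mem θ x.2, extD_resForm θ hθ hφ x.2⟩ :
      HdR R B (n - r)) := rfl

variable [Algebra.FormallySmooth R B]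

include hs hk in
lemma resClass_lieD {τ : Derivation K R R} {W : Derivation K C C} (h : IsLift τ W)
    (hW : ∀ j, W (φ j) = 0) (x : topForms R C n) :
    resClass θ hθ hφ ⟨lieD h x, lieD_mem_topForms h x.2⟩ =
      (gaussManin R B K (n - r)).nabla τ (resClass θ hθ hφ ⟨x.1, x.2⟩) := by
  obtain ⟨W', hW'⟩ := exists_derivation_of_surjective hs hk hφ W hW
  have h' : IsLift τ W' := fun a => by
    rw [IsScalarTower.algebraMap_apply R C B, hW', h, ← IsScalarTower.algebraMap_apply]
  rw [resClass_apply, resClass_apply, gaussManin_mk h']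
  exact congrArg Submodule.Quotient.mk (Subtype.ext (resForm_lieD θ hθ hφ h h' hW' hW x.2))

include hθ hφ hs hk in
lemma resForm_mem_exactForms {x : Forms R C} (hx : x ∈ vertForms K R n φ) :
    resForm θ B x ∈ exactForms R B (n - r) := by
  induction hx using Submodule.span_induction with
  | mem x hx =>
    obtain ⟨E, h, x, hx, hE, rfl⟩ := hx
    have h1 := resClass_lieD θ hθ hφ hs hk h hE ⟨x, hx⟩
    have h2 := (gaussManin R B K (n - r)).nabla_smul 0 0 (resClass θ hθ hφ ⟨x, hx⟩)
    rw [zero_smul, zero_smul] at h2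
    rw [h2] at h1
    exact (Submodule.Quotient.mk_eq_zero
      ((exactForms R B (n - r)).submoduleOf (closedForms R B (n - r)))).mp h1
  | zero => rw [← zero_smul C (0 : Forms R C), resForm_smul, map_zero, zero_smul]; exact zero_mem _
  | add x y _ _ hx hy =>
    have : resForm θ B (x + y) = resForm θ B x + resForm θ B y := by simp [resForm]
    rw [this]; exact add_mem hx hy
  | smul a x _ h =>
    rw [← algebraMap_smul C a, resForm_smul, ← IsScalarTower.algebraMap_apply, algebraMap_smul]
    exact Submodule.smul_mem _ _ h

/-- The residue map from classes of top forms to de Rham cohomology. -/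
def TopQuot.res : TopQuot K R n φ →ₗ[R] HdR R B (n - r) :=
  Submodule.liftQ _ (resClass θ hθ hφ) fun _ hx => (Submodule.Quotient.mk_eq_zero _).mpr
    (resForm_mem_exactForms θ hθ hφ hs hk hx)

lemma TopQuot.res_mk (x : topForms R C n) :
    TopQuot.res θ hθ hφ hs hk (TopQuot.mk n φ x : TopQuot K R n φ) =
      resClass θ hθ hφ ⟨x.1, x.2⟩ := rfl

lemma TopQuot.res_lie {τ : Derivation K R R} {W : Derivation K C C} (h : IsLift τ W)
    (hW : ∀ j, W (φ j) = 0) (hW' : ∀ j, ∃ a, W (φ j) = algebraMap R C a) (q : TopQuot K R n φ) :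
    TopQuot.res θ hθ hφ hs hk (TopQuot.lie h hW' q) =
      (gaussManin R B K (n - r)).nabla τ (TopQuot.res θ hθ hφ hs hk q) := by
  obtain ⟨x, rfl⟩ := TopQuot.mk_surjective q
  exact resClass_lieD θ hθ hφ hs hk h hW x

lemma TopQuot.res_mul (j : Fin r) (hj) (q : TopQuot K R n φ) :
    TopQuot.res θ hθ hφ hs hk (TopQuot.mul (φ j) hj q) = 0 := by
  obtain ⟨x, rfl⟩ := TopQuot.mk_surjective q
  refine (Submodule.Quotient.mk_eq_zero _).mpr ?_
  change resForm θ B (φ j • (x : Forms R C)) ∈ exactForms R B (n - r)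
  rw [resForm_smul, hφ, zero_smul]
  exact zero_mem _

variable [IsScalarTower K R C]

include hθ in
lemma dual_eq_algebraMap (i j : Fin r) :
    ∃ a, (θ i).restrictScalars K (φ j) = algebraMap R C a :=
  ⟨if i = j then 1 else 0, by rw [Derivation.restrictScalars_apply, hθ]; split_ifs <;> simp⟩

/-- The negative of the Lie derivative along the derivation `θⱼ = ∂/∂φⱼ`, on classes of top
forms. By integration by parts against `exp (∑ⱼ yⱼ φⱼ)`, it plays the role of the multiplication by
the variable `yⱼ`. -/
def negLie (j : Fin r) : Module.End R (TopQuot K R n φ) where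
  toFun q := -TopQuot.lie (isLift_restrictScalars (θ j)) (dual_eq_algebraMap θ hθ j) q
  map_add' q q' := by rw [map_add, neg_add]
  map_smul' a q := by rw [TopQuot.lie_smul, smul_neg]; rfl

lemma negLie_apply (j : Fin r) (q : TopQuot K R n φ) : negLie θ hθ j q =
    -TopQuot.lie (isLift_restrictScalars (θ j)) (dual_eq_algebraMap θ hθ j) q := rfl

lemma negLie_comm (i j : Fin r) :
    (negLie θ hθ i * negLie θ hθ j : Module.End R (TopQuot K R n φ)) =
      negLie θ hθ j * negLie θ hθ i := by
  refine LinearMap.ext fun q => ?_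
  rw [Module.End.mul_apply, Module.End.mul_apply, negLie_apply, negLie_apply, negLie_apply,
    negLie_apply, map_neg, map_neg, neg_neg, neg_neg]
  refine TopQuot.lie_comm _ _ _ _ (lie_zero _) (fun k => ?_) q
  simp only [Derivation.restrictScalars_apply, hθ]
  split_ifs <;> simp

lemma lie_negLie {τ : Derivation K R R} {W : Derivation K C C} (h : IsLift τ W)
    (hW : ∀ j, W (φ j) = 0) (hW' : ∀ j, ∃ a, W (φ j) = algebraMap R C a) (j : Fin r)
    (q : TopQuot K R n φ) :
    TopQuot.lie h hW' (negLie θ hθ j q) = negLie θ hθ j (TopQuot.lie h hW' q) := by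
  rw [negLie_apply, negLie_apply, map_neg]
  congr 1
  refine TopQuot.lie_comm _ _ _ _ (lie_zero _) (fun k => ?_) q
  rw [hW, map_zero, Derivation.restrictScalars_apply, hθ]
  split_ifs <;> simp

lemma negLie_mul (i j : Fin r) (q : TopQuot K R n φ) :
    negLie θ hθ i (TopQuot.mul (φ j) (fun _ _ hE => hE j) q) =
      TopQuot.mul (φ j) (fun _ _ hE => hE j) (negLie θ hθ i q) - if i = j then q else 0 := by
  rw [negLie_apply, negLie_apply, TopQuot.lie_mul _ _ j (if i = j then 1 else 0), map_neg, neg_add,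
    sub_eq_add_neg]
  · congr 2
    split_ifs <;> simp
  · rw [Derivation.restrictScalars_apply, hθ]
    split_ifs <;> simp

variable (K) in
/-- The derivation `E - ∑ⱼ E(φⱼ) θⱼ`, which kills the `φⱼ`. -/
def killDer (φ : Fin r → C) (E : Derivation K C C) : Derivation K C C :=
  E - (∑ j, E (φ j) • θ j).restrictScalars K

lemma killDer_apply (E : Derivation K C C) (b : C) :
    killDer K θ φ E b = E b - ∑ j, E (φ j) * θ j b := by
  have : (∑ j, E (φ j) • θ j) b = ∑ j, E (φ j) * θ j b := by
    rw [← Derivation.coeFnAddMonoidHom_apply, map_sum, Finset.sum_apply]; rfl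
  rw [← this]; rfl

include hθ in
lemma killDer_eq_zero (E : Derivation K C C) (j : Fin r) : killDer K θ φ E (φ j) = 0 := by
  simp [killDer_apply, hθ]

lemma isLift_killDer {τ : Derivation K R R} {E : Derivation K C C} (h : IsLift τ E) :
    IsLift τ (killDer K θ φ E) := fun a => by
  simp [killDer_apply, h a]

lemma lie_killDer {τ : Derivation K R R} {E : Derivation K C C} (h : IsLift τ E)
    (hW' : ∀ j, ∃ a, killDer K θ φ E (φ j) = algebraMap R C a) (x : topForms R C n)
    (hx : lieD h (x : Forms R C) = 0) (c : C) :
    TopQuot.lie (isLift_killDer θ h) hW' (TopQuot.mk n φ (c • x)) =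
      TopQuot.mk n φ (E c • x) + ∑ j, negLie θ hθ j (TopQuot.mk n φ ((E (φ j) * c) • x)) := by
  simp only [negLie_apply, TopQuot.lie_mk, Finset.sum_neg_distrib]
  rw [← sub_eq_add_neg, ← TopQuot.mk_sum, ← TopQuot.mk_sub]
  congr 1
  refine Subtype.ext ((lieD_sub_eq_sum h (isLift_killDer θ h) (fun j => E (φ j)) θ
    (killDer_apply θ E) (c • x).2).trans ?_)
  have e : lieD h ((c • x : topForms R C n) : Forms R C) = E c • (x : Forms R C) := by
    refine (lieD_smul h c (x : Forms R C)).trans ?_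
    rw [hx, smul_zero, zero_add]
  rw [e, AddSubgroupClass.coe_sub, AddSubmonoidClass.coe_finsetSum]
  congr 1
  refine Finset.sum_congr rfl fun j _ => ?_
  rw [mul_smul]
  rfl

end Period

/-! ### The classes of formal exponential integrals -/

section Family

variable {K R C B : Type*} [CommRing K] [CommRing R] [CommRing C] [CommRing B] [Algebra K R]
  [Algebra K C] [Algebra K B] [Algebra R C] [Algebra R B] [Algebra C B]
  [IsScalarTower R C B] [IsScalarTower K R B] [IsScalarTower K C B] [IsScalarTower K R C]
  [Algebra.FormallySmooth R B] {N r n : ℕ} {φ : Fin r → C}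
  (θ : Fin r → Derivation R C C)
  (hθ : ∀ i j, θ i (φ j) = if i = j then 1 else 0) (hφ : ∀ j, algebraMap C B (φ j) = 0)
  (hs : Function.Surjective (algebraMap C B))
  (hk : ∀ c, algebraMap C B c = 0 → c ∈ Ideal.span (Set.range φ))
  (x : Fin N → C) (vol : topForms R C n)

variable (R) in
/-- The monomial `x^a`. -/
def mon (a : Fin N →₀ ℕ) : C := MvPolynomial.aeval x (MvPolynomial.monomial a (1 : R))

omit [Algebra.FormallySmooth R B] in
lemma mon_add (a b : Fin N →₀ ℕ) : mon R x (a + b) = mon R x a * mon R x b := by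
  rw [mon, mon, mon, ← map_mul, MvPolynomial.monomial_mul, one_mul]

variable (K) in
/-- The class of the residue of `x^a (∏ⱼ yⱼ^{Mⱼ}) dx₁ ⋯ dx_N`, where the variables `yⱼ` act through
`negLie`. -/
def resFamily (a : (Fin N →₀ ℕ) × Multiset (Fin r)) : HdR R B (n - r) :=
  TopQuot.res (K := K) θ hθ hφ hs hk
    (wordOp (negLie θ hθ) (negLie_comm θ hθ) a.2 (TopQuot.mk n φ (mon R x a.1 • vol)))

variable {m : Fin r → ℕ} (d : (Σ j, Fin (m j)) → Fin N →₀ ℕ) (lam : (Σ j, Fin (m j)) → R)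

/-- The Gauss–Manin connection on a residue class, computed with the lift `killDer E` of `τ`. For
`E` equal to a lift of `τ` that kills the coordinates this is differentiation under the integral
sign; for `τ = 0` and `E = ∂/∂x_k` the left side vanishes, which is integration by parts. -/
lemma res_wordOp_lie_killDer {τ : Derivation K R R} {E : Derivation K C C} (h : IsLift τ E)
    (hvol : lieD h (vol : Forms R C) = 0) (b : C) (a' : Fin N →₀ ℕ) (k : R)
    (hE : E b = algebraMap R C k * mon R x a')
    (c : (Σ j, Fin (m j)) → R)
    (hc : ∀ j, E (φ j) * b = ∑ i, algebraMap R C (c ⟨j, i⟩) * mon R x (d ⟨j, i⟩ + a'))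
    (M : Multiset (Fin r)) :
    (gaussManin R B K (n - r)).nabla τ (TopQuot.res (K := K) θ hθ hφ hs hk
      (wordOp (negLie θ hθ) (negLie_comm θ hθ) M (TopQuot.mk n φ (b • vol)))) =
    k • resFamily K θ hθ hφ hs hk x vol (a', M) +
      ∑ s, c s • resFamily K θ hθ hφ hs hk x vol ((a', M) + latticePt d s) := by
  have hW := killDer_eq_zero (K := K) θ hθ E
  have hW' : ∀ j, ∃ a, killDer K θ φ E (φ j) = algebraMap R C a :=
    fun j => ⟨0, by rw [hW, map_zero]⟩
  have hmk : ∀ (e : R) (a : Fin N →₀ ℕ), (TopQuot.mk n φ ((algebraMap R C e * mon R x a) • vol) :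
      TopQuot K R n φ) = e • TopQuot.mk n φ (mon R x a • vol) := fun e a => by
    rw [← TopQuot.mk_smul, mul_smul, algebraMap_smul]
  rw [← TopQuot.res_lie θ hθ hφ hs hk (isLift_killDer θ h) hW hW',
    apply_wordOp _ _ (lie_negLie θ hθ (isLift_killDer θ h) hW hW'), lie_killDer θ hθ h hW' vol hvol,
    hE, hmk, map_add, map_add, map_smul, map_smul, map_sum, map_sum, Fintype.sum_sigma]
  congr 1
  refine Finset.sum_congr rfl fun j _ => ?_
  rw [wordOp_apply, hc, Finset.sum_smul, TopQuot.mk_sum, map_sum, map_sum]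
  refine Finset.sum_congr rfl fun i _ => ?_
  rw [hmk, map_smul, map_smul, resFamily, add_comm (a', M)]
  rfl

variable (hpoly : ∀ j, φ j = ∑ i, algebraMap R C (lam ⟨j, i⟩) * mon R x (d ⟨j, i⟩))

include hpoly in
lemma nabla_resFamily {τ : Derivation K R R} {E : Derivation K C C} (h : IsLift τ E)
    (hvol : lieD h (vol : Forms R C) = 0) (hE : ∀ a, E (mon R x a) = 0)
    (a : (Fin N →₀ ℕ) × Multiset (Fin r)) :
    (gaussManin R B K (n - r)).nabla τ (resFamily K θ hθ hφ hs hk x vol a) =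
      ∑ s, τ (lam s) • resFamily K θ hθ hφ hs hk x vol (a + latticePt d s) := by
  have := res_wordOp_lie_killDer θ hθ hφ hs hk x vol d h hvol (mon R x a.1) a.1 0
    (by rw [hE, map_zero, zero_mul]) (fun s => τ (lam s)) (fun j => ?_) a.2
  · rwa [zero_smul, zero_add] at this
  · rw [hpoly, map_sum, Finset.sum_mul]
    refine Finset.sum_congr rfl fun i _ => ?_
    rw [Derivation.leibniz, hE, h, smul_zero, zero_add, smul_eq_mul, mon_add]
    ring

include hpoly in
/-- The relation that comes from the derivative with respect to `x_k`. -/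
lemma resFamily_relation_inl (D : Derivation R C C) (k : Fin N)
    (hvol : lieD (isLift_restrictScalars (K := K) D) (vol : Forms R C) = 0)
    (hD : ∀ a, x k * D (mon R x a) = a k • mon R x a) (hDk : D (x k) = 1)
    (a : (Fin N →₀ ℕ) × Multiset (Fin r)) :
    (latticeDeg (.inl k) a + 1) • resFamily K θ hθ hφ hs hk x vol a +
      ∑ s, latticeDeg (.inl k) (latticePt d s) • lam s •
        resFamily K θ hθ hφ hs hk x vol (a + latticePt d s) = 0 := by
  have := res_wordOp_lie_killDer (K := K) θ hθ hφ hs hk x vol d (isLift_restrictScalars D) hvol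
    (x k * mon R x a.1) a.1 ((a.1 k + 1 : ℕ) : R) ?_ (fun s => d s k • lam s) (fun j => ?_) a.2
  · rw [← Nat.cast_smul_eq_nsmul R, ← Finset.sum_congr rfl fun s _ => smul_assoc
      (latticeDeg (.inl k) (latticePt d s)) (lam s) (resFamily K θ hθ hφ hs hk x vol _)]
    refine this.symm.trans ?_
    have h0 := fun y => (gaussManin R B K (n - r)).nabla_smul 0 0 y
    simp only [zero_smul] at h0
    exact h0 _
  · rw [Derivation.restrictScalars_apply, Derivation.leibniz, smul_eq_mul, hD, hDk, smul_eq_mul,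
      map_natCast, nsmul_eq_mul]
    push_cast
    ring
  · rw [hpoly, Derivation.restrictScalars_apply, map_sum, Finset.sum_mul]
    refine Finset.sum_congr rfl fun i _ => ?_
    rw [Derivation.leibniz, Derivation.map_algebraMap, smul_zero, add_zero, smul_eq_mul, mon_add,
      map_nsmul, nsmul_eq_mul]
    have := hD (d ⟨j, i⟩)
    rw [nsmul_eq_mul] at this
    linear_combination (algebraMap R C (lam ⟨j, i⟩) * mon R x a.1) * this

include hpoly in
/-- The relation that comes from the derivative with respect to `yⱼ`: multiplication by `φⱼ` vanishes
under the residue map, and its commutator with the operators `negLie` is known. -/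
lemma resFamily_relation_inr (j : Fin r) (a : (Fin N →₀ ℕ) × Multiset (Fin r)) :
    (latticeDeg (.inr j) a + 1) • resFamily K θ hθ hφ hs hk x vol a +
      ∑ s, latticeDeg (.inr j) (latticePt d s) • lam s •
        resFamily K θ hθ hφ hs hk x vol (a + latticePt d s) = 0 := by
  have h1 := congrArg (TopQuot.res (K := K) θ hθ hφ hs hk)
    (wordOp_cons_apply_mul (negLie_comm θ hθ) (fun j => TopQuot.mul (φ j) (fun _ _ hE => hE j))
      (negLie_mul θ hθ) j a.2 (TopQuot.mk n φ (mon R x a.1 • vol)))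
  rw [map_sub, TopQuot.res_mul, zero_sub, map_nsmul, TopQuot.mul_mk, ← mul_smul, hpoly,
    Finset.sum_mul, Finset.sum_smul, TopQuot.mk_sum, map_sum, map_sum] at h1
  rw [sum_latticePt_inr, latticeDeg_inr, ← eq_neg_iff_add_eq_zero, eq_comm, neg_eq_iff_eq_neg]
  refine Eq.trans (Finset.sum_congr rfl fun i _ => ?_) h1
  rw [mul_assoc, ← mon_add, mul_smul, algebraMap_smul, TopQuot.mk_smul, map_smul, map_smul,
    resFamily, add_comm a]
  rfl

end Family

/-! ### Jacobian determinants and products of the `dxᵢ` -/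

section Shuffle

variable {R C : Type*} [CommRing R] [CommRing C] [Algebra R C] {N : ℕ} (x : Fin N → C)

lemma dB_mul_dProd_self {k : Fin N} {l : List (Fin N)} (hk : k ∈ l) :
    dB R (x k) * dProd x l = 0 := by
  induction l with
  | nil => simp at hk
  | cons i l ih =>
    rw [dProd_cons, ← mul_assoc]
    rcases List.mem_cons.mp hk with rfl | hk
    · simp [dB]
    · rw [dB_anticomm, neg_mul, mul_assoc, ih hk, mul_zero, neg_zero]

lemma dB_mul_mul_eq_zero {c : C} {D : Forms R C} (h : dB R c * D = 0) (y : Forms R C) :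
    dB R c * (y * D) = 0 := by
  induction y using OpData.forms_induction with
  | h1 => rw [one_mul, h]
  | ha x y hx hy => rw [add_mul, mul_add, hx, hy, add_zero]
  | hs b x hx => rw [smul_mul_assoc, mul_smul_comm, hx, smul_zero]
  | hD b x hx => rw [mul_assoc, ← mul_assoc, dB_anticomm, neg_mul, mul_assoc, hx, mul_zero, neg_zero]

variable (R) in
/-- The product of the `dxᵢ` for `i ∈ S`, in increasing order. -/
def dSet (S : Finset (Fin N)) : Forms R C := dProd x (S.sort (· ≤ ·))

@[simp] lemma dSet_empty : dSet R x ∅ = 1 := by simp [dSet]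

lemma dSet_insert {S : Finset (Fin N)} {a : Fin N} (ha : ∀ b ∈ S, a < b) :
    dSet R x (insert a S) = dB R (x a) * dSet R x S := by
  rw [dSet, Finset.sort_insert _ (fun b hb => (ha b hb).le) fun h => lt_irrefl _ (ha a h), dProd_cons,
    dSet]

lemma dB_mul_dSet (c : C) (S : Finset (Fin N)) :
    dB R c * dSet R x S = (-1 : ℤ) ^ S.card • (dSet R x S * dB R c) := by
  rw [dSet, dB_mul_dProd, Finset.length_sort]

/-- The number of inversions of the list of the elements of `T` followed by those of `S`. -/
def inversions (T S : Finset (Fin N)) : ℕ := ((T ×ˢ S).filter fun p => p.2 < p.1).card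

lemma inversions_insert_left {T S : Finset (Fin N)} {a : Fin N} (hS : ∀ b ∈ S, a < b) :
    inversions (insert a T) S = inversions T S := by
  rw [inversions, inversions]
  congr 1
  ext ⟨p, q⟩
  simp only [Finset.mem_filter, Finset.mem_product, Finset.mem_insert]
  constructor
  · rintro ⟨⟨rfl | hp, hq⟩, h⟩
    · exact absurd h (hS q hq).asymm
    · exact ⟨⟨hp, hq⟩, h⟩
  · rintro ⟨⟨hp, hq⟩, h⟩
    exact ⟨⟨Or.inr hp, hq⟩, h⟩

lemma inversions_insert_right {T S : Finset (Fin N)} {a : Fin N} (hT : ∀ b ∈ T, a < b)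
    (ha : a ∉ S) : inversions T (insert a S) = inversions T S + T.card := by
  have e : (T ×ˢ insert a S).filter (fun p => p.2 < p.1) =
      (T ×ˢ S).filter (fun p => p.2 < p.1) ∪ T ×ˢ {a} := by
    ext ⟨p, q⟩
    simp only [Finset.mem_filter, Finset.mem_product, Finset.mem_insert, Finset.mem_union,
      Finset.mem_singleton]
    constructor
    · rintro ⟨⟨hp, rfl | hq⟩, h⟩
      · exact Or.inr ⟨hp, rfl⟩
      · exact Or.inl ⟨⟨hp, hq⟩, h⟩
    · rintro (⟨⟨hp, hq⟩, h⟩ | ⟨hp, rfl⟩)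
      · exact ⟨⟨hp, Or.inr hq⟩, h⟩
      · exact ⟨⟨hp, Or.inl rfl⟩, hT p hp⟩
  rw [inversions, e, Finset.card_union_of_disjoint, Finset.card_product, Finset.card_singleton,
    mul_one, inversions]
  rw [Finset.disjoint_left]
  rintro ⟨p, q⟩ h h'
  simp only [Finset.mem_filter, Finset.mem_product, Finset.mem_singleton] at h h'
  exact ha (h'.2 ▸ h.1.2)

/-- The sign of a shuffle. -/
lemma dSet_mul_dSet (T S : Finset (Fin N)) (h : Disjoint T S) :
    dSet R x T * dSet R x S = (-1 : ℤ) ^ inversions T S • dSet R x (T ∪ S) := by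
  generalize hU : T ∪ S = U
  induction U using Finset.induction_on_min generalizing T S with
  | empty =>
    obtain ⟨rfl, rfl⟩ := Finset.union_eq_empty.mp hU
    simp [inversions]
  | insert a U ha ih =>
    have haU : a ∉ U := fun h => lt_irrefl _ (ha a h)
    have hmem : a ∈ T ∪ S := hU ▸ Finset.mem_insert_self a U
    have hlt : ∀ b ∈ T ∪ S, b ≠ a → a < b := fun b hb hba => by
      rw [hU] at hb
      exact ha b ((Finset.mem_insert.mp hb).resolve_left hba)
    rcases Finset.mem_union.mp hmem with haT | haS
    · have haS := Finset.disjoint_left.mp h haT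
      obtain ⟨T', haT', rfl⟩ : ∃ T', a ∉ T' ∧ T = insert a T' :=
        ⟨T.erase a, Finset.notMem_erase a T, (Finset.insert_erase haT).symm⟩
      have hT' : ∀ b ∈ T', a < b := fun b hb =>
        hlt b (by simp [hb]) (by rintro rfl; exact haT' hb)
      have hS' : ∀ b ∈ S, a < b := fun b hb => hlt b (by simp [hb]) (by rintro rfl; exact haS hb)
      have hU' : T' ∪ S = U := by
        rw [Finset.insert_union] at hU
        rw [← Finset.erase_insert (s := T' ∪ S) (a := a) (by simp [haT', haS]), hU,
          Finset.erase_insert haU]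
      rw [dSet_insert x hT', mul_assoc, ih T' S (Finset.disjoint_insert_left.mp h).2 hU',
        inversions_insert_left hS', dSet_insert x ha, mul_smul_comm]
    · have haT : a ∉ T := fun h' => Finset.disjoint_left.mp h h' haS
      obtain ⟨S', haS', rfl⟩ : ∃ S', a ∉ S' ∧ S = insert a S' :=
        ⟨S.erase a, Finset.notMem_erase a S, (Finset.insert_erase haS).symm⟩
      have hS' : ∀ b ∈ S', a < b := fun b hb =>
        hlt b (by simp [hb]) (by rintro rfl; exact haS' hb)
      have hT' : ∀ b ∈ T, a < b := fun b hb => hlt b (by simp [hb]) (by rintro rfl; exact haT hb)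
      have hU' : T ∪ S' = U := by
        rw [Finset.union_insert] at hU
        rw [← Finset.erase_insert (s := T ∪ S') (a := a) (by simp [haT, haS']), hU,
          Finset.erase_insert haU]
      have e : dSet R x T * dB R (x a) = (-1 : ℤ) ^ T.card • (dB R (x a) * dSet R x T) := by
        rw [dB_mul_dSet, smul_smul, ← mul_pow, neg_one_mul, neg_neg, one_pow, one_smul]
      rw [dSet_insert x hS', ← mul_assoc, e, smul_mul_assoc, mul_assoc,
        ih T S' (Finset.disjoint_insert_right.mp h).2 hU', inversions_insert_right hT' haS',
        dSet_insert x ha, mul_smul_comm, smul_smul, pow_add, mul_comm]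

lemma dSet_mul_comm (S : Finset (Fin N)) (l : List (Fin N)) :
    dProd x l * dSet R x S = (-1 : ℤ) ^ (l.length * S.card) • (dSet R x S * dProd x l) := by
  induction l with
  | nil => simp
  | cons i l ih =>
    rw [dProd_cons, mul_assoc, ih, mul_smul_comm, ← mul_assoc, dB_mul_dSet, smul_mul_assoc,
      smul_smul, ← pow_add, List.length_cons, add_mul, one_mul, mul_assoc]

/-- The `r`-fold product of linear combinations of `r` vectors in the exterior algebra. -/
lemma ιMulti_sum_smul {M : Type*} [AddCommGroup M] [Module C M] {r : ℕ}
    (c : Matrix (Fin r) (Fin r) C) (w : Fin r → M) :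
    ExteriorAlgebra.ιMulti C r (fun j => ∑ k, c j k • w k) = c.det • ExteriorAlgebra.ιMulti C r w := by
  let g := (ExteriorAlgebra.ιMulti C r).compLinearMap (Fintype.linearCombination C w)
  let g' := (LinearMap.toSpanSingleton C _ (ExteriorAlgebra.ιMulti C r w)).compAlternatingMap
    (Matrix.detRowAlternating (n := Fin r) (R := C))
  have hb : g (Pi.basisFun C (Fin r)) = ExteriorAlgebra.ιMulti C r w := by
    change ExteriorAlgebra.ιMulti C r (fun j => Fintype.linearCombination C w _) = _
    congr 1
    ext j
    simp
  have hb' : g' (Pi.basisFun C (Fin r)) = ExteriorAlgebra.ιMulti C r w := by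
    have : Matrix.det (fun j => Pi.basisFun C (Fin r) j) = 1 := by
      rw [← Matrix.det_one (n := Fin r)]
      congr 1
      ext i j
      simp [Matrix.one_apply, Pi.single_apply, eq_comm]
    change (Matrix.det (fun j => Pi.basisFun C (Fin r) j) • ExteriorAlgebra.ιMulti C r w :
      ExteriorAlgebra C M) = _
    rw [this, one_smul]
  have h : g = g' := by
    refine (Pi.basisFun C (Fin r)).ext_alternating fun v hv => ?_
    let σ := Equiv.ofBijective v (Finite.injective_iff_bijective.mp hv)
    have e : (fun i => Pi.basisFun C (Fin r) (v i)) = Pi.basisFun C (Fin r) ∘ σ := rfl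
    rw [e, AlternatingMap.map_perm, AlternatingMap.map_perm, hb, hb']
  exact congrArg (fun G => G c) h

lemma dSet_eq_ιMulti {r : ℕ} (S : Finset (Fin N)) (hS : S.card = r) :
    dSet R x S = ExteriorAlgebra.ιMulti C r
      fun k => KaehlerDifferential.D R C (x (S.orderEmbOfFin hS k)) := by
  rw [ExteriorAlgebra.ιMulti_apply, dSet, dProd]
  congr 1
  refine List.ext_getElem (by simp [hS]) fun i h1 h2 => ?_
  simp [Finset.orderEmbOfFin_apply, dB]

/-- The product of the `dφⱼ` and the `dxᵢ` for `i ∉ S` is a Jacobian determinant. -/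
lemma dProd_mul_dSet_compl {r : ℕ} (φ : Fin r → C) (c : Fin r → Fin N → C)
    (hc : ∀ j, dB R (φ j) = ∑ k, c j k • dB R (x k)) (S : Finset (Fin N)) (hS : S.card = r) :
    dProd φ (List.finRange r) * dSet R x Sᶜ =
      (Matrix.of fun j k => c j (S.orderEmbOfFin hS k)).det • (dSet R x S * dSet R x Sᶜ) := by
  have h0 : ∀ k ∉ S, dB R (x k) * dSet R x Sᶜ = 0 := fun k hk =>
    dB_mul_dProd_self x (by simpa using hk)
  set α : Fin r → Forms R C := fun j => ExteriorAlgebra.ι C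
    (∑ k, c j (S.orderEmbOfFin hS k) • KaehlerDifferential.D R C (x (S.orderEmbOfFin hS k)))
    with hα
  have hα' : ∀ j, α j = ∑ k ∈ S, c j k • dB R (x k) := fun j => by
    rw [hα]
    simp only [map_sum, map_smul]
    have e : Finset.univ.map (S.orderEmbOfFin hS).toEmbedding = S := by
      ext k; simp
    conv_rhs => rw [← e, Finset.sum_map]
    rfl
  have h1 : ∀ l : List (Fin r), dProd φ l * dSet R x Sᶜ = (l.map α).prod * dSet R x Sᶜ := by
    intro l
    induction l with
    | nil => rfl
    | cons j l ih =>
      rw [dProd_cons, List.map_cons, List.prod_cons, mul_assoc, mul_assoc, ih, hc, hα',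
        ← Finset.sum_add_sum_compl S, add_mul, add_eq_left, Finset.sum_mul]
      refine Finset.sum_eq_zero fun k hk => ?_
      rw [smul_mul_assoc, dB_mul_mul_eq_zero (h0 k (Finset.mem_compl.mp hk)), smul_zero]
  rw [h1, dSet_eq_ιMulti x S hS, ← smul_mul_assoc, ← ιMulti_sum_smul, ExteriorAlgebra.ιMulti_apply,
    List.ofFn_eq_map]
  rfl

variable {x} in
/-- The form `dx₁ ⋯ dx_N`. -/
lemma dSet_univ_mem_topForms (h : ∀ c, dB R c * dSet R x Finset.univ = 0) :
    dSet R x Finset.univ ∈ topForms R C N := by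
  refine ⟨?_, ?_, h⟩
  · have := dProd_mem (R := R) x (Finset.univ.sort (· ≤ ·))
    rwa [Finset.length_sort, Finset.card_univ, Fintype.card_fin] at this
  · have := extD_dProd_mul (R := R) x (Finset.univ.sort (· ≤ ·)) 1
    rwa [extD_one, mul_zero, smul_zero, mul_one] at this

lemma lieD_dSet {K : Type*} [CommRing K] [Algebra K R] [Algebra K C] {τ : Derivation K R R}
    {E : Derivation K C C} (h : IsLift τ E) (hE : ∀ k, dB R (E (x k)) = 0) (S : Finset (Fin N)) :
    lieD h (dSet R x S) = 0 := by
  have := lieD_dProd_mul x h (S.sort (· ≤ ·)) (fun k _ => hE k) 1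
  rwa [lieD_one, mul_zero, mul_one] at this

/-- The chain rule. -/
lemma D_aeval (p : MvPolynomial (Fin N) R) :
    KaehlerDifferential.D R C (MvPolynomial.aeval x p) =
      ∑ k, MvPolynomial.aeval x (MvPolynomial.pderiv k p) • KaehlerDifferential.D R C (x k) := by
  induction p using MvPolynomial.induction_on with
  | C a => simp
  | add p q hp hq => simp only [map_add, hp, hq, add_smul, Finset.sum_add_distrib]
  | mul_X p i hp =>
    simp only [map_mul, Derivation.leibniz, hp, smul_eq_mul, map_add, add_smul,
      Finset.sum_add_distrib, MvPolynomial.aeval_X, mul_smul, Finset.smul_sum,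
      MvPolynomial.pderiv_X]
    congr 1
    rw [Finset.sum_eq_single i]
    · simp
    · intro k _ hk; simp [hk.symm]
    · simp

lemma dB_aeval (p : MvPolynomial (Fin N) R) : dB R (MvPolynomial.aeval x p) =
    ∑ k, MvPolynomial.aeval x (MvPolynomial.pderiv k p) • dB R (x k) := by
  rw [dB, D_aeval, map_sum]
  exact Finset.sum_congr rfl fun k _ => map_smul _ _ _

lemma dB_aeval_mul_dSet_univ (p : MvPolynomial (Fin N) R) :
    dB R (MvPolynomial.aeval x p) * dSet R x Finset.univ = 0 := by
  rw [dB_aeval, Finset.sum_mul]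
  refine Finset.sum_eq_zero fun k _ => ?_
  rw [smul_mul_assoc, dSet, dB_mul_dProd_self x (by simp), smul_zero]

end Shuffle

/-! ### The Jacobian criterion -/

section Jacobian

variable {R B : Type*} [CommRing R] [CommRing B] [Algebra R B] {N r : ℕ}

variable (f : Fin r → MvPolynomial (Fin N) R) (y : Fin N → B)

/-- The Jacobian matrix of `f` at `y`. -/
def jacMat : Matrix (Fin r) (Fin N) B :=
  Matrix.of fun j k => MvPolynomial.aeval y (MvPolynomial.pderiv k (f j))

variable (R) in
/-- The map from the free module on the `dy_k` to the one-forms. -/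
def freeToOmega : (Fin N → B) →ₗ[B] Ω[B⁄R] :=
  Fintype.linearCombination _ fun k => KaehlerDifferential.D R B (y k)

lemma D_eq_freeToOmega (p : MvPolynomial (Fin N) R) :
    KaehlerDifferential.D R B (MvPolynomial.aeval y p) =
      freeToOmega R y fun k => MvPolynomial.aeval y (MvPolynomial.pderiv k p) := by
  rw [D_aeval, freeToOmega, Fintype.linearCombination_apply]

variable {y}

lemma freeToOmega_surjective
    (hy : Function.Surjective (MvPolynomial.aeval y : MvPolynomial (Fin N) R →ₐ[R] B)) :
    Function.Surjective (freeToOmega R y) := by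
  rw [← LinearMap.range_eq_top, ← top_le_iff, ← KaehlerDifferential.span_range_derivation,
    Submodule.span_le]
  rintro _ ⟨b, rfl⟩
  obtain ⟨p, rfl⟩ := hy b
  exact ⟨_, (D_eq_freeToOmega y p).symm⟩

variable {f}

/-- The gradient of a polynomial, modulo the gradients of the `fⱼ`, as a derivation of the
quotient ring. -/
lemma exists_gradMod
    (hy : Function.Surjective (MvPolynomial.aeval y : MvPolynomial (Fin N) R →ₐ[R] B))
    (hk : ∀ p : MvPolynomial (Fin N) R, MvPolynomial.aeval y p = 0 →
      p ∈ Ideal.span (Set.range f))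
    (hf : ∀ j, MvPolynomial.aeval y (f j) = 0) :
    ∃ δ : Derivation R B ((Fin N → B) ⧸ Submodule.span B (Set.range (jacMat f y))),
      ∀ p : MvPolynomial (Fin N) R, δ (MvPolynomial.aeval y p) = Submodule.Quotient.mk
        fun k => MvPolynomial.aeval y (MvPolynomial.pderiv k p) := by
  let W := Submodule.span B (Set.range (jacMat f y))
  let g : MvPolynomial (Fin N) R → (Fin N → B) := fun p k =>
    MvPolynomial.aeval y (MvPolynomial.pderiv k p)
  have gadd : ∀ p q, g (p + q) = g p + g q := fun p q => by ext k; simp [g]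
  have gmul : ∀ p q, g (p * q) = MvPolynomial.aeval y p • g q +
      MvPolynomial.aeval y q • g p := fun p q => by
    ext k; simp [g, Derivation.leibniz]
  have gC : ∀ a, g (MvPolynomial.C a) = 0 := fun a => by ext k; simp [g]
  have hz : ∀ p ∈ Ideal.span (Set.range f), MvPolynomial.aeval y p = 0 := fun p hp =>
    (Ideal.span_le.mpr (by rintro _ ⟨j, rfl⟩; exact hf j) :
      Ideal.span (Set.range f) ≤ RingHom.ker (MvPolynomial.aeval y).toRingHom) hp
  have g0 : ∀ p ∈ Ideal.span (Set.range f), g p ∈ W := fun p hp => by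
    induction hp using Submodule.span_induction with
    | mem p hp => obtain ⟨j, rfl⟩ := hp; exact Submodule.subset_span (Set.mem_range_self j)
    | zero => rw [show g 0 = 0 by ext k; simp [g]]; exact zero_mem _
    | add p q _ _ hp hq => rw [gadd]; exact add_mem hp hq
    | smul a p hp ih =>
      rw [smul_eq_mul, gmul, hz p hp, zero_smul, add_zero]
      exact Submodule.smul_mem _ _ ih
  have gsub : ∀ p q, MvPolynomial.aeval y p = MvPolynomial.aeval y q →
      W.mkQ (g p) = W.mkQ (g q) := fun p q h => by
    have h1 := g0 _ (hk (p - q) (by rw [map_sub, h, sub_self]))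
    have h2 : g p = g (p - q) + g q := by rw [← gadd, sub_add_cancel]
    rw [h2, map_add, (Submodule.Quotient.mk_eq_zero W).mpr h1 |> fun e =>
      (show W.mkQ (g (p - q)) = 0 from e), zero_add]
  choose sec hsec using hy
  have hG : ∀ p, W.mkQ (g (sec (MvPolynomial.aeval y p))) = W.mkQ (g p) := fun p =>
    gsub _ _ (hsec _)
  have hadd : ∀ a b, W.mkQ (g (sec (a + b))) = W.mkQ (g (sec a)) + W.mkQ (g (sec b)) :=
    fun a b => by
      rw [← map_add, ← gadd]
      exact gsub _ _ (by rw [hsec, map_add, hsec, hsec])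
  have hmul : ∀ a b, W.mkQ (g (sec (a * b))) = a • W.mkQ (g (sec b)) + b • W.mkQ (g (sec a)) :=
    fun a b => by
      rw [← map_smul, ← map_smul, ← map_add]
      nth_rewrite 2 [← hsec a]
      nth_rewrite 3 [← hsec b]
      rw [← gmul]
      exact gsub _ _ (by rw [hsec, map_mul, hsec, hsec])
  refine ⟨Derivation.mk'
    { toFun := fun b => W.mkQ (g (sec b))
      map_add' := hadd
      map_smul' := fun a b => ?_ } hmul, hG⟩
  have : W.mkQ (g (sec (algebraMap R B a))) = 0 := by
    rw [← MvPolynomial.aeval_C y a, hG, gC, map_zero]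
  rw [Algebra.smul_def, hmul, this, smul_zero, add_zero, RingHom.id_apply, algebraMap_smul]

/-- The relations between the `dy_k` are generated by the `dfⱼ`. -/
lemma ker_freeToOmega
    (hy : Function.Surjective (MvPolynomial.aeval y : MvPolynomial (Fin N) R →ₐ[R] B))
    (hk : ∀ p : MvPolynomial (Fin N) R, MvPolynomial.aeval y p = 0 →
      p ∈ Ideal.span (Set.range f))
    (hf : ∀ j, MvPolynomial.aeval y (f j) = 0) :
    LinearMap.ker (freeToOmega R y) = Submodule.span B (Set.range (jacMat f y)) := by
  obtain ⟨δ, hδ⟩ := exists_gradMod hy hk hf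
  refine le_antisymm (fun v hv => ?_) ?_
  · have h : δ.liftKaehlerDifferential ∘ₗ freeToOmega R y = Submodule.mkQ _ := by
      refine (Pi.basisFun B (Fin N)).ext fun k => ?_
      rw [LinearMap.comp_apply, freeToOmega, Pi.basisFun_apply,
        Fintype.linearCombination_apply_single, one_smul,
        Derivation.liftKaehlerDifferential_comp_D, ← MvPolynomial.aeval_X (R := R) y k, hδ,
        Submodule.mkQ_apply]
      congr 1
      ext l
      rw [MvPolynomial.pderiv_X, Pi.single_apply, Pi.single_apply,
        apply_ite (MvPolynomial.aeval y), map_one, map_zero]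
      simp [eq_comm]
    have h2 := LinearMap.congr_fun h v
    rw [LinearMap.comp_apply, LinearMap.mem_ker.mp hv, map_zero, eq_comm, Submodule.mkQ_apply,
      Submodule.Quotient.mk_eq_zero] at h2
    exact h2
  · rw [Submodule.span_le]
    rintro _ ⟨j, rfl⟩
    refine LinearMap.mem_ker.mpr ((D_eq_freeToOmega y (f j)).symm.trans ?_)
    rw [hf, map_zero]

/-- The Jacobian criterion: the Jacobian matrix of a smooth complete intersection has a right
inverse. The kernel of `freeToOmega` is projective of rank `r` and generated by the `r` rows of the
Jacobian matrix, which are therefore a basis of a direct summand. -/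
lemma exists_jacMat_mul_eq_one [Module.Projective B Ω[B⁄R]]
    (hy : Function.Surjective (MvPolynomial.aeval y : MvPolynomial (Fin N) R →ₐ[R] B))
    (hk : ∀ p : MvPolynomial (Fin N) R, MvPolynomial.aeval y p = 0 →
      p ∈ Ideal.span (Set.range f))
    (hf : ∀ j, MvPolynomial.aeval y (f j) = 0)
    (hrank : ∀ p : PrimeSpectrum B, Module.rankAtStalk Ω[B⁄R] p + r = N) :
    ∃ M : Matrix (Fin N) (Fin r) B, jacMat f y * M = 1 := by
  have hker := ker_freeToOmega hy hk hf
  have hsurj := freeToOmega_surjective hy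
  obtain ⟨s, hs⟩ := Module.projective_lifting_property (freeToOmega R y) LinearMap.id hsurj
  have hs' : ∀ w, freeToOmega R y (s w) = w := LinearMap.congr_fun hs
  have : Module.Finite B Ω[B⁄R] := Module.Finite.of_surjective _ hsurj
  let ret : (Fin N → B) →ₗ[B] LinearMap.ker (freeToOmega R y) :=
    (LinearMap.id - s ∘ₗ freeToOmega R y).codRestrict _ fun v => by simp [hs']
  have hret : ∀ v : LinearMap.ker (freeToOmega R y), ret v = v := fun v => by
    ext1
    change (v : Fin N → B) - s (freeToOmega R y v) = v
    rw [LinearMap.mem_ker.mp v.2, map_zero, sub_zero]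
  have hproj : Module.Projective B (LinearMap.ker (freeToOmega R y)) :=
    Module.Projective.of_split (Submodule.subtype _) ret (LinearMap.ext hret)
  have hfin : Module.Finite B (LinearMap.ker (freeToOmega R y)) :=
    Module.Finite.of_surjective ret fun v => ⟨v, hret v⟩
  let e : (Fin N → B) ≃ₗ[B] LinearMap.ker (freeToOmega R y) × Ω[B⁄R] :=
    { ret.prod (freeToOmega R y) with
      invFun := fun p => p.1 + s p.2
      left_inv := fun v => by
        change v - s (freeToOmega R y v) + s (freeToOmega R y v) = v
        abel
      right_inv := fun p => by
        refine Prod.ext ?_ ?_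
        · change ret (p.1 + s p.2) = p.1
          have : ret (s p.2) = 0 := by
            ext1
            change s p.2 - s (freeToOmega R y (s p.2)) = 0
            rw [hs', sub_self]
          rw [map_add, hret, this, add_zero]
        · change freeToOmega R y (p.1 + s p.2) = p.2
          rw [map_add, hs', LinearMap.mem_ker.mp p.1.2, zero_add] }
  let g : (Fin r → B) →ₗ[B] LinearMap.ker (freeToOmega R y) :=
    Fintype.linearCombination _ fun j => ⟨jacMat f y j,
      hker.ge (Submodule.subset_span (Set.mem_range_self j))⟩
  have hg1 : ∀ v, (g v : Fin N → B) = ∑ j, v j • jacMat f y j := fun v => by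
    simp [g, Fintype.linearCombination_apply]
  have hg : Function.Surjective g := fun v => by
    have hv : (v : Fin N → B) ∈ Submodule.span B (Set.range (jacMat f y)) := hker.le v.2
    obtain ⟨w, hw⟩ := (Submodule.mem_span_range_iff_exists_fun B).mp hv
    exact ⟨w, Subtype.ext ((hg1 w).trans hw)⟩
  have hbij : Function.Bijective g := by
    refine Module.bijective_of_surjective_of_rankAtStalk_eq hg ?_
    intro m hm
    have : Nontrivial B := ⟨⟨0, 1, fun h => hm.ne_top (m.eq_top_of_isUnit_mem
      (m.zero_mem) (h ▸ isUnit_one))⟩⟩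
    have h1 := congrFun (Module.rankAtStalk_eq_of_equiv e) ⟨m, hm.isPrime⟩
    rw [Module.rankAtStalk_prod, Module.rankAtStalk_eq_finrank_of_free] at h1
    rw [Module.rankAtStalk_eq_finrank_of_free]
    have h2 := hrank ⟨m, hm.isPrime⟩
    simp only [Pi.natCast_apply, Pi.add_apply, Module.finrank_fin_fun, Nat.cast_id] at h1 ⊢
    omega
  let g' := LinearEquiv.ofBijective g hbij
  refine ⟨Matrix.of fun k j => g'.symm (ret (Pi.single k 1)) j, ?_⟩
  ext i j
  have h1 : (g'.symm (ret (jacMat f y i)) : Fin r → B) = Pi.single i 1 := by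
    rw [LinearEquiv.symm_apply_eq]
    have h3 : (g (Pi.single i 1) : Fin N → B) = jacMat f y i := by
      rw [hg1, Finset.sum_eq_single i] <;> simp +contextual
    have := hret (g (Pi.single i 1))
    rw [h3] at this
    exact this
  have h2 : jacMat f y i = ∑ k, jacMat f y i k • (Pi.single k 1 : Fin N → B) := by
    ext l
    simp [Finset.sum_apply, Pi.single_apply]
  rw [h2, map_sum, map_sum] at h1
  have h4 := congrFun h1 j
  simp only [map_smul, Finset.sum_apply, Pi.smul_apply, smul_eq_mul] at h4
  rw [Matrix.mul_apply]
  refine h4.trans ?_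
  rw [Matrix.one_apply, Pi.single_apply]
  simp [eq_comm]

/-- The maximal minors of a matrix with a right inverse generate the unit ideal. -/
lemma span_minors_eq_top {A : Type*} [CommRing A] (J : Matrix (Fin r) (Fin N) A)
    (M : Matrix (Fin N) (Fin r) A) (h : J * M = 1) (I : Ideal A)
    (hI : ∀ (S : Finset (Fin N)) (hS : S.card = r),
      (Matrix.of fun j k => J j (S.orderEmbOfFin hS k)).det ∈ I) : I = ⊤ := by
  have hmin : ∀ v : Fin r → Fin N, (Matrix.of fun j k => J j (v k)).det ∈ I := by
    intro v
    by_cases hv : Function.Injective v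
    · let S := Finset.univ.image v
      have hS : S.card = r := by
        rw [Finset.card_image_of_injective _ hv, Finset.card_univ, Fintype.card_fin]
      have hvS : ∀ k, v k ∈ S := fun k => Finset.mem_image_of_mem v (Finset.mem_univ k)
      let σ' : Fin r → Fin r := fun k => (S.orderIsoOfFin hS).symm ⟨v k, hvS k⟩
      have hσ' : ∀ k, S.orderEmbOfFin hS (σ' k) = v k := fun k => by
        rw [← Finset.coe_orderIsoOfFin_apply, OrderIso.apply_symm_apply]
      have hinj : Function.Injective σ' := fun a b hab => hv (by rw [← hσ', ← hσ', hab])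
      let σ := Equiv.ofBijective σ' (Finite.injective_iff_bijective.mp hinj)
      have e : (Matrix.of fun j k => J j (v k)) =
          (Matrix.of fun j k => J j (S.orderEmbOfFin hS k)).submatrix id σ := by
        ext j k
        change J j (v k) = J j (S.orderEmbOfFin hS (σ' k))
        rw [hσ']
      rw [e, Matrix.det_permute']
      exact I.mul_mem_left _ (hI S hS)
    · obtain ⟨a, b, hab, hne⟩ : ∃ a b, v a = v b ∧ a ≠ b := by
        simpa [Function.Injective] using hv
      rw [Matrix.det_zero_of_column_eq hne fun j => by simp [hab]]
      exact zero_mem _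
  rw [Ideal.eq_top_iff_one, ← Matrix.det_one (n := Fin r), ← h, ← Matrix.det_transpose]
  have e : (J * M).transpose = fun j => ∑ k, M k j • J.transpose k := by
    ext j i
    simp [Matrix.mul_apply, Finset.sum_apply, mul_comm]
  rw [e]
  change Matrix.detRowAlternating.toMultilinearMap _ ∈ I
  rw [MultilinearMap.map_sum]
  refine sum_mem fun v _ => ?_
  rw [MultilinearMap.map_smul_univ, smul_eq_mul]
  refine I.mul_mem_left _ ?_
  have hv := hmin v
  rw [← Matrix.det_transpose] at hv
  exact hv

end Jacobian

/-! ### The residue of `dx₁ ⋯ dx_N` along a complete intersection -/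

section Volume

variable {R C : Type*} [CommRing R] [CommRing C] [Algebra R C] {N : ℕ} (x : Fin N → C)

/-- The form `± dx₁ ⋯ dx_N`, with the sign of the permutation that moves `r` factors past the
remaining `N - r`. -/
def volForm (r : ℕ) (h : ∀ c, dB R c * dSet R x Finset.univ = 0) : topForms R C N :=
  ⟨(-1 : ℤ) ^ (r * (N - r)) • dSet R x Finset.univ, zsmul_mem (dSet_univ_mem_topForms h) _⟩

lemma lieD_volForm (r : ℕ) (h : ∀ c, dB R c * dSet R x Finset.univ = 0) {K : Type*} [CommRing K]
    [Algebra K R] [Algebra K C] {τ : Derivation K R R} {E : Derivation K C C} (hE : IsLift τ E)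
    (hx : ∀ k, dB R (E (x k)) = 0) : lieD hE (volForm x r h : Forms R C) = 0 := by
  change lieD hE ((-1 : ℤ) ^ (r * (N - r)) • dSet R x Finset.univ) = 0
  rw [map_zsmul, lieD_dSet x hE hx, smul_zero]

lemma formsMap_dSet {B : Type*} [CommRing B] [Algebra R B] [Algebra C B] [IsScalarTower R C B]
    (S : Finset (Fin N)) :
    formsMap R C B (dSet R x S) = dSet R (fun k => algebraMap C B (x k)) S := by
  rw [dSet, dSet]
  induction S.sort (· ≤ ·) with
  | nil => exact map_one _
  | cons i l ih => rw [dProd_cons, dProd_cons, map_mul, formsMap_dB, ih]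

/-- The formula for the residue of `dx₁ ⋯ dx_N` in terms of Jacobian determinants. -/
lemma det_smul_resForm_volForm {B : Type*} [CommRing B] [Algebra R B] [Algebra C B]
    [IsScalarTower R C B] {r : ℕ} {φ : Fin r → C} (θ : Fin r → Derivation R C C)
    (hθ : ∀ i j, θ i (φ j) = if i = j then 1 else 0) (hφ : ∀ j, algebraMap C B (φ j) = 0)
    (h : ∀ c, dB R c * dSet R x Finset.univ = 0) (c : Fin r → Fin N → C)
    (hc : ∀ j, dB R (φ j) = ∑ k, c j k • dB R (x k)) (S : Finset (Fin N)) (hS : S.card = r) :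
    algebraMap C B (Matrix.of fun j k => c j (S.orderEmbOfFin hS k)).det •
      resForm θ B (volForm x r h : Forms R C) =
      (-1 : ℤ) ^ inversions Sᶜ S • dSet R (fun k => algebraMap C B (x k)) Sᶜ := by
  rw [← resForm_smul, ← formsMap_dSet, ← map_zsmul]
  refine resForm_eq θ hθ hφ (Submodule.smul_mem _ _ (volForm x r h).2) ?_
  have hS' : Sᶜ.card = N - r := by rw [Finset.card_compl, Fintype.card_fin, hS]
  have h1 : dSet R x S * dSet R x Sᶜ = (-1 : ℤ) ^ (r * (N - r)) • (dSet R x Sᶜ * dSet R x S) := by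
    have := dSet_mul_comm (R := R) x Sᶜ (S.sort (· ≤ ·))
    rwa [Finset.length_sort, hS, hS'] at this
  rw [mul_smul_comm, dProd_mul_dSet_compl x φ c hc S hS, h1,
    dSet_mul_dSet x _ _ disjoint_compl_left, Finset.union_comm, Finset.union_compl,
    smul_comm ((-1 : ℤ) ^ inversions Sᶜ S) (Matrix.det _),
    smul_comm ((-1 : ℤ) ^ (r * (N - r))) ((-1 : ℤ) ^ inversions Sᶜ S),
    smul_smul ((-1 : ℤ) ^ inversions Sᶜ S), ← mul_pow, neg_one_mul, neg_neg, one_pow, one_smul]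
  rfl

end Volume

/-! ### Lifting derivations to open subsets of affine space -/

section Derivations

variable {R C : Type*} [CommRing R] [CommRing C] [Algebra R C] {N r : ℕ} {x : Fin N → C}
  {D : Fin N → Derivation R C C}
  (hD : ∀ k (p : MvPolynomial (Fin N) R), D k (MvPolynomial.aeval x p) = MvPolynomial.aeval x (MvPolynomial.pderiv k p))

include hD in
lemma partial_coord (k l : Fin N) : D k (x l) = if k = l then 1 else 0 := by
  rw [← MvPolynomial.aeval_X (R := R) x l, hD, MvPolynomial.pderiv_X, Pi.single_apply]
  split_ifs <;> simp_all

include hD in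
lemma coord_mul_partial_mon (k : Fin N) (a : Fin N →₀ ℕ) :
    x k * D k (mon R x a) = a k • mon R x a := by
  rw [mon, hD, ← MvPolynomial.aeval_X (R := R) x k, ← map_mul, MvPolynomial.X_mul_pderiv_monomial,
    map_nsmul]

lemma sum_smul_apply {ι : Type*} (s : Finset ι) (c : ι → C) (v : ι → Derivation R C C) (b : C) :
    (∑ i ∈ s, c i • v i) b = ∑ i ∈ s, c i * v i b := by
  rw [← Derivation.coeFnAddMonoidHom_apply, map_sum, Finset.sum_apply]
  rfl

variable {K : Type*} [CommRing K] [Algebra K R] [Algebra K C] [IsScalarTower K R C]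

lemma mon_zero : mon R x 0 = 1 := map_one (MvPolynomial.aeval x)

lemma mon_single (k : Fin N) (e : ℕ) : mon R x (Finsupp.single k e) = x k ^ e := by
  rw [mon, MvPolynomial.aeval_monomial, map_one, one_mul]
  exact Finsupp.prod_single_index (pow_zero _)

include hD in
/-- Derivations of the base lift to derivations that kill the coordinates. -/
lemma exists_isLift_mon_eq_zero [Algebra.FormallySmooth R C] (τ : Derivation K R R) :
    ∃ E : Derivation K C C, IsLift τ E ∧ ∀ a, E (mon R x a) = 0 := by
  obtain ⟨E, hE⟩ := exists_isLift (B := C) τ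
  let W : Derivation K C C := E - (∑ k, E (x k) • D k).restrictScalars K
  have hW : ∀ b, W b = E b - ∑ k, E (x k) * D k b := fun b => by
    rw [← sum_smul_apply]
    rfl
  have hx : ∀ k, W (x k) = 0 := fun k => by simp [hW, partial_coord hD]
  refine ⟨W, fun a => by simp [hW, hE a], fun a => ?_⟩
  induction a using Finsupp.induction_linear with
  | zero => rw [mon_zero, Derivation.map_one_eq_zero]
  | add a b ha hb => rw [mon_add, Derivation.leibniz, ha, hb, smul_zero, smul_zero, add_zero]
  | single k e => rw [mon_single, Derivation.leibniz_pow, hx, smul_zero, smul_zero]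

end Derivations

/-! ### A neighbourhood of the complete intersection -/

section Chart

variable {R : Type*} [CommRing R] {N r : ℕ} {f : Fin r → MvPolynomial (Fin N) R}

/-- A right inverse of the Jacobian matrix on the complete intersection extends to a polynomial
matrix `c` that is `g` times a right inverse, for a polynomial `g` equal to `1` on the complete
intersection. -/
lemma exists_jacobian_mul_eq {B : Type*} [CommRing B] [Algebra R B] {y : Fin N → B}
    (hy : Function.Surjective (MvPolynomial.aeval y : MvPolynomial (Fin N) R →ₐ[R] B))
    (M : Matrix (Fin N) (Fin r) B) (hM : jacMat f y * M = 1) :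
    ∃ (c : Fin N → Fin r → MvPolynomial (Fin N) R) (g : MvPolynomial (Fin N) R),
      (∀ i j, ∑ k, MvPolynomial.pderiv k (f i) * c k j = if i = j then g else 0) ∧
        MvPolynomial.aeval y g = 1 := by
  choose l hl using hy
  -- `G` is the identity on the complete intersection, and `adj G` inverts it up to `g = det G`.
  let J : Matrix (Fin r) (Fin N) (MvPolynomial (Fin N) R) :=
    Matrix.of fun j k => MvPolynomial.pderiv k (f j)
  let G := J * M.map l
  refine ⟨M.map l * G.adjugate, G.det, fun i j => ?_, ?_⟩
  · have : J * (M.map l * G.adjugate) = G.det • 1 := by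
      rw [← Matrix.mul_assoc, Matrix.mul_adjugate]
    have := congrFun (congrFun this i) j
    rw [Matrix.mul_apply, Matrix.smul_apply, Matrix.one_apply, smul_eq_mul, mul_ite, mul_one,
      mul_zero] at this
    exact this
  · have e : (MvPolynomial.aeval y : MvPolynomial (Fin N) R →ₐ[R] B).mapMatrix G = 1 := by
      ext i j
      change MvPolynomial.aeval y ((J * M.map l) i j) = _
      rw [Matrix.mul_apply, map_sum, ← hM, Matrix.mul_apply]
      refine Finset.sum_congr rfl fun k _ => ?_
      rw [map_mul]
      exact congrArg _ (hl _)
    rw [AlgHom.map_det, e, Matrix.det_one]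

end Chart

lemma aeval_poly {R C : Type*} [CommRing R] [CommRing C] [Algebra R C] {N r : ℕ} {m : Fin r → ℕ}
    (d : (Σ j, Fin (m j)) → Fin N →₀ ℕ) (lam : (Σ j, Fin (m j)) → R) (x : Fin N → C) (j : Fin r) :
    MvPolynomial.aeval x (poly d lam j) =
    ∑ i, algebraMap R C (lam ⟨j, i⟩) * mon R x (d ⟨j, i⟩) := by
  rw [poly, map_sum]
  refine Finset.sum_congr rfl fun i _ => ?_
  rw [mon, MvPolynomial.aeval_monomial, MvPolynomial.aeval_monomial, map_one, one_mul]

section Residue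

variable {R C B : Type*} [CommRing R] [CommRing C] [CommRing B] [Algebra ℂ R]
  [Algebra ℂ C] [Algebra ℂ B] [Algebra R C] [Algebra R B] [Algebra C B]
  [IsScalarTower R C B] [IsScalarTower ℂ R B] [IsScalarTower ℂ C B] [IsScalarTower ℂ R C]
  [Algebra.FormallySmooth ℂ R] [Algebra.EssFiniteType ℂ R]
  [Algebra.FormallySmooth R B] [Algebra.FormallySmooth R C] {N r : ℕ} {m : Fin r → ℕ}
  (d : (Σ j, Fin (m j)) → Fin N →₀ ℕ) (lam : (Σ j, Fin (m j)) → R)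

/-- The residue form of `x^u dx₁ ⋯ dx_N`, computed on a neighbourhood `Spec C` of the complete
intersection `Spec B` in affine space on which the Jacobian matrix has the right inverse `c`. -/
lemma exists_residue {x : Fin N → C} {D : Fin N → Derivation R C C}
    (hD : ∀ k (p : MvPolynomial (Fin N) R),
      D k (MvPolynomial.aeval x p) = MvPolynomial.aeval x (MvPolynomial.pderiv k p))
    (hvol : ∀ b, dB R b * dSet R x Finset.univ = 0) (c : Fin N → Fin r → C)
    (hc : ∀ i j, ∑ k, MvPolynomial.aeval x (MvPolynomial.pderiv k (poly d lam i)) * c k j =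
      if i = j then 1 else 0)
    (hφ : ∀ j, algebraMap C B (MvPolynomial.aeval x (poly d lam j)) = 0)
    (hs : Function.Surjective (algebraMap C B))
    (hk : ∀ b, algebraMap C B b = 0 →
      b ∈ Ideal.span (Set.range fun j => MvPolynomial.aeval x (poly d lam j)))
    (y : Fin N → B) (hy : ∀ k, algebraMap C B (x k) = y k) (u : Fin N →₀ ℕ) :
    ∃ ω : ⋀[B]^(N - r) Ω[B⁄R],
      (∀ (S : Finset (Fin N)) (hS : S.card = r),
        (Matrix.of fun j k => jacMat (poly d lam) y j (S.orderEmbOfFin hS k)).det •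
          (ω : Forms R B) =
          (-1 : ℤ) ^ inversions Sᶜ S •
            (MvPolynomial.aeval y (MvPolynomial.monomial u (1 : R)) • dSet R y Sᶜ)) ∧
      ∃ hω : extD R B ω = 0, ∀ L ∈ hypIdealOver d lam u 0,
        (gaussManin R B ℂ (N - r)).act L (HdR.mk ω hω) = 0 := by
  obtain rfl : y = algebraMap C B ∘ x := funext fun k => (hy k).symm
  let φ : Fin r → C := fun j => MvPolynomial.aeval x (poly d lam j)
  -- The derivations `∂/∂φⱼ`.
  let θ : Fin r → Derivation R C C := fun j => ∑ k, c k j • D k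
  have hθ : ∀ i j, θ i (φ j) = if i = j then 1 else 0 := fun i j => by
    rw [sum_smul_apply]
    simp only [φ, hD]
    rw [Finset.sum_congr rfl fun k _ => mul_comm _ _, hc]
    simp only [eq_comm]
  let vol := volForm x r hvol
  have hx : ∀ k l, dB R (D k (x l)) = 0 := fun k l => by
    rw [partial_coord hD]
    split_ifs <;> simp [dB]
  let w : topForms R C N := mon R x u • vol
  let ω : ⋀[B]^(N - r) Ω[B⁄R] := ⟨resForm θ B (w : Forms R C), resForm_mem θ w.2⟩
  have hω : extD R B ω = 0 := extD_resForm θ hθ hφ w.2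
  refine ⟨ω, fun S hS => ?_, hω, fun L hL => ?_⟩
  · have h := det_smul_resForm_volForm (B := B) x θ hθ hφ hvol
      (fun j k => MvPolynomial.aeval x (MvPolynomial.pderiv k (poly d lam j)))
      (fun j => dB_aeval x _) S hS
    have e : algebraMap C B (Matrix.of fun j k => MvPolynomial.aeval x
        (MvPolynomial.pderiv (S.orderEmbOfFin hS k) (poly d lam j))).det =
        (Matrix.of fun j k =>
          jacMat (poly d lam) (algebraMap C B ∘ x) j (S.orderEmbOfFin hS k)).det := by
      rw [RingHom.map_det]
      congr 1
      ext j k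
      exact (MvPolynomial.aeval_algebraMap_apply _ _ _).symm
    change _ • resForm θ B (mon R x u • (vol : Forms R C)) = _
    rw [resForm_smul, ← e, smul_comm, h, smul_comm, MvPolynomial.aeval_algebraMap_apply]
    rfl
  · have h := act_eq_zero_of_mem_hypIdealOver d (gaussManin R B ℂ (N - r))
      (resFamily ℂ θ hθ hφ hs hk x vol) lam (fun τ a => ?_) (fun k a => ?_) u hL
    · rwa [resFamily, wordOp_zero, Module.End.one_apply, TopQuot.res_mk, resClass_apply] at h
    · obtain ⟨E, hE, hmon⟩ := exists_isLift_mon_eq_zero hD τ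
      refine nabla_resFamily θ hθ hφ hs hk x vol d lam (aeval_poly d lam x) hE
        (lieD_volForm x r hvol hE fun k => ?_) hmon a
      have := hmon (Finsupp.single k 1)
      rw [mon_single, pow_one] at this
      rw [this]
      simp [dB]
    · cases k with
      | inl k =>
        exact resFamily_relation_inl (K := ℂ) θ hθ hφ hs hk x vol d lam (aeval_poly d lam x) (D k) k
          (lieD_volForm x r hvol _ (hx k)) (coord_mul_partial_mon hD k)
          ((partial_coord hD k k).trans (if_pos rfl)) a
      | inr j =>
        exact resFamily_relation_inr (K := ℂ) θ hθ hφ hs hk x vol d lam (aeval_poly d lam x) j a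

end Residue

section Chart

/-- The partial derivatives extend to localizations of the polynomial ring. -/
lemma exists_partial {R C : Type*} [CommRing R] [CommRing C] {N : ℕ} [Algebra R C]
    [Algebra (MvPolynomial (Fin N) R) C] [IsScalarTower R (MvPolynomial (Fin N) R) C]
    [Algebra.FormallySmooth (MvPolynomial (Fin N) R) C] (k : Fin N) :
    ∃ D : Derivation R C C, ∀ p : MvPolynomial (Fin N) R,
      D (algebraMap _ C p) = algebraMap _ C (MvPolynomial.pderiv k p) :=
  exists_isLift (MvPolynomial.pderiv k)

lemma dB_mul_eq_zero_of_isLocalization {R P C : Type*} [CommRing R] [CommRing P] [CommRing C]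
    [Algebra R C] [Algebra P C] (T : Submonoid P) [IsLocalization T C] {z : Forms R C}
    (h : ∀ p : P, dB R (algebraMap P C p) * z = 0) (c : C) : dB R c * z = 0 := by
  obtain ⟨p, s, rfl⟩ := IsLocalization.exists_mk'_eq T c
  have hu := IsLocalization.map_units C s
  have h1 := h p
  rw [← IsLocalization.mk'_spec C p s, dB_mul, add_mul, smul_mul_assoc, smul_mul_assoc, h,
    smul_zero, zero_add] at h1
  exact (hu.smul_eq_zero).mp h1

variable {R B : Type*} [CommRing R] [CommRing B] [Algebra ℂ R]
  [Algebra ℂ B] [Algebra R B] [IsScalarTower ℂ R B]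
  [Algebra.FormallySmooth ℂ R] [Algebra.EssFiniteType ℂ R]
  [Algebra.FormallySmooth R B] {N r : ℕ} {m : Fin r → ℕ}
  {d : (Σ j, Fin (m j)) → Fin N →₀ ℕ} {lam : (Σ j, Fin (m j)) → R} {y : Fin N → B}

/-- Existence of the form `ω_u`, and its differential equations. -/
lemma exists_residue_of_jacMat_mul_eq_one
    (hy : Function.Surjective (MvPolynomial.aeval y : MvPolynomial (Fin N) R →ₐ[R] B))
    (hk : ∀ p : MvPolynomial (Fin N) R, MvPolynomial.aeval y p = 0 →
      p ∈ Ideal.span (Set.range (poly d lam)))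
    (hf : ∀ j, MvPolynomial.aeval y (poly d lam j) = 0)
    {M : Matrix (Fin N) (Fin r) B} (hM : jacMat (poly d lam) y * M = 1) (u : Fin N →₀ ℕ) :
    ∃ ω : ⋀[B]^(N - r) Ω[B⁄R],
      (∀ (S : Finset (Fin N)) (hS : S.card = r),
        (Matrix.of fun j k => jacMat (poly d lam) y j (S.orderEmbOfFin hS k)).det •
          (ω : Forms R B) =
          (-1 : ℤ) ^ inversions Sᶜ S •
            (MvPolynomial.aeval y (MvPolynomial.monomial u (1 : R)) • dSet R y Sᶜ)) ∧
      ∃ hω : extD R B ω = 0, ∀ L ∈ hypIdealOver d lam u 0,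
        (gaussManin R B ℂ (N - r)).act L (HdR.mk ω hω) = 0 := by
  obtain ⟨c, g, hc, hg⟩ := exists_jacobian_mul_eq hy M hM
  -- The neighbourhood of the complete intersection on which `g` is invertible.
  let C := Localization.Away g
  have hgu : IsUnit ((MvPolynomial.aeval y).toRingHom g) := by
    change IsUnit (MvPolynomial.aeval y g)
    rw [hg]
    exact isUnit_one
  let _ : Algebra C B := (IsLocalization.Away.lift g hgu).toAlgebra
  have hCB : ∀ p : MvPolynomial (Fin N) R,
      algebraMap C B (algebraMap _ C p) = MvPolynomial.aeval y p := fun p =>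
    IsLocalization.Away.lift_eq g hgu p
  have : IsScalarTower R C B := IsScalarTower.of_algebraMap_eq fun a => by
    rw [IsScalarTower.algebraMap_apply R (MvPolynomial (Fin N) R) C, hCB, MvPolynomial.algebraMap_eq,
      MvPolynomial.aeval_C]
  have : IsScalarTower ℂ C B := IsScalarTower.of_algebraMap_eq fun a => by
    rw [IsScalarTower.algebraMap_apply ℂ R C, ← IsScalarTower.algebraMap_apply R C B,
      ← IsScalarTower.algebraMap_apply]
  have hsm : Algebra.FormallySmooth (MvPolynomial (Fin N) R) C :=
    Algebra.FormallySmooth.of_isLocalization (Submonoid.powers g)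
  have : Algebra.FormallySmooth R C := Algebra.FormallySmooth.comp R (MvPolynomial (Fin N) R) C
  let x : Fin N → C := fun k => algebraMap (MvPolynomial (Fin N) R) C (MvPolynomial.X k)
  have hx : ∀ p : MvPolynomial (Fin N) R, MvPolynomial.aeval x p = algebraMap _ C p := fun p => by
    have := MvPolynomial.aeval_algebraMap_apply C (MvPolynomial.X : Fin N → MvPolynomial (Fin N) R) p
    rw [MvPolynomial.aeval_X_left_apply] at this
    exact this
  choose D hD using exists_partial (R := R) (C := C) (N := N)
  have hgC : IsUnit (algebraMap _ C g) := IsLocalization.Away.algebraMap_isUnit g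
  refine exists_residue d lam (x := x) (D := D) (fun k p => by rw [hx, hx, hD])
    (dB_mul_eq_zero_of_isLocalization (Submonoid.powers g) fun p => ?_)
    (fun k j => algebraMap _ C (c k j) * ↑hgC.unit⁻¹) (fun i j => ?_) (fun j => ?_) (fun b => ?_)
    (fun b hb => ?_) y (fun k => ?_) u
  · rw [← hx]
    exact dB_aeval_mul_dSet_univ x p
  · simp only [hx, ← mul_assoc, ← map_mul]
    rw [← Finset.sum_mul, ← map_sum, hc]
    split_ifs
    · exact hgC.mul_val_inv
    · rw [map_zero, zero_mul]
  · rw [hx, hCB, hf]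
  · obtain ⟨p, rfl⟩ := hy b
    exact ⟨_, hCB p⟩
  · obtain ⟨p, s, rfl⟩ := IsLocalization.exists_mk'_eq (Submonoid.powers g) b
    have hu := IsLocalization.map_units C s
    have hp : MvPolynomial.aeval y p = 0 := by
      rw [← hCB, ← IsLocalization.mk'_spec C p s, map_mul, hb, zero_mul]
    have h1 := Ideal.mem_map_of_mem (algebraMap _ C) (hk p hp)
    rw [Ideal.map_span, ← Set.range_comp, ← IsLocalization.mk'_spec C p s, mul_comm] at h1
    have h2 := (Ideal.unit_mul_mem_iff_mem _ hu).mp h1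
    simp only [hx]
    exact h2
  · rw [hCB, MvPolynomial.aeval_X]

end Chart

/-! ### Uniqueness of the form -/

/-- An element of a module that is killed by powers of all maximal minors of a matrix with a right
inverse is zero. -/
lemma eq_zero_of_minors_pow_smul {A M : Type*} [CommRing A] [AddCommGroup M] [Module A M] {N r : ℕ}
    {J : Matrix (Fin r) (Fin N) A} {Q : Matrix (Fin N) (Fin r) A} (h : J * Q = 1) {v : M}
    (hv : ∀ (S : Finset (Fin N)) (hS : S.card = r),
      ∃ e : ℕ, (Matrix.of fun j k => J j (S.orderEmbOfFin hS k)).det ^ e • v = 0) : v = 0 := by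
  have h1 := span_minors_eq_top J Q h (Ideal.radical (LinearMap.ker (LinearMap.toSpanSingleton A M v)))
    fun S hS => (hv S hS).imp fun e he => LinearMap.mem_ker.mpr he
  have h2 := (Ideal.radical_eq_top.mp h1 ▸ Submodule.mem_top :
    (1 : A) ∈ LinearMap.ker (LinearMap.toSpanSingleton A M v))
  rwa [LinearMap.mem_ker, LinearMap.toSpanSingleton_apply, one_smul] at h2

section CompleteIntersection

variable {R : Type*} [CommRing R] {N r : ℕ} (f : Fin r → MvPolynomial (Fin N) R)

/-- The coordinate functions on the complete intersection. -/
def coord (k : Fin N) : CoordRing f := Ideal.Quotient.mk _ (MvPolynomial.X k)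

lemma aeval_coord (p : MvPolynomial (Fin N) R) :
    MvPolynomial.aeval (coord f) p = Ideal.Quotient.mk (Ideal.span (Set.range f)) p := by
  have : MvPolynomial.aeval (coord f) = Ideal.Quotient.mkₐ R (Ideal.span (Set.range f)) :=
    MvPolynomial.algHom_ext fun k => by rw [MvPolynomial.aeval_X]; rfl
  exact DFunLike.congr_fun this p

lemma jac_eq (S : Finset (Fin N)) (hS : S.card = r) :
    jac f S hS = (Matrix.of fun j k => jacMat f (coord f) j (S.orderEmbOfFin hS k)).det := by
  rw [jac]
  congr 1
  ext j k
  exact (aeval_coord f _).symm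

lemma coe_dxCompl (S : Finset (Fin N)) (hS : S.card = r) :
    (dxCompl f S hS : Forms R (CoordRing f)) = dSet R (coord f) Sᶜ := by
  rw [dSet_eq_ιMulti (coord f) Sᶜ (by rw [Finset.card_compl, Fintype.card_fin, hS]), dxCompl,
    exteriorPower.ιMulti_apply_coe]
  rfl

variable {f}

lemma isOmega_iff {u : Fin N →₀ ℕ} {ω : ⋀[CoordRing f]^(N - r) Ω[CoordRing f⁄R]} :
    IsOmega f u ω ↔ ∀ (S : Finset (Fin N)) (hS : S.card = r), ∃ e : ℕ,
      jac f S hS ^ e • jac f S hS • ω = jac f S hS ^ e •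
        ((sgn S • Ideal.Quotient.mk _ (MvPolynomial.monomial u 1) : CoordRing f) •
          dxCompl f S hS) := by
  refine forall₂_congr fun S hS => ?_
  rw [LocalizedModule.mk_eq]
  constructor
  · rintro ⟨⟨_, e, rfl⟩, h⟩
    exact ⟨e, h.trans (congrArg _ (one_smul _ _))⟩
  · rintro ⟨e, h⟩
    exact ⟨⟨_, e, rfl⟩, h.trans (congrArg _ (one_smul _ _).symm)⟩

lemma isOmega_of_forall_smul_eq {u : Fin N →₀ ℕ} {ω : ⋀[CoordRing f]^(N - r) Ω[CoordRing f⁄R]}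
    (h : ∀ (S : Finset (Fin N)) (hS : S.card = r), jac f S hS • (ω : Forms R (CoordRing f)) =
      (-1 : ℤ) ^ inversions Sᶜ S • (MvPolynomial.aeval (coord f)
        (MvPolynomial.monomial u (1 : R)) • dSet R (coord f) Sᶜ))
    (S : Finset (Fin N)) (hS : S.card = r) : jac f S hS • ω =
      (sgn S • Ideal.Quotient.mk _ (MvPolynomial.monomial u 1) : CoordRing f) •
        dxCompl f S hS := by
  refine Subtype.ext ((h S hS).trans ?_)
  rw [← coe_dxCompl f S hS, aeval_coord]
  exact (smul_assoc (sgn S) (Ideal.Quotient.mk (Ideal.span (Set.range f))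
    (MvPolynomial.monomial u (1 : R))) (dxCompl f S hS : Forms R (CoordRing f))).symm

end CompleteIntersection

end RelDeRham

end

theorem corollary6p8 {R : Type*} [CommRing R] [Algebra ℂ R] [Algebra.FormallySmooth ℂ R]
    [Algebra.EssFiniteType ℂ R] {N r : ℕ} (m : Fin r → ℕ)
    (d : (Σ j, Fin (m j)) → Fin N →₀ ℕ) (lam : (Σ j, Fin (m j)) → R)
    (hf : RelDeRham.IsSmoothCompleteIntersection (RelDeRham.poly d lam)) (u : Fin N →₀ ℕ) :
    (∃! ω, RelDeRham.IsOmega (RelDeRham.poly d lam) u ω) ∧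
      ∀ ω, RelDeRham.IsOmega (RelDeRham.poly d lam) u ω →
        ∃ hω : RelDeRham.extD R (RelDeRham.CoordRing (RelDeRham.poly d lam)) ω = 0,
          ∀ L ∈ RelDeRham.hypIdealOver d lam u 0,
            (hf.connection (N - r)).act L (RelDeRham.HdR.mk ω hω) = 0 := by
  have := hf.smooth
  have hmk := RelDeRham.aeval_coord (RelDeRham.poly d lam)
  have hy : Function.Surjective (MvPolynomial.aeval (RelDeRham.coord (RelDeRham.poly d lam)) :
      MvPolynomial (Fin N) R →ₐ[R] RelDeRham.CoordRing (RelDeRham.poly d lam)) := fun b => by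
    obtain ⟨p, rfl⟩ := Ideal.Quotient.mk_surjective b
    exact ⟨p, hmk p⟩
  have hk : ∀ p : MvPolynomial (Fin N) R,
      MvPolynomial.aeval (RelDeRham.coord (RelDeRham.poly d lam)) p = 0 →
        p ∈ Ideal.span (Set.range (RelDeRham.poly d lam)) := fun p hp =>
    Ideal.Quotient.eq_zero_iff_mem.mp ((hmk p).symm.trans hp)
  have h0 : ∀ j, MvPolynomial.aeval (RelDeRham.coord (RelDeRham.poly d lam))
      (RelDeRham.poly d lam j) = 0 := fun j =>
    (hmk _).trans (Ideal.Quotient.eq_zero_iff_mem.mpr (Ideal.subset_span (Set.mem_range_self j)))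
  obtain ⟨M, hM⟩ := RelDeRham.exists_jacMat_mul_eq_one hy hk h0 hf.rank
  obtain ⟨ω₀, h1, h2⟩ := RelDeRham.exists_residue_of_jacMat_mul_eq_one hy hk h0 hM u
  have h3 := RelDeRham.isOmega_of_forall_smul_eq (ω := ω₀) fun S hS => by
    rw [RelDeRham.jac_eq]
    exact h1 S hS
  have hunique : ∀ ω, RelDeRham.IsOmega (RelDeRham.poly d lam) u ω → ω = ω₀ := fun ω hω => by
    refine sub_eq_zero.mp (RelDeRham.eq_zero_of_minors_pow_smul hM fun S hS => ?_)
    obtain ⟨e, he⟩ := RelDeRham.isOmega_iff.mp hω S hS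
    refine ⟨e + 1, ?_⟩
    rw [← RelDeRham.jac_eq, pow_succ, mul_smul, smul_sub, h3, smul_sub, he, sub_self]
  refine ⟨⟨ω₀, RelDeRham.isOmega_iff.mpr fun S hS => ⟨0, by rw [h3]⟩, hunique⟩, fun ω hω => ?_⟩
  obtain rfl := hunique ω hω
  exact h2
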